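/- **Parameters.** Let $\kappa, c_v, \mathcal R_g, T_\infty, p_{\infty,*}, \rho_l, \rho_*, R_*>0$, $\sigma\ge 0$, $\mu_l\ge 0$ be real numbers with $$c_p=\gamma c_v=c_v+\mathcal R_g,\qquad p_*=\mathcal R_gT_\infty\rho_*=p_{\infty,*}+\frac{2\sigma}{R_*},\qquad \chi=\frac{\kappa}{c_p\rho_*}$$ (so $\gamma>1$), and put, for $j\ge1$, $$\bar\kappa=\frac{\chi}{R_*^2},\quad \lambda_j=(j\pi)^2,\quad \Gamma_j=\frac{2\sqrt2(\gamma-1)}{\sqrt\pi\,\gamma}\frac{(-1)^{j-1}}{j},\quad b=\frac{3p_{\infty,*}}{\rho_lR_*^2}+\frac{4\sigma}{\rho_lR_*^3},\quad d=\frac{3\gamma\mathcal R_gT_\infty}{4\pi(\gamma-1)\rho_lR_*},\quad e_j=\bar\kappa\lambda_j\frac{3\gamma^2}{4\pi(\gamma-1)}.$$ **Operator.** Let $\mathcal L_-$ be the operator on complex $\ell^2$ with maximal domain $\{\mathbf w\in\ell^2:\mathcal L_-\mathbf w\in\ell^2\}$ given, on sequences $\mathbf w=(\mathcal R,\dot{\mathcal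 R},c_1,c_2,\dots)^\top$, by the infinite matrix $$\mathcal L_-=\begin{pmatrix}0&1&0&0&\cdots\\ -b&-\frac{4\mu_l}{\rho_lR_*^2}&-d\Gamma_1&-d\Gamma_2&\cdots\\ 0&\frac{3\rho_*}{R_*}\gamma\Gamma_1&-\bar\kappa\lambda_1-e_1\Gamma_1^2&-e_2\Gamma_1\Gamma_2&\cdots\\ 0&\frac{3\rho_*}{R_*}\gamma\Gamma_2&-e_1\Gamma_1\Gamma_2&-\bar\kappa\lambda_2-e_2\Gamma_2^2&\cdots\\ \vdots&\vdots&\vdots&\vdots&\ddots\end{pmatrix}.$$ Thus $\dot{\mathbf w}=\mathcal L_-\mathbf w$ is the linearized system $\dot c_k=-\bar\kappa\lambda_kc_k-\Gamma_k\dot z$, $\ z=\frac1{\mathcal R_gT_\infty}\big(-\frac{2\sigma}{R_*^2}\mathcal R+\frac{4\mu_l}{R_*}\dot{\mathcal R}+\rho_lR_*\ddot{\mathcal R}\big)$, with $z=-\frac{3}{4\pi}\frac{\gamma}{\gamma-1}\sum_j\Gamma_jc_j-\frac{3\rho_*}{R_*}\mathcal R$. The spectrum $\sigma(\mathcal L_-)$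 is the set of $\tau\in\mathbb C$ for which $\mathcal L_--\tau I$ has no bounded inverse $\ell^2\to\mathcal D(\mathcal L_-)$. Let $P(\tau)=\rho_lR_*\tau^2+\frac{4\mu_l}{R_*}\tau-\frac{2\sigma}{R_*^2}$ and, for $\tau\notin\{-\pi^2\bar\kappa j^2:j\ge1\}$, $$Q(\tau)=\frac1{\mathcal R_gT_\infty}\Big(\frac{4\pi}3-\frac{8(\gamma-1)}{\pi\gamma}\sum_{j=1}^\infty\frac{\tau}{j^2(\pi^2\bar\kappa j^2+\tau)}\Big)P(\tau)+4\pi\frac{\rho_*}{R_*}.$$ **Decay rate.** Let $\vartheta=1-\gamma^{-1}$, $\Delta=(4\mu_l/R_*)^2-8\rho_lp_*$, $X=\frac1{\pi^2\bar\kappa}\sqrt{\frac{2p_*}{\rho_lR_*^2}}$ and, for $\varepsilon\in(0,1)$, $r_\varepsilon=4\sum_{j\ge1}\frac1{j^4+(1-\varepsilon)X^2}-\frac{4\pi^4}{90}$ and $$\beta=\beta(\varepsilon)=\min\Big\{\Big(1-\sqrt{\tfrac{\vartheta}{\frac{p_{\infty,*}R_*}{2p_{\infty,*}R_*+6\sigma}+\vartheta}}\Big)\pi^2\bar\kappa,\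 \sqrt{\varepsilon\tfrac{2p_*}{\rho_lR_*^2}},\ \frac{2\mu_l}{\rho_lR_*^2}+\mathbf 1_{\Delta\le0}\frac{(1-\varepsilon)^2\vartheta p_*}{\pi^4\bar\kappa\rho_lR_*^2}\Big(\frac{4\pi^4}{90}+r_\varepsilon\Big)-\mathbf 1_{\Delta>0}\frac{\sqrt\Delta}{2\rho_lR_*}\Big\}.$$ There is an absolute constant $K$ with $|r_\varepsilon|\le K(1-\varepsilon)^{3/4}X^{3/2}$ for all parameters and all $\varepsilon\in(0,1)$. **Proposition.** For all parameters as above: 1. $\sigma(\mathcal L_-)=\{\tau: \tau\ne-\pi^2\bar\kappa j^2\ \forall j\ge1,\ Q(\tau)=0\}\cup\{-\pi^2\bar\kappa j^2: j\ge1,\ P(-\pi^2\bar\kappa j^2)=0\}$. In particular, if $P(-\pi^2\bar\kappa j^2)\neq0$ for all $j\ge1$, then $\sigma(\mathcal L_-)=\{\tau:Q(\tau)=0\}$. 2. For every $\varepsilon\in(0,1)$, $\beta=\beta(\varepsilon)>0$, and every zero $\tau$ of $Q$ satisfies $\operatorname{Re}\tau<-\beta<0$. 3. For every $\varepsilon\in(0,1)$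 there is a constant $C$ such that $(\mathcal L_--\tau I)^{-1}$ exists and $\|(\mathcal L_--\tau I)^{-1}\|\le C$ for all $\tau$ with $\operatorname{Re}\tau\ge-\beta(\varepsilon)$. 4. $-\mathcal L_-$ is sectorial: it is closed and densely defined, and there are $a\in\mathbb R$, $\varphi\in(0,\pi/2)$, $M\ge1$ such that every $\lambda\neq a$ with $\varphi\le|\arg(\lambda-a)|\le\pi$ is in its resolvent set and $\|(\lambda+\mathcal L_-)^{-1}\|\le M/|\lambda-a|$. Moreover $\mathcal L_-$ generates an analytic semigroup $\{e^{\mathcal L_-t}\}_{t\ge0}$ (a strongly continuous semigroup of bounded operators for which $t\mapsto e^{\mathcal L_-t}\mathbf x$ is real analytic on $(0,\infty)$ for every $\mathbf x\in\ell^2$), and for every $\varepsilon\in(0,1)$ there is $C>0$ with $\|e^{\mathcal L_-t}\|\le Ce^{-\beta(\varepsilon)t}$ for all $t\ge0$. -/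

import Mathlib

open Filter Topology

noncomputable section

/-! ## Unbounded operators on a complex Banach space -/

section Operators

variable {E : Type*} [NormedAddCommGroup E] [NormedSpace ℂ E]

/-- `S` is the bounded inverse `(A - τ I)⁻¹` of the unbounded operator `A - τ I`: it maps the whole
space into the domain of `A` and is a two-sided inverse of `A - τ I`. -/
def IsResolventAt (A : E →ₗ.[ℂ] E) (τ : ℂ) (S : E →L[ℂ] E) : Prop :=
  (∀ y : E, ∃ x : A.domain, (x : E) = S y ∧ A x - τ • (x : E) = y) ∧
    ∀ x : A.domain, S (A x - τ • (x : E)) = x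

/-- The spectrum of an unbounded operator: all `τ` at which `A - τ I` has no bounded inverse. -/
def unboundedSpectrum (A : E →ₗ.[ℂ] E) : Set ℂ :=
  {τ | ¬ ∃ S : E →L[ℂ] E, IsResolventAt A τ S}

/-- Sectorial operators in the sense of Henry: `A` is closed and densely defined, and for some
`a ∈ ℝ`, `φ ∈ (0, π/2)`, `M ≥ 1` the sector `{lam ≠ a : φ ≤ |arg (lam - a)| ≤ π}` lies in the
resolvent set, with `‖(A - lam I)⁻¹‖ ≤ M / |lam - a|` there. -/
def IsSectorial (A : E →ₗ.[ℂ] E) : Prop :=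
  A.IsClosed ∧ Dense (A.domain : Set E) ∧
    ∃ a φ M : ℝ, 0 < φ ∧ φ < Real.pi / 2 ∧ 1 ≤ M ∧
      ∀ lam : ℂ, lam ≠ (a : ℂ) → φ ≤ |Complex.arg (lam - (a : ℂ))| →
        ∃ S : E →L[ℂ] E, IsResolventAt A lam S ∧ ‖S‖ ≤ M / ‖lam - (a : ℂ)‖

/-- Analytic semigroups in the sense of Henry. Only the values `T t` for `t ≥ 0` matter. -/
structure IsAnalyticSemigroup (T : ℝ → E →L[ℂ] E) : Prop where
  map_zero : T 0 = ContinuousLinearMap.id ℂ E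
  map_add : ∀ s t : ℝ, 0 ≤ s → 0 ≤ t → T (s + t) = (T s).comp (T t)
  tendsto_zero : ∀ x : E, Tendsto (fun t : ℝ => T t x) (𝓝[>] 0) (𝓝 x)
  analytic : ∀ x : E, AnalyticOnNhd ℝ (fun t : ℝ => T t x) (Set.Ioi 0)

/-- `A` is the infinitesimal generator of `T`: the domain of `A` consists of exactly those `x` for
which `(T t x - x) / t` converges as `t → 0+`, and the limit is then `A x`. -/
def IsGenerator (A : E →ₗ.[ℂ] E) (T : ℝ → E →L[ℂ] E) : Prop :=
  ∀ x y : E, (x, y) ∈ A.graph ↔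
    Tendsto (fun t : ℝ => ((t : ℂ)⁻¹) • (T t x - x)) (𝓝[>] 0) (𝓝 y)

end Operators

/-! ## Infinite matrices as operators on complex `ℓ²` -/

/-- Complex square-summable sequences, indexed by `0, 1, 2, …`. -/
abbrev EllTwo : Type := lp (fun _ : ℕ => ℂ) 2

/-- The `i`-th entry of the product of an infinite matrix with a sequence. -/
def matVec (a : ℕ → ℕ → ℂ) (w : ℕ → ℂ) (i : ℕ) : ℂ := ∑' j, a i j * w j

/-- The operator of an infinite matrix `a` on `ℓ²`, on its maximal domain
`{w ∈ ℓ² : a w is defined and a w ∈ ℓ²}`. -/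
def matrixOperator (a : ℕ → ℕ → ℂ) : EllTwo →ₗ.[ℂ] EllTwo where
  domain :=
    { carrier := {w | (∀ i, Summable fun j => a i j * w j) ∧ Memℓp (matVec a w) 2}
      add_mem' := by
        rintro v w ⟨hv, hv2⟩ ⟨hw, hw2⟩
        have key : matVec a (v + w : EllTwo) = matVec a v + matVec a w := by
          funext i
          simp only [matVec, lp.coeFn_add, Pi.add_apply, mul_add]
          exact (hv i).tsum_add (hw i)
        refine ⟨fun i => ?_, ?_⟩
        · simpa only [lp.coeFn_add, Pi.add_apply, mul_add] using (hv i).add (hw i)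
        · rw [key]
          exact hv2.add hw2
      zero_mem' := by
        have key : matVec a (0 : EllTwo) = 0 := by
          funext i
          simp [matVec]
        refine ⟨fun i => ?_, ?_⟩
        · simp
        · rw [key]
          exact zero_memℓp
      smul_mem' := by
        rintro c w ⟨hw, hw2⟩
        have key : matVec a (c • w : EllTwo) = c • matVec a w := by
          funext i
          simp only [matVec, lp.coeFn_smul, Pi.smul_apply, smul_eq_mul, ← tsum_mul_left]
          exact tsum_congr fun j => by ring
        refine ⟨fun i => ?_, ?_⟩
        · refine ((hw i).mul_left c).congr fun j => ?_
          simp only [lp.coeFn_smul, Pi.smul_apply, smul_eq_mul]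
          ring
        · rw [key]
          exact hw2.const_smul c }
  toFun :=
    { toFun := fun w => ⟨matVec a (w : EllTwo), w.2.2⟩
      map_add' := by
        rintro ⟨v, hv⟩ ⟨w, hw⟩
        apply lp.ext
        funext i
        simp only [matVec, Submodule.coe_add, lp.coeFn_add, Pi.add_apply, mul_add]
        exact (hv.1 i).tsum_add (hw.1 i)
      map_smul' := by
        rintro c ⟨w, hw⟩
        apply lp.ext
        funext i
        simp only [matVec, Submodule.coe_smul, lp.coeFn_smul, Pi.smul_apply, smul_eq_mul,
          RingHom.id_apply, ← tsum_mul_left]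
        exact tsum_congr fun j => by ring }

/-! ## The linearized bubble dynamics -/

/-- The physical parameters and the spherical equilibrium state, with their relations. -/
structure BubbleParams where
  /-- thermal conductivity -/
  kappa : ℝ
  /-- thermal diffusivity -/
  chi : ℝ
  /-- adiabatic constant -/
  gam : ℝ
  /-- heat capacity at constant volume -/
  cv : ℝ
  /-- heat capacity at constant pressure -/
  cp : ℝ
  /-- specific gas constant -/
  Rg : ℝ
  /-- far-field liquid temperature -/
  Tinf : ℝ
  /-- far-field liquid pressure -/
  pinf : ℝ
  /-- surface tension -/
  sig : ℝ
  /-- dynamic viscosity of the liquid -/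
  mul : ℝ
  /-- density of the liquid -/
  rhol : ℝ
  /-- equilibrium gas density -/
  rhos : ℝ
  /-- equilibrium gas pressure -/
  ps : ℝ
  /-- equilibrium bubble radius -/
  Rs : ℝ
  kappa_pos : 0 < kappa
  cv_pos : 0 < cv
  Rg_pos : 0 < Rg
  Tinf_pos : 0 < Tinf
  pinf_pos : 0 < pinf
  sig_nonneg : 0 ≤ sig
  mul_nonneg : 0 ≤ mul
  rhol_pos : 0 < rhol
  rhos_pos : 0 < rhos
  Rs_pos : 0 < Rs
  cp_eq : cp = gam * cv
  cp_eq' : cp = cv + Rg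
  ps_eq : ps = Rg * Tinf * rhos
  ps_eq' : ps = pinf + 2 * sig / Rs
  chi_eq : chi = kappa / (cp * rhos)

namespace BubbleParams

variable (p : BubbleParams)

/-- `κ̄ = χ / R_*²` -/
def kbar : ℝ := p.chi / p.Rs ^ 2

/-- The Dirichlet eigenvalue `λ_{j+1} = ((j+1) π)²` (indices are shifted: `j = 0, 1, …`). -/
def eig (j : ℕ) : ℝ := (((j : ℝ) + 1) * Real.pi) ^ 2

/-- `Γ_{j+1} = (γ-1)/γ ∫_{B_1} φ_{j+1} = 2√2 (γ-1) / (√π γ) · (-1)^j / (j+1)` -/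
def Gam (j : ℕ) : ℝ :=
  2 * √2 * (p.gam - 1) / (√Real.pi * p.gam) * ((-1) ^ j / ((j : ℝ) + 1))

/-- `b = 3 p_{∞,*} / (ρ_l R_*²) + 4 σ / (ρ_l R_*³)` -/
def b : ℝ := 3 * p.pinf / (p.rhol * p.Rs ^ 2) + 4 * p.sig / (p.rhol * p.Rs ^ 3)

/-- `d = 3 γ Rg T_∞ / (4 π (γ-1) ρ_l R_*)` -/
def d : ℝ := 3 * p.gam * p.Rg * p.Tinf / (4 * Real.pi * (p.gam - 1) * p.rhol * p.Rs)

/-- `e_{j+1} = κ̄ λ_{j+1} · 3 γ² / (4 π (γ-1))` -/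
def e (j : ℕ) : ℝ := p.kbar * eig j * (3 * p.gam ^ 2 / (4 * Real.pi * (p.gam - 1)))

/-- The infinite matrix of the linearized dynamics `w' = L w` of
`w = (R, R', c_1, c_2, …)`: index `0` is `R`, index `1` is `R'`, and index `k + 2` is the
coefficient `c_{k+1}`. -/
def entry : ℕ → ℕ → ℝ
  | 0, 0 => 0
  | 0, 1 => 1
  | 0, _ + 2 => 0
  | 1, 0 => -p.b
  | 1, 1 => -(4 * p.mul / (p.rhol * p.Rs ^ 2))
  | 1, j + 2 => -(p.d * p.Gam j)
  | _ + 2, 0 => 0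
  | k + 2, 1 => 3 * p.rhos / p.Rs * p.gam * p.Gam k
  | k + 2, j + 2 => (if k = j then -(p.kbar * eig k) else 0) - p.e j * p.Gam k * p.Gam j

/-- The operator `𝓛₋` on `ℓ²` with its maximal domain. -/
def generator : EllTwo →ₗ.[ℂ] EllTwo := matrixOperator fun i j => (p.entry i j : ℂ)

/-- The functional `z(w) = -(3/(4π)) (γ/(γ-1)) ∑ Γ_j c_j - (3 ρ_*/R_*) R` expressing the perturbation
of the surface density by conservation of mass. It only enters `generator_dynamics`. -/
def massZ (w : ℕ → ℂ) : ℂ :=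
  -(3 / (4 * Real.pi) * (p.gam / (p.gam - 1))) * (∑' j : ℕ, (p.Gam j : ℂ) * w (j + 2))
    - 3 * p.rhos / p.Rs * w 0

theorem one_lt_gam : 1 < p.gam := by
  have h := p.cp_eq.symm.trans p.cp_eq'
  have h1 := p.Rg_pos
  have h2 := p.cv_pos
  nlinarith

theorem hasSum_Gam_sq :
    HasSum (fun j => p.Gam j * p.Gam j)
      (4 * Real.pi * (p.gam - 1) ^ 2 / (3 * p.gam ^ 2)) := by
  have hg : p.gam ≠ 0 := by linarith [p.one_lt_gam]
  have h0 : HasSum (fun j : ℕ => 1 / ((j : ℝ) + 1) ^ 2) (Real.pi ^ 2 / 6) := by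
    have h := (hasSum_nat_add_iff' (f := fun n : ℕ => (1 : ℝ) / (n : ℝ) ^ 2) 1).mpr hasSum_zeta_two
    simpa using h
  have h1 := h0.mul_left (8 * (p.gam - 1) ^ 2 / (Real.pi * p.gam ^ 2))
  have hpi : Real.pi ≠ 0 := Real.pi_ne_zero
  have e1 : 8 * (p.gam - 1) ^ 2 / (Real.pi * p.gam ^ 2) * (Real.pi ^ 2 / 6)
      = 4 * Real.pi * (p.gam - 1) ^ 2 / (3 * p.gam ^ 2) := by
    field_simp
    ring
  rw [e1] at h1
  have hs2 : (√2 : ℝ) ^ 2 = 2 := Real.sq_sqrt (by norm_num)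
  have hsp : √Real.pi ^ 2 = Real.pi := Real.sq_sqrt Real.pi_pos.le
  have hm (j : ℕ) : ((-1 : ℝ) ^ j) ^ 2 = 1 := by
    rw [← pow_mul, mul_comm, pow_mul]
    norm_num
  refine h1.congr_fun fun j => ?_
  have e2 : p.Gam j * p.Gam j = 2 ^ 2 * √2 ^ 2 * (p.gam - 1) ^ 2 / (√Real.pi ^ 2 * p.gam ^ 2) *
      (((-1) ^ j) ^ 2 / ((j : ℝ) + 1) ^ 2) := by
    unfold Gam
    generalize (j : ℝ) + 1 = y
    ring
  rw [e2, hs2, hsp, hm]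
  ring

/-- The infinite matrix is the one of the linearized system: with `v = w'`, it encodes
`R'' = (Rg T_∞ / (ρ_l R_*)) z + (2 σ / (ρ_l R_*³)) R - (4 μ_l / (ρ_l R_*²)) R'` and
`c_k' = -κ̄ λ_k c_k - Γ_k z'`. -/
theorem generator_dynamics (w : p.generator.domain) :
    p.generator w 0 = (w : EllTwo) 1 ∧
    p.generator w 1 = p.Rg * p.Tinf / (p.rhol * p.Rs) * p.massZ (w : EllTwo)
      + 2 * p.sig / (p.rhol * p.Rs ^ 3) * (w : EllTwo) 0
      - 4 * p.mul / (p.rhol * p.Rs ^ 2) * (w : EllTwo) 1 ∧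
    ∀ k : ℕ, p.generator w (k + 2) =
      -(p.kbar * eig k) * (w : EllTwo) (k + 2) - p.Gam k * p.massZ (p.generator w) := by
  have hG : p.gam ≠ 0 := by linarith [p.one_lt_gam]
  have hG1 : p.gam - 1 ≠ 0 := by linarith [p.one_lt_gam]
  have hpi : Real.pi ≠ 0 := Real.pi_ne_zero
  have hR : p.Rs ≠ 0 := p.Rs_pos.ne'
  have hrl : p.rhol ≠ 0 := p.rhol_pos.ne'
  have hGc : (p.gam : ℂ) ≠ 0 := by exact_mod_cast hG
  have hG1c : (p.gam : ℂ) - 1 ≠ 0 := by exact_mod_cast hG1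
  have hpic : (Real.pi : ℂ) ≠ 0 := by exact_mod_cast hpi
  have hRc : (p.Rs : ℂ) ≠ 0 := by exact_mod_cast hR
  have hrlc : (p.rhol : ℂ) ≠ 0 := by exact_mod_cast hrl
  have hGam : ∀ j, (p.Gam j : ℂ) ≠ 0 := by
    intro j
    have : p.Gam j ≠ 0 := by
      unfold Gam
      have := Real.pi_pos
      positivity
    exact_mod_cast this
  obtain ⟨w, hw, hw2⟩ := w
  set x : ℕ → ℂ := fun j => w j with hx
  have hval : ∀ i, p.generator ⟨w, hw, hw2⟩ i = ∑' j, (p.entry i j : ℂ) * x j := fun i => rfl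
  have split : ∀ i, p.generator ⟨w, hw, hw2⟩ i = (p.entry i 0 : ℂ) * x 0 + (p.entry i 1 : ℂ) * x 1
      + ∑' j, (p.entry i (j + 2) : ℂ) * x (j + 2) := by
    intro i
    rw [hval, ← (hw i).sum_add_tsum_nat_add 2]
    simp [Finset.sum_range_succ, hx]
  have v0 : p.generator ⟨w, hw, hw2⟩ 0 = x 1 := by
    rw [split]
    simp [entry]
  set S : ℂ := ∑' j, (p.e j : ℂ) * p.Gam j * x (j + 2) with hS
  have hdiag : ∀ k : ℕ, HasSum
      (fun j : ℕ => (if k = j then -((p.kbar : ℂ) * eig k) else 0) * x (j + 2))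
      (-((p.kbar : ℂ) * eig k) * x (k + 2)) := by
    intro k
    have := hasSum_ite_eq k (-((p.kbar : ℂ) * eig k) * x (k + 2))
    convert this using 1
    funext j
    by_cases h : j = k
    · subst h
      simp
    · simp [h, Ne.symm h]
  have hSs : Summable fun j : ℕ => (p.e j : ℂ) * p.Gam j * x (j + 2) := by
    have h1 := (summable_nat_add_iff 2).mpr (hw 2)
    have h2 := ((hdiag 0).summable.sub h1).mul_left ((p.Gam 0 : ℂ)⁻¹)
    refine h2.congr fun j => ?_
    have := hGam 0
    simp only [entry, hx]
    push_cast
    field_simp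
    split_ifs <;> push_cast <;> ring
  set A : ℂ := 3 * p.rhos / p.Rs * p.gam * x 1 with hA
  have vk : ∀ k : ℕ, p.generator ⟨w, hw, hw2⟩ (k + 2) =
      p.Gam k * A + -((p.kbar : ℂ) * eig k) * x (k + 2) - p.Gam k * S := by
    intro k
    have h3 := ((hdiag k).sub (hSs.hasSum.mul_left (p.Gam k : ℂ))).tsum_eq
    rw [split]
    have : ∀ j, (p.entry (k + 2) (j + 2) : ℂ) * x (j + 2) =
        (if k = j then -((p.kbar : ℂ) * eig k) else 0) * x (j + 2)
          - (p.Gam k : ℂ) * ((p.e j : ℂ) * p.Gam j * x (j + 2)) := by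
      intro j
      simp only [entry]
      push_cast
      split_ifs <;> simp <;> ring
    rw [tsum_congr this, h3]
    simp only [entry, hA, hS]
    push_cast
    ring
  have hGs : HasSum (fun j => (p.Gam j : ℂ) * p.Gam j)
      (4 * Real.pi * (p.gam - 1) ^ 2 / (3 * p.gam ^ 2)) := by
    exact_mod_cast p.hasSum_Gam_sq
  refine ⟨v0, ?_, fun k => ?_⟩
  · have hrow : ∑' j, (p.entry 1 (j + 2) : ℂ) * x (j + 2)
        = -p.d * ∑' j : ℕ, (p.Gam j : ℂ) * x (j + 2) := by
      rw [← tsum_mul_left]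
      refine tsum_congr fun j => ?_
      simp only [entry]
      push_cast
      ring
    have hps : (p.Rg : ℂ) * p.Tinf * p.rhos = p.pinf + 2 * p.sig / p.Rs := by
      exact_mod_cast p.ps_eq.symm.trans p.ps_eq'
    rw [split, hrow]
    change _ = _ * (_ - _ * x 0) + _ * x 0 - _ * x 1
    simp only [entry, b, d]
    push_cast
    have hsub : (p.pinf : ℂ) = p.Rg * p.Tinf * p.rhos - 2 * p.sig / p.Rs := by
      rw [hps]
      ring
    rw [hsub]
    field_simp
    ring
  · have hz : p.massZ (p.generator ⟨w, hw, hw2⟩) = S - A := by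
      have hsum : HasSum (fun j : ℕ => (p.Gam j : ℂ) * p.generator ⟨w, hw, hw2⟩ (j + 2))
          ((A - S) * (4 * Real.pi * (p.gam - 1) ^ 2 / (3 * p.gam ^ 2))
            - (3 * p.gam ^ 2 / (4 * Real.pi * (p.gam - 1)) : ℂ)⁻¹ * S) := by
        refine ((hGs.mul_left (A - S)).sub (hSs.hasSum.mul_left
          (3 * p.gam ^ 2 / (4 * Real.pi * (p.gam - 1)) : ℂ)⁻¹)).congr_fun fun j => ?_
        rw [vk]
        simp only [e]
        push_cast
        field_simp
        ring
      unfold massZ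
      rw [hsum.tsum_eq, v0, hA]
      field_simp
      ring
    rw [hz, vk]
    simp only [hx]
    ring

/-- `P(τ) = ρ_l R_* τ² + (4 μ_l / R_*) τ - 2 σ / R_*²` -/
def P (τ : ℂ) : ℂ :=
  p.rhol * p.Rs * τ ^ 2 + 4 * p.mul / p.Rs * τ - 2 * p.sig / p.Rs ^ 2

/-- The pole `-π² κ̄ (j+1)²` of `Q`. -/
def pole (j : ℕ) : ℂ := -(Real.pi ^ 2 * p.kbar * ((j : ℂ) + 1) ^ 2)

/-- The meromorphic function `Q` (meaningful away from the points `pole j`). -/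
def Q (τ : ℂ) : ℂ :=
  1 / (p.Rg * p.Tinf) *
      (4 * Real.pi / 3 - 8 * (p.gam - 1) / (Real.pi * p.gam) *
        ∑' j : ℕ, τ / (((j : ℂ) + 1) ^ 2 * (Real.pi ^ 2 * p.kbar * ((j : ℂ) + 1) ^ 2 + τ))) *
      p.P τ
    + 4 * Real.pi * (p.rhos / p.Rs)

/-- The zeros of the meromorphic function `Q`, off the points `-π² κ̄ j²`. -/
def zerosQ : Set ℂ := {τ | (∀ j, τ ≠ p.pole j) ∧ p.Q τ = 0}

/-- The points `-π² κ̄ j²` at which the factor `P` of `Q` vanishes, so that the pole of the series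
is cancelled. For all but exceptional parameters there are none, and there is at most one. -/
def resonances : Set ℂ := {τ | (∃ j, τ = p.pole j) ∧ p.P τ = 0}

/-- `ϑ(γ) = 1 - 1/γ` -/
def vartheta : ℝ := 1 - 1 / p.gam

/-- `Δ = (4 μ_l / R_*)² - 8 ρ_l p_*` -/
def Disc : ℝ := (4 * p.mul / p.Rs) ^ 2 - 8 * p.rhol * p.ps

/-- `(1 / (π² κ̄)) √(2 p_* / (ρ_l R_*²))` -/
def ratio : ℝ := 1 / (Real.pi ^ 2 * p.kbar) * √(2 * p.ps / (p.rhol * p.Rs ^ 2))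

/-- The remainder term in the decay rate: `4 ∑_{j ≥ 1} 1 / (j⁴ + B²) - 4 π⁴ / 90`, where
`B = √(1-ε) · ratio`. -/
def remainder (ε : ℝ) : ℝ :=
  4 * ∑' j : ℕ, 1 / (((j : ℝ) + 1) ^ 4 + (√(1 - ε) * p.ratio) ^ 2) - 4 * Real.pi ^ 4 / 90

open Classical in
/-- The explicit decay rate `β`, depending on a free parameter `ε ∈ (0, 1)`. -/
def rate (ε : ℝ) : ℝ :=
  min (min
    ((1 - √(p.vartheta / (p.pinf * p.Rs / (2 * p.pinf * p.Rs + 6 * p.sig) + p.vartheta))) *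
      (Real.pi ^ 2 * p.kbar))
    √(ε * (2 * p.ps / (p.rhol * p.Rs ^ 2))))
    (2 * p.mul / (p.rhol * p.Rs ^ 2)
      + (if p.Disc ≤ 0 then
          (1 - ε) ^ 2 * p.vartheta * p.ps / (Real.pi ^ 4 * p.kbar * p.rhol * p.Rs ^ 2) *
            (4 * Real.pi ^ 4 / 90 + p.remainder ε)
        else 0)
      - (if 0 < p.Disc then √p.Disc / (2 * p.rhol * p.Rs) else 0))

end BubbleParams

end

/-! Everything reduces to scalar equations through the mass functional `z` (`massL`). In terms of
`z`, each row of the resolvent equation `𝓛₋ w = f + τ w` involves only its own mode: `w₁ = τ R +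
f₀`, `pfun τ · R - bcoef · z = …`, and `(q_k + τ) c_k = -f_k - Γ_k (z(f) + τ z)` with `q_k = κ̄
λ_k`. Solving for the `c_k` and inserting them into the definition of `z` leaves a 2×2 system for
`(R, z)`. Its determinant `detfun = yfun · pfun + bcoef · acoef` is a nonzero multiple of `Q`. Off
the poles, `τ` is therefore in the spectrum exactly when `Q τ = 0`. At a pole `-q_k`, row `k`
determines `z`, the factor `pfun` determines `R`, and `c_k` is adjusted to the mass balance, so only
the vanishing of `P` matters.

The zeros are located through the identity `γ yfun - 1 = ∑ m Γ_k² q_k / (q_k + τ)`, whose weights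
are positive with sum `γ - 1` (`hasSum_yfun`). On the half-plane of the first rate it gives `|yfun|
≤ 1 + η/2`, which excludes real zeros. At a zero off the real axis, eliminating `Re yfun` gives `Im
yfun · |pfun|² = stiff · Im pfun`. Since `Im yfun` has the sign opposite to `Im τ`, the zero is
damped more than by viscosity alone, and lower bounds on `|pfun|` quantify the gain
(`gain_lt_of_detfun_eq_zero`).

In the sector `Re τ ≥ -|Im τ|` one has `|q_k + τ| ≥ |τ|/2` and `|yfun| ≥ 1/(2γ)`, hence an a priori
bound `|τ| ‖w‖ ≤ C (‖f‖ + ‖w‖)`. For large `τ` the last term is absorbed and the resolvent is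
`O(1/|τ|)` (`exists_hasSectorEstimate`). This is sectoriality.

Openness of the resolvent set and compactness widen the half-plane `Re τ ≥ -β` to a wedge with
vertex `-β` (`HasSectorEstimate.exists_hasWedgeResolvent`). The Dunford integral of `exp(λ t)` along
wedges is the semigroup. Independence of the vertex permits the choice `-β + 1/t`, which yields the
bound `C e^{-βt}` without loss. Uniqueness of solutions of `u' = A u` identifies the semigroups
belonging to different `ε`. -/

noncomputable section

/-! ## Resolvents of unbounded operators -/

section Resolvent

variable {E : Type*} [NormedAddCommGroup E] [NormedSpace ℂ E] {A : E →ₗ.[ℂ] E}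

/-- One linear equation in `(x, y)` describes the whole graph, so domain membership and the two
inverse identities are carried together. All later resolvent computations start from this form. -/
theorem isResolventAt_iff {τ : ℂ} {S : E →L[ℂ] E} :
    IsResolventAt A τ S ↔ ∀ x y : E, (x, y) ∈ A.graph ↔ S (y - τ • x) = x := by
  constructor
  · rintro ⟨h1, h2⟩ x y
    constructor
    · intro h
      obtain ⟨x', hx, hy⟩ := LinearPMap.mem_graph_iff A |>.1 h
      have := h2 x'
      simp only at hx hy
      rwa [hy, hx] at this
    · intro h
      obtain ⟨x', hx, hy⟩ := h1 (y - τ • x)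
      rw [h] at hx
      rw [hx] at hy
      exact LinearPMap.mem_graph_iff A |>.2 ⟨x', hx, sub_left_inj.1 hy⟩
  · intro h
    constructor
    · intro y
      have : (S y, y + τ • S y) ∈ A.graph := by
        rw [h]; simp
      obtain ⟨x', hx, hy⟩ := LinearPMap.mem_graph_iff A |>.1 this
      simp only at hx hy
      exact ⟨x', hx, by rw [hx, hy]; simp⟩
    · intro x
      exact (h x (A x)).1 (LinearPMap.mem_graph A x)

theorem IsResolventAt.mem_graph {τ : ℂ} {S : E →L[ℂ] E} (h : IsResolventAt A τ S) (v : E) :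
    (S v, v + τ • S v) ∈ A.graph := by
  rw [isResolventAt_iff.1 h]; simp

/-- The first resolvent identity, for the convention `(A - τ)⁻¹`: apply `S` to the graph point
produced by `S' v`. -/
theorem IsResolventAt.identity {lam μ : ℂ} {S S' : E →L[ℂ] E} (h : IsResolventAt A lam S)
    (h' : IsResolventAt A μ S') : S - S' = (lam - μ) • (S * S') := by
  ext v
  have h1 := (isResolventAt_iff.1 h _ _).1 (h'.mem_graph v)
  have h2 : v + μ • S' v - lam • S' v = v - (lam - μ) • S' v := by
    rw [sub_smul]; abel
  rw [h2, map_sub, map_smul] at h1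
  simp only [_root_.sub_apply, _root_.smul_apply,
    mul_apply_eq_comp]
  rw [← sub_eq_zero] at h1 ⊢
  rw [← h1]; abel

theorem IsResolventAt.unique {lam : ℂ} {S S' : E →L[ℂ] E} (h : IsResolventAt A lam S)
    (h' : IsResolventAt A lam S') : S = S' := by
  have := h.identity h'
  rwa [sub_self, zero_smul, sub_eq_zero] at this

theorem IsResolventAt.neg {τ : ℂ} {S : E →L[ℂ] E} (h : IsResolventAt A (-τ) S) :
    IsResolventAt (-A) τ (-S) := by
  constructor
  · intro y
    obtain ⟨x, hx, hy⟩ := h.1 (-y)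
    refine ⟨⟨x, x.2⟩, ?_, ?_⟩
    · simp [hx]
    · rw [LinearPMap.neg_apply]
      rw [← neg_eq_iff_eq_neg] at hy
      rw [← hy]
      simp [sub_eq_add_neg, add_comm]
  · intro x
    have := h.2 ⟨x, x.2⟩
    rw [LinearPMap.neg_apply]
    simp only [_root_.neg_apply, ← map_neg]
    refine (congrArg S ?_).trans this
    simp [sub_eq_add_neg, add_comm]

/-- Neumann series: `A - lam = (1 - (lam - μ) S)` composed with `A - μ`, formally, so the new
resolvent is `u⁻¹ S` with `u = 1 - (lam - μ) S`. The norm bound comes from `S' = S + (lam - μ) S'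
S`. -/
theorem IsResolventAt.perturb [CompleteSpace E] {lam μ : ℂ} {S : E →L[ℂ] E}
    (h : IsResolventAt A μ S)
    (hl : ‖lam - μ‖ * ‖S‖ < 1) :
    ∃ S' : E →L[ℂ] E, IsResolventAt A lam S' ∧ ‖S'‖ * (1 - ‖lam - μ‖ * ‖S‖) ≤ ‖S‖ := by
  have hn : ‖(lam - μ) • S‖ < 1 := by rwa [norm_smul]
  set u := Units.oneSub ((lam - μ) • S) hn with hu
  have huv : (u : E →L[ℂ] E) = 1 - (lam - μ) • S := rfl
  have hc : Commute S (u : E →L[ℂ] E) := by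
    rw [huv]
    exact (Commute.one_right S).sub_right ((Commute.refl S).smul_right _)
  have hc' : Commute S ((u⁻¹ : (E →L[ℂ] E)ˣ) : E →L[ℂ] E) := hc.units_inv_right
  refine ⟨((u⁻¹ : (E →L[ℂ] E)ˣ) : E →L[ℂ] E) * S, ?_, ?_⟩
  · rw [isResolventAt_iff]
    intro x y
    rw [isResolventAt_iff.1 h]
    have key : S (y - μ • x) = x ↔ S (y - lam • x) = (u : E →L[ℂ] E) x := by
      rw [huv]
      simp only [map_sub, map_smul, _root_.sub_apply, _root_.smul_apply,
        one_apply_eq_self]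
      rw [sub_smul, ← sub_eq_zero, ← sub_eq_zero (a := S y - lam • S x)]
      have : S y - lam • S x - (x - (lam • S x - μ • S x)) = S y - μ • S x - x := by abel
      rw [this]
    rw [key, mul_apply_eq_comp]
    constructor
    · intro h
      rw [h, ← mul_apply_eq_comp, Units.inv_mul, one_apply_eq_self]
    · intro h
      have h' := congrArg (u : E →L[ℂ] E) h
      rwa [← mul_apply_eq_comp, Units.mul_inv, one_apply_eq_self] at h'
  · set S' : E →L[ℂ] E := ((u⁻¹ : (E →L[ℂ] E)ˣ) : E →L[ℂ] E) * S with hS'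
    have e1 : S' = S + (lam - μ) • (S' * S) := by
      have e2 : S' * (u : E →L[ℂ] E) = S := by
        rw [hS', ← hc'.eq, mul_assoc, Units.inv_mul, mul_one]
      rw [huv, mul_sub, mul_one, mul_smul_comm, sub_eq_iff_eq_add] at e2
      exact e2
    have e3 : ‖S'‖ ≤ ‖S‖ + ‖lam - μ‖ * (‖S'‖ * ‖S‖) := by
      calc ‖S'‖ = ‖S + (lam - μ) • (S' * S)‖ := by rw [← e1]
        _ ≤ ‖S‖ + ‖(lam - μ) • (S' * S)‖ := norm_add_le _ _
        _ ≤ _ := by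
          rw [norm_smul]
          gcongr
          exact norm_mul_le _ _
    linarith

/-- The set of `τ` at which `A - τ I` has a bounded inverse. -/
def resolventDomain (A : E →ₗ.[ℂ] E) : Set ℂ := {τ | ∃ S : E →L[ℂ] E, IsResolventAt A τ S}

open Classical in
/-- The resolvent `(A - τ I)⁻¹`, extended by zero. -/
def resolventFun (A : E →ₗ.[ℂ] E) (τ : ℂ) : E →L[ℂ] E :=
  if h : ∃ S : E →L[ℂ] E, IsResolventAt A τ S then h.choose else 0

theorem isResolventAt_resolventFun {τ : ℂ} (h : τ ∈ resolventDomain A) :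
    IsResolventAt A τ (resolventFun A τ) := by
  have h' : ∃ S : E →L[ℂ] E, IsResolventAt A τ S := h
  rw [resolventFun, dif_pos h']
  exact h'.choose_spec

theorem IsResolventAt.resolventFun_eq {τ : ℂ} {S : E →L[ℂ] E} (h : IsResolventAt A τ S) :
    resolventFun A τ = S :=
  (isResolventAt_resolventFun ⟨S, h⟩).unique h

variable [CompleteSpace E]

theorem eventually_resolvent {μ : ℂ} (h : μ ∈ resolventDomain A) :
    ∀ᶠ lam in 𝓝 μ, lam ∈ resolventDomain A ∧
      ‖resolventFun A lam‖ ≤ 2 * ‖resolventFun A μ‖ := by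
  have h0 := isResolventAt_resolventFun h
  have : Tendsto (fun lam : ℂ => ‖lam - μ‖ * ‖resolventFun A μ‖) (𝓝 μ) (𝓝 0) := by
    have : Continuous fun lam : ℂ => ‖lam - μ‖ * ‖resolventFun A μ‖ := by fun_prop
    simpa using this.tendsto μ
  filter_upwards [this.eventually (gt_mem_nhds (show (0 : ℝ) < 1 / 2 by norm_num))] with lam hl
  obtain ⟨S', hS', hn⟩ := h0.perturb (lam := lam) (by linarith)
  refine ⟨⟨S', hS'⟩, ?_⟩
  rw [hS'.resolventFun_eq]
  nlinarith [norm_nonneg S']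

theorem isOpen_resolventDomain : IsOpen (resolventDomain A) := by
  rw [isOpen_iff_mem_nhds]
  intro μ h
  filter_upwards [eventually_resolvent h] with lam hl using hl.1

theorem continuousAt_resolventFun {μ : ℂ} (h : μ ∈ resolventDomain A) :
    ContinuousAt (resolventFun A) μ := by
  have h0 := isResolventAt_resolventFun h
  rw [ContinuousAt, tendsto_iff_norm_sub_tendsto_zero]
  have hz : Tendsto (fun lam : ℂ => ‖lam - μ‖ * (2 * ‖resolventFun A μ‖ * ‖resolventFun A μ‖))
      (𝓝 μ) (𝓝 0) := by
    have : Continuous fun lam : ℂ =>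
      ‖lam - μ‖ * (2 * ‖resolventFun A μ‖ * ‖resolventFun A μ‖) := by fun_prop
    simpa using this.tendsto μ
  refine squeeze_zero' (Eventually.of_forall fun _ => norm_nonneg _) ?_ hz
  filter_upwards [eventually_resolvent h] with lam hl
  rw [(isResolventAt_resolventFun hl.1).identity h0, norm_smul]
  gcongr
  exact (norm_mul_le _ _).trans (by gcongr; exact hl.2)

theorem hasDerivAt_resolventFun {μ : ℂ} (h : μ ∈ resolventDomain A) :
    HasDerivAt (resolventFun A) (resolventFun A μ * resolventFun A μ) μ := by
  have h0 := isResolventAt_resolventFun h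
  rw [hasDerivAt_iff_tendsto_slope]
  have hc : Tendsto (fun lam => resolventFun A lam * resolventFun A μ) (𝓝[≠] μ)
      (𝓝 (resolventFun A μ * resolventFun A μ)) :=
    (((continuousAt_resolventFun h).mul continuousAt_const).tendsto).mono_left nhdsWithin_le_nhds
  refine hc.congr' ?_
  filter_upwards [(eventually_resolvent h).filter_mono nhdsWithin_le_nhds,
    self_mem_nhdsWithin] with lam hl hne
  rw [slope_def_module, (isResolventAt_resolventFun hl.1).identity h0, smul_smul, inv_mul_cancel₀,
    one_smul]
  exact sub_ne_zero.2 hne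

/-- A closed operator has a bounded inverse wherever `A - τ I` is bijective. -/
theorem mem_resolventDomain_of_bijective {τ : ℂ} (hA : A.IsClosed)
    (hinj : ∀ x, (x, τ • x) ∈ A.graph → x = 0) (hsurj : ∀ f, ∃ x, (x, f + τ • x) ∈ A.graph) :
    τ ∈ resolventDomain A := by
  choose s hs using hsurj
  have huniq : ∀ {f x}, (x, f + τ • x) ∈ A.graph → x = s f := by
    intro f x hx
    have h1 := A.graph.sub_mem hx (hs f)
    have h2 : ((x, f + τ • x) : E × E) - (s f, f + τ • s f) = (x - s f, τ • (x - s f)) := by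
      ext <;> simp [smul_sub]
    rw [h2] at h1
    exact sub_eq_zero.1 (hinj _ h1)
  let S : E →ₗ[ℂ] E :=
    { toFun := s
      map_add' := by
        intro f g
        symm
        apply huniq
        convert A.graph.add_mem (hs f) (hs g) using 1
        ext <;> simp [smul_add]
        abel
      map_smul' := by
        intro c f
        symm
        apply huniq
        convert A.graph.smul_mem c (hs f) using 1
        ext <;> simp [smul_add, smul_comm c τ] }
  -- The graph of the inverse is the preimage of the closed graph of `A` under `(f, x) ↦ (x, f + τ
  -- x)`. Boundedness then follows from the closed graph theorem.
  have hcl : _root_.IsClosed (S.graph : Set (E × E)) := by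
    have : (S.graph : Set (E × E)) =
        (fun v : E × E => (v.2, v.1 + τ • v.2)) ⁻¹' (A.graph : Set (E × E)) := by
      ext ⟨f, x⟩
      simp only [SetLike.mem_coe, LinearMap.mem_graph_iff, Set.mem_preimage]
      constructor
      · rintro rfl; exact hs f
      · intro h; exact huniq h
    rw [this]
    exact hA.preimage (by fun_prop)
  refine ⟨⟨S, S.continuous_of_isClosed_graph hcl⟩, isResolventAt_iff.2 fun x y => ?_⟩
  change _ ↔ s (y - τ • x) = x
  constructor
  · intro h
    exact (huniq (by simpa using h)).symm
  · intro h
    have := hs (y - τ • x)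
    rw [h] at this
    simpa using this

end Resolvent

/-! ## Laplace integrals along rays and wedges -/

section Contour

open MeasureTheory Set

variable {X : Type*} [NormedAddCommGroup X] [NormedSpace ℂ X]

/-- The integral of `exp (lam z) • r lam` along the ray `lam = c + y w`, `y > 0`. -/
def rayIntegral (w : ℂ) (r : ℂ → X) (c : ℝ) (z : ℂ) : X :=
  ∫ y in Ioi (0 : ℝ), (w * Complex.exp ((c + y * w) * z)) • r (c + y * w)

theorem norm_exp_ray (w z : ℂ) (c y : ℝ) :
    ‖Complex.exp ((c + y * w) * z)‖ = Real.exp (c * z.re) * Real.exp ((w * z).re * y) := by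
  rw [Complex.norm_exp, ← Real.exp_add]
  congr 1
  simp
  ring

theorem continuousOn_ray_integrand {w z : ℂ} {r : ℂ → X} {c : ℝ}
    (hr : ContinuousOn (fun y : ℝ => r (c + y * w)) (Ici 0)) :
    ContinuousOn (fun y : ℝ => (w * Complex.exp ((c + y * w) * z)) • r (c + y * w)) (Ioi 0) :=
  ContinuousOn.smul (Continuous.continuousOn (by fun_prop)) (hr.mono Ioi_subset_Ici_self)

theorem integrableOn_exp_const {κ : ℝ} (hκ : κ < 0) (C : ℝ) :
    IntegrableOn (fun y : ℝ => C * Real.exp (κ * y)) (Ioi 0) :=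
  (integrableOn_exp_mul_Ioi hκ 0).const_mul C

theorem integrableOn_ray {w z : ℂ} {r : ℂ → X} {c K : ℝ} (hwz : (w * z).re < 0)
    (hr : ContinuousOn (fun y : ℝ => r (c + y * w)) (Ici 0))
    (hK : ∀ y : ℝ, 0 ≤ y → ‖r (c + y * w)‖ ≤ K) :
    IntegrableOn (fun y : ℝ => (w * Complex.exp ((c + y * w) * z)) • r (c + y * w)) (Ioi 0) := by
  refine (integrableOn_exp_const hwz (‖w‖ * Real.exp (c * z.re) * K)).mono'
    ((continuousOn_ray_integrand hr).aestronglyMeasurable measurableSet_Ioi) ?_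
  refine (ae_restrict_iff' measurableSet_Ioi).2 (Eventually.of_forall fun y hy => ?_)
  rw [norm_smul, norm_mul, norm_exp_ray]
  calc _ ≤ ‖w‖ * (Real.exp (c * z.re) * Real.exp ((w * z).re * y)) * K := by
        gcongr; exact hK y (le_of_lt hy)
    _ = _ := by ring

theorem norm_rayIntegral_le {w z : ℂ} {r : ℂ → X} {c K : ℝ} (hwz : (w * z).re < 0)
    (hK : ∀ y : ℝ, 0 ≤ y → ‖r (c + y * w)‖ ≤ K) :
    ‖rayIntegral w r c z‖ ≤ ‖w‖ * Real.exp (c * z.re) * K / (-(w * z).re) := by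
  have h1 : ‖rayIntegral w r c z‖
      ≤ ∫ y in Ioi (0 : ℝ), ‖w‖ * Real.exp (c * z.re) * K * Real.exp ((w * z).re * y) := by
    refine norm_integral_le_of_norm_le (integrableOn_exp_const hwz _) ?_
    refine (ae_restrict_iff' measurableSet_Ioi).2 (Eventually.of_forall fun y hy => ?_)
    rw [norm_smul, norm_mul, norm_exp_ray]
    calc _ ≤ ‖w‖ * (Real.exp (c * z.re) * Real.exp ((w * z).re * y)) * K := by
          gcongr; exact hK y (le_of_lt hy)
      _ = _ := by ring
  refine h1.trans (le_of_eq ?_)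
  rw [integral_const_mul, integral_exp_mul_Ioi hwz]
  simp only [mul_zero, Real.exp_zero]
  ring

theorem hasDerivAt_rayIntegral {w z : ℂ} {r : ℂ → X} {c K : ℝ} (hwz : (w * z).re < 0)
    (hr : ContinuousOn (fun y : ℝ => r (c + y * w)) (Ici 0))
    (hK : ∀ y : ℝ, 0 ≤ y → ‖r (c + y * w)‖ ≤ K)
    (hK' : ∀ y : ℝ, 0 ≤ y → ‖((c : ℂ) + y * w) • r (c + y * w)‖ ≤ K) :
    HasDerivAt (rayIntegral w r c) (rayIntegral w (fun lam => lam • r lam) c z) z := by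
  -- On this neighbourhood of `z` the exponential still decays at half its rate, and the prefactor
  -- `exp (c Re ζ)` grows by at most a factor `e`. This gives one integrable majorant.
  have hs : {ζ : ℂ | (w * ζ).re < (w * z).re / 2 ∧ c * ζ.re < c * z.re + 1} ∈ 𝓝 z := by
    refine IsOpen.mem_nhds ?_ ⟨by linarith, by linarith⟩
    exact (isOpen_lt (Complex.continuous_re.comp (continuous_const.mul continuous_id))
      continuous_const).inter
      (isOpen_lt (continuous_const.mul Complex.continuous_re) continuous_const)
  have hr' : ContinuousOn (fun y : ℝ => ((c : ℂ) + y * w) • r (c + y * w)) (Ici 0) :=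
    ContinuousOn.smul (Continuous.continuousOn (by fun_prop)) hr
  refine (hasDerivAt_integral_of_dominated_loc_of_deriv_le
    (bound := fun y => ‖w‖ * Real.exp (c * z.re + 1) * K * Real.exp ((w * z).re / 2 * y))
    (μ := volume.restrict (Ioi 0))
    (F := fun ζ (y : ℝ) => (w * Complex.exp ((c + y * w) * ζ)) • r (c + y * w))
    (F' := fun ζ (y : ℝ) => (w * Complex.exp ((c + y * w) * ζ)) •
      (((c : ℂ) + y * w) • r (c + y * w))) hs
    ?_ (integrableOn_ray hwz hr hK) ?_ ?_ (integrableOn_exp_const (by linarith) _) ?_).2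
  · exact Eventually.of_forall fun ζ =>
      (continuousOn_ray_integrand hr).aestronglyMeasurable measurableSet_Ioi
  · exact (continuousOn_ray_integrand (r := fun lam => lam • r lam) hr').aestronglyMeasurable
      measurableSet_Ioi
  · refine (ae_restrict_iff' measurableSet_Ioi).2 (Eventually.of_forall fun y hy ζ hζ => ?_)
    rw [norm_smul, norm_mul, norm_exp_ray]
    have hy' : (0 : ℝ) ≤ y := le_of_lt hy
    have h0 : 0 ≤ K := (norm_nonneg _).trans (hK y hy')
    calc _ ≤ ‖w‖ * (Real.exp (c * z.re + 1) * Real.exp ((w * z).re / 2 * y)) * K := by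
          gcongr
          · exact hζ.2.le
          · exact hζ.1.le
          · exact hK' y hy'
      _ = _ := by ring
  · refine Eventually.of_forall fun y ζ _ => ?_
    have h1 : HasDerivAt (fun ζ : ℂ => w * Complex.exp ((c + y * w) * ζ))
        (w * (Complex.exp ((c + y * w) * ζ) * (c + y * w))) ζ := by
      have := (((hasDerivAt_id ζ).const_mul ((c : ℂ) + y * w)).cexp).const_mul w
      simpa using this
    have h2 := h1.smul_const (r (c + y * w))
    convert h2 using 1
    rw [smul_smul]
    congr 1
    ring

/-- The fundamental theorem of calculus along a ray. -/
theorem rayIntegral_deriv [CompleteSpace X] {w z : ℂ} {r r' : ℂ → X} {c K : ℝ}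
    (hwz : (w * z).re < 0)
    (hr : ∀ y : ℝ, 0 ≤ y → HasDerivAt r (r' (c + y * w)) (c + y * w))
    (hr' : ContinuousOn (fun y : ℝ => r' (c + y * w)) (Ici 0))
    (hK : ∀ y : ℝ, 0 ≤ y → ‖r (c + y * w)‖ ≤ K)
    (hK' : ∀ y : ℝ, 0 ≤ y → ‖r' (c + y * w)‖ ≤ K) :
    rayIntegral w (fun lam => z • r lam + r' lam) c z = -(Complex.exp (c * z) • r c) := by
  have hray : ∀ y : ℝ, HasDerivAt (fun y : ℝ => (c : ℂ) + y * w) w y := by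
    intro y
    have := ((Complex.ofRealCLM.hasDerivAt (x := y)).mul_const w).const_add (c : ℂ)
    simpa using this
  have hrc : ContinuousOn (fun y : ℝ => r (c + y * w)) (Ici 0) := fun y hy =>
    ((hr y hy).continuousAt.comp (f := fun y : ℝ => (c : ℂ) + y * w)
      (hray y).continuousAt).continuousWithinAt
  have hd : ∀ y ∈ Ici (0 : ℝ), HasDerivAt
      (fun y : ℝ => Complex.exp ((c + y * w) * z) • r (c + y * w))
      ((w * Complex.exp ((c + y * w) * z)) • (z • r (c + y * w) + r' (c + y * w))) y := by
    intro y hy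
    have h1 : HasDerivAt (fun y : ℝ => Complex.exp ((c + y * w) * z))
        (Complex.exp ((c + y * w) * z) * (w * z)) y := ((hray y).mul_const z).cexp
    have h2 : HasDerivAt (fun y : ℝ => r (c + y * w)) (w • r' (c + y * w)) y :=
      (hr y hy).scomp y (hray y)
    refine (h1.smul h2).congr_deriv ?_
    simp only [smul_add, smul_smul]
    rw [add_comm]
    congr 2 <;> ring
  have := integral_Ioi_of_hasDerivAt_of_tendsto' (m := 0) hd ?_ ?_
  · rw [rayIntegral, this]
    simp
  · exact integrableOn_ray (r := fun lam => z • r lam + r' lam) (K := ‖z‖ * K + K) hwz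
      ((hrc.const_smul z).add hr') fun y hy => by
        refine (norm_add_le _ _).trans ?_
        rw [norm_smul]
        gcongr
        · exact hK y hy
        · exact hK' y hy
  · have hlim : Tendsto (fun y : ℝ => Real.exp (c * z.re) * K * Real.exp ((w * z).re * y)) atTop
        (𝓝 0) := by
      have h1 : Tendsto (fun y : ℝ => (w * z).re * y) atTop atBot :=
        tendsto_id.const_mul_atTop_of_neg hwz
      simpa using (Real.tendsto_exp_atBot.comp h1).const_mul (Real.exp (c * z.re) * K)
    refine squeeze_zero_norm' ?_ hlim
    filter_upwards [eventually_ge_atTop 0] with y hy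
    rw [norm_smul, norm_exp_ray]
    calc _ ≤ Real.exp (c * z.re) * Real.exp ((w * z).re * y) * K := by
          gcongr; exact hK y hy
      _ = _ := by ring

/-- Moving the vertex of the ray only produces a boundary term. -/
theorem hasDerivAt_rayIntegral_vertex [CompleteSpace X] {w z : ℂ} {r r' : ℂ → X} {a c K : ℝ}
    (hac : a < c) (hwz : (w * z).re < 0)
    (hr : ∀ x : ℝ, a < x → ∀ y : ℝ, 0 ≤ y → HasDerivAt r (r' (x + y * w)) (x + y * w))
    (hr' : ContinuousOn (fun y : ℝ => r' (c + y * w)) (Ici 0))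
    (hK : ∀ x : ℝ, a < x → ∀ y : ℝ, 0 ≤ y → ‖r (x + y * w)‖ ≤ K)
    (hK' : ∀ x : ℝ, a < x → ∀ y : ℝ, 0 ≤ y → ‖r' (x + y * w)‖ ≤ K) :
    HasDerivAt (fun x : ℝ => rayIntegral w r x z) (-(Complex.exp (c * z) • r c)) c := by
  -- Differentiating the integrand in the vertex gives the integrand with `r` replaced by `z r +
  -- r'`, which is also the derivative along the ray up to the factor already present. Its integral
  -- is the boundary term.
  rw [← rayIntegral_deriv hwz (hr c hac) hr' (hK c hac) (hK' c hac)]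
  have hcont : ∀ x : ℝ, a < x → ContinuousOn (fun y : ℝ => r (x + y * w)) (Ici 0) :=
    fun x hx y hy => ((hr x hx y hy).continuousAt.comp (f := fun y : ℝ => (x : ℂ) + y * w)
      (by fun_prop)).continuousWithinAt
  have hs : {x : ℝ | a < x ∧ x * z.re < c * z.re + 1} ∈ 𝓝 c := by
    refine IsOpen.mem_nhds ?_ ⟨hac, by linarith⟩
    exact (isOpen_lt continuous_const continuous_id).inter
      (isOpen_lt (continuous_id.mul continuous_const) continuous_const)
  have hcr := (hcont c hac).const_smul z |>.add hr'
  refine (hasDerivAt_integral_of_dominated_loc_of_deriv_le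
    (bound := fun y => ‖w‖ * Real.exp (c * z.re + 1) * (‖z‖ * K + K) * Real.exp ((w * z).re * y))
    (μ := volume.restrict (Ioi 0))
    (F := fun (x : ℝ) (y : ℝ) => (w * Complex.exp ((x + y * w) * z)) • r (x + y * w))
    (F' := fun (x : ℝ) (y : ℝ) => (w * Complex.exp ((x + y * w) * z)) •
      (z • r (x + y * w) + r' (x + y * w))) hs
    ?_ (integrableOn_ray hwz (hcont c hac) (hK c hac)) ?_ ?_ (integrableOn_exp_const hwz _) ?_).2
  · filter_upwards [hs] with x hx
    exact (continuousOn_ray_integrand (hcont x hx.1)).aestronglyMeasurable measurableSet_Ioi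
  · exact (continuousOn_ray_integrand (r := fun lam => z • r lam + r' lam)
      hcr).aestronglyMeasurable measurableSet_Ioi
  · refine (ae_restrict_iff' measurableSet_Ioi).2 (Eventually.of_forall fun y hy x hx => ?_)
    rw [norm_smul, norm_mul, norm_exp_ray]
    have hy' : (0 : ℝ) ≤ y := le_of_lt hy
    calc _ ≤ ‖w‖ * (Real.exp (c * z.re + 1) * Real.exp ((w * z).re * y)) * (‖z‖ * K + K) := by
          gcongr
          · exact hx.2.le
          · refine (norm_add_le _ _).trans ?_
            rw [norm_smul]
            gcongr
            · exact hK x hx.1 y hy'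
            · exact hK' x hx.1 y hy'
      _ = _ := by ring
  · refine (ae_restrict_iff' measurableSet_Ioi).2 (Eventually.of_forall fun y hy x hx => ?_)
    have hy' : (0 : ℝ) ≤ y := le_of_lt hy
    have hpt : HasDerivAt (fun x : ℝ => (x : ℂ) + y * w) 1 x := by
      simpa using (Complex.ofRealCLM.hasDerivAt (x := x)).add_const ((y : ℂ) * w)
    have h1 : HasDerivAt (fun x : ℝ => w * Complex.exp ((x + y * w) * z))
        (w * (Complex.exp ((x + y * w) * z) * (1 * z))) x :=
      ((hpt.mul_const z).cexp).const_mul w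
    have h2 : HasDerivAt (fun x : ℝ => r (x + y * w)) ((1 : ℂ) • r' (x + y * w)) x :=
      (hr x hx.1 y hy').scomp x hpt
    refine (h1.smul h2).congr_deriv ?_
    simp only [smul_add, smul_smul]
    rw [add_comm]
    congr 2 <;> ring

/-! ### Wedge contours -/

/-- The complement of an open sector: the points to the right of a wedge with vertex `a`. -/
def wedge (a δ : ℝ) : Set ℂ := {lam | a - δ * |lam.im| ≤ lam.re}

theorem mem_wedge_ray_up {a c δ : ℝ} (h : a ≤ c) {y : ℝ} (hy : 0 ≤ y) :
    (c : ℂ) + y * ⟨-δ, 1⟩ ∈ wedge a δ := by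
  simp only [wedge, mem_ofPred_eq]
  simp [abs_of_nonneg hy]
  nlinarith

theorem mem_wedge_ray_down {a c δ : ℝ} (h : a ≤ c) {y : ℝ} (hy : 0 ≤ y) :
    (c : ℂ) + y * ⟨-δ, -1⟩ ∈ wedge a δ := by
  simp only [wedge, mem_ofPred_eq]
  simp [abs_of_nonneg hy]
  nlinarith

/-- The integral of `exp (lam z) • r lam` along the wedge with vertex `c`. -/
def wedgeIntegral (δ : ℝ) (r : ℂ → X) (c : ℝ) (z : ℂ) : X :=
  rayIntegral ⟨-δ, 1⟩ r c z - rayIntegral ⟨-δ, -1⟩ r c z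

theorem re_ray_up_neg {δ : ℝ} {z : ℂ} (hz : |z.im| < δ * z.re) :
    ((⟨-δ, 1⟩ : ℂ) * z).re < 0 := by
  have := (abs_lt.1 hz).1
  simp [Complex.mul_re]; linarith

theorem re_ray_down_neg {δ : ℝ} {z : ℂ} (hz : |z.im| < δ * z.re) :
    ((⟨-δ, -1⟩ : ℂ) * z).re < 0 := by
  have := (abs_lt.1 hz).2
  simp [Complex.mul_re]; linarith

theorem continuousOn_wedge_up {X : Type*} [TopologicalSpace X] {a c δ : ℝ} (h : a ≤ c)
    {r : ℂ → X}
    (hr : ContinuousOn r (wedge a δ)) :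
    ContinuousOn (fun y : ℝ => r (c + y * ⟨-δ, 1⟩)) (Ici 0) :=
  hr.comp (Continuous.continuousOn (by fun_prop)) fun _ hy => mem_wedge_ray_up h hy

theorem continuousOn_wedge_down {X : Type*} [TopologicalSpace X] {a c δ : ℝ} (h : a ≤ c)
    {r : ℂ → X}
    (hr : ContinuousOn r (wedge a δ)) :
    ContinuousOn (fun y : ℝ => r (c + y * ⟨-δ, -1⟩)) (Ici 0) :=
  hr.comp (Continuous.continuousOn (by fun_prop)) fun _ hy => mem_wedge_ray_down h hy

theorem hasDerivAt_wedgeIntegral {a c δ K : ℝ} {z : ℂ} {r : ℂ → X} (hac : a ≤ c)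
    (hz : |z.im| < δ * z.re) (hr : ContinuousOn r (wedge a δ))
    (hK : ∀ lam ∈ wedge a δ, ‖r lam‖ ≤ K) (hK' : ∀ lam ∈ wedge a δ, ‖lam • r lam‖ ≤ K) :
    HasDerivAt (wedgeIntegral δ r c) (wedgeIntegral δ (fun lam => lam • r lam) c z) z :=
  (hasDerivAt_rayIntegral (re_ray_up_neg hz) (continuousOn_wedge_up hac hr)
      (fun _ hy => hK _ (mem_wedge_ray_up hac hy)) fun _ hy => hK' _ (mem_wedge_ray_up hac hy)).sub
    (hasDerivAt_rayIntegral (re_ray_down_neg hz) (continuousOn_wedge_down hac hr)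
      (fun _ hy => hK _ (mem_wedge_ray_down hac hy))
      fun _ hy => hK' _ (mem_wedge_ray_down hac hy))

/-- Stands in for Cauchy's theorem: both rays produce the same boundary term when the vertex moves,
and these cancel in the difference. -/
theorem wedgeIntegral_vertex_eq [CompleteSpace X] {a c c' δ K : ℝ} {z : ℂ} {r r' : ℂ → X}
    (hac : a < c) (hac' : a < c') (hz : |z.im| < δ * z.re)
    (hr : ∀ lam ∈ wedge a δ, HasDerivAt r (r' lam) lam) (hr' : ContinuousOn r' (wedge a δ))
    (hK : ∀ lam ∈ wedge a δ, ‖r lam‖ ≤ K) (hK' : ∀ lam ∈ wedge a δ, ‖r' lam‖ ≤ K) :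
    wedgeIntegral δ r c z = wedgeIntegral δ r c' z := by
  have hd : ∀ x ∈ Ioi a, HasDerivAt (fun x : ℝ => wedgeIntegral δ r x z) 0 x := by
    intro x hx
    have h1 := hasDerivAt_rayIntegral_vertex (w := ⟨-δ, 1⟩) (r := r) (r' := r') (K := K) hx
      (re_ray_up_neg hz)
      (fun x hx y hy => hr _ (mem_wedge_ray_up hx.le hy))
      (continuousOn_wedge_up (le_of_lt hx) hr') (fun x hx y hy => hK _ (mem_wedge_ray_up hx.le hy))
      (fun x hx y hy => hK' _ (mem_wedge_ray_up hx.le hy))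
    have h2 := hasDerivAt_rayIntegral_vertex (w := ⟨-δ, -1⟩) (r := r) (r' := r') (K := K) hx
      (re_ray_down_neg hz)
      (fun x hx y hy => hr _ (mem_wedge_ray_down hx.le hy))
      (continuousOn_wedge_down (le_of_lt hx) hr')
      (fun x hx y hy => hK _ (mem_wedge_ray_down hx.le hy))
      (fun x hx y hy => hK' _ (mem_wedge_ray_down hx.le hy))
    exact (h1.sub h2).congr_deriv (by simp)
  refine isOpen_Ioi.is_const_of_deriv_eq_zero isPreconnected_Ioi
    (fun x hx => (hd x hx).differentiableAt.differentiableWithinAt)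
    (fun x hx => (hd x hx).deriv) hac hac'

/-- The primitive `exp (lam z) / z` vanishes at both infinite ends, so each ray contributes the same
value at the common vertex. -/
theorem wedgeIntegral_const [CompleteSpace X] {c δ : ℝ} {z : ℂ} (hz : |z.im| < δ * z.re) (x : X) :
    wedgeIntegral δ (fun _ => x) c z = 0 := by
  have hz0 : z ≠ 0 := by
    rintro rfl
    simp at hz
  have h : ∀ w : ℂ, (w * z).re < 0 →
      rayIntegral w (fun _ => x) c z = -(Complex.exp (c * z) • z⁻¹ • x) := by
    intro w hw
    have := rayIntegral_deriv (r := fun _ => z⁻¹ • x) (r' := fun _ => 0) (c := c)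
      (K := ‖z⁻¹ • x‖) hw (fun y _ => hasDerivAt_const _ _) continuousOn_const
      (fun _ _ => le_rfl) (fun _ _ => by simp)
    simpa [smul_smul, hz0] using this
  rw [wedgeIntegral, h _ (re_ray_up_neg hz), h _ (re_ray_down_neg hz), sub_self]

theorem norm_wedgeIntegral_le {c δ K t : ℝ} {r : ℂ → X} (hδ : 0 < δ) (ht : 0 < t)
    (hK : ∀ y : ℝ, 0 ≤ y → ‖r (c + y * ⟨-δ, 1⟩)‖ ≤ K ∧ ‖r (c + y * ⟨-δ, -1⟩)‖ ≤ K) :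
    ‖wedgeIntegral δ r c t‖ ≤ 2 * (1 + δ) / δ * Real.exp (c * t) * K / t := by
  have hz : |(t : ℂ).im| < δ * (t : ℂ).re := by simpa using mul_pos hδ ht
  have hK0 : 0 ≤ K := (norm_nonneg _).trans (hK 0 le_rfl).1
  have hw : ∀ s : ℝ, |s| = 1 → ‖(⟨-δ, s⟩ : ℂ)‖ ≤ 1 + δ := by
    intro s hs
    refine (Complex.norm_le_abs_re_add_abs_im _).trans ?_
    simp [abs_of_pos hδ, hs, add_comm]
  have h1 := norm_rayIntegral_le (c := c) (r := r) (re_ray_up_neg hz) fun y hy => (hK y hy).1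
  have h2 := norm_rayIntegral_le (c := c) (r := r) (re_ray_down_neg hz) fun y hy => (hK y hy).2
  have e1 : -((⟨-δ, 1⟩ : ℂ) * (t : ℂ)).re = δ * t := by simp
  have e2 : -((⟨-δ, -1⟩ : ℂ) * (t : ℂ)).re = δ * t := by simp
  rw [e1] at h1
  rw [e2] at h2
  have hpos : 0 < δ * t := mul_pos hδ ht
  have h3 : ∀ s : ℝ, |s| = 1 → ‖(⟨-δ, s⟩ : ℂ)‖ * Real.exp (c * (t : ℂ).re) * K / (δ * t)
      ≤ (1 + δ) * Real.exp (c * t) * K / (δ * t) := by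
    intro s hs
    rw [Complex.ofReal_re]
    gcongr
    exact hw s hs
  calc _ ≤ _ := norm_sub_le _ _
    _ ≤ (1 + δ) * Real.exp (c * t) * K / (δ * t) + (1 + δ) * Real.exp (c * t) * K / (δ * t) :=
      add_le_add (h1.trans (h3 1 (by simp))) (h2.trans (h3 (-1) (by simp)))
    _ = _ := by field_simp; ring

theorem wedgeIntegral_sub {a c δ K K' : ℝ} {z : ℂ} {r s : ℂ → X} (hac : a ≤ c)
    (hz : |z.im| < δ * z.re) (hr : ContinuousOn r (wedge a δ)) (hs : ContinuousOn s (wedge a δ))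
    (hK : ∀ lam ∈ wedge a δ, ‖r lam‖ ≤ K) (hK' : ∀ lam ∈ wedge a δ, ‖s lam‖ ≤ K') :
    wedgeIntegral δ (fun lam => r lam - s lam) c z
      = wedgeIntegral δ r c z - wedgeIntegral δ s c z := by
  have h : ∀ w : ℂ, (w * z).re < 0 → (∀ y : ℝ, 0 ≤ y → (c : ℂ) + y * w ∈ wedge a δ) →
      rayIntegral w (fun lam => r lam - s lam) c z
        = rayIntegral w r c z - rayIntegral w s c z := by
    intro w hw hy
    have hc : ContinuousOn (fun y : ℝ => (c : ℂ) + y * w) (Ici 0) := by fun_prop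
    rw [rayIntegral, rayIntegral, rayIntegral, ← integral_sub
      (integrableOn_ray hw (hr.comp hc hy) fun y h => hK _ (hy y h))
      (integrableOn_ray hw (hs.comp hc hy) fun y h => hK' _ (hy y h))]
    simp only [smul_sub]
  rw [wedgeIntegral, wedgeIntegral, wedgeIntegral,
    h _ (re_ray_up_neg hz) fun y hy => mem_wedge_ray_up hac hy,
    h _ (re_ray_down_neg hz) fun y hy => mem_wedge_ray_down hac hy]
  abel

theorem wedgeIntegral_comp {Y : Type*} [NormedAddCommGroup Y] [NormedSpace ℂ Y] [CompleteSpace X]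
    [CompleteSpace Y] (Φ : X →L[ℂ] Y) {a c δ K : ℝ} {z : ℂ} {r : ℂ → X} (hac : a ≤ c)
    (hz : |z.im| < δ * z.re) (hr : ContinuousOn r (wedge a δ))
    (hK : ∀ lam ∈ wedge a δ, ‖r lam‖ ≤ K) :
    wedgeIntegral δ (fun lam => Φ (r lam)) c z = Φ (wedgeIntegral δ r c z) := by
  have h : ∀ w : ℂ, (w * z).re < 0 → (∀ y : ℝ, 0 ≤ y → (c : ℂ) + y * w ∈ wedge a δ) →
      rayIntegral w (fun lam => Φ (r lam)) c z = Φ (rayIntegral w r c z) := by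
    intro w hw hy
    have hc : ContinuousOn (fun y : ℝ => (c : ℂ) + y * w) (Ici 0) := by fun_prop
    rw [rayIntegral, rayIntegral, ← Φ.integral_comp_comm
      (integrableOn_ray hw (hr.comp hc hy) fun y h => hK _ (hy y h))]
    simp only [map_smul]
  rw [wedgeIntegral, wedgeIntegral, map_sub,
    h _ (re_ray_up_neg hz) fun y hy => mem_wedge_ray_up hac hy,
    h _ (re_ray_down_neg hz) fun y hy => mem_wedge_ray_down hac hy]

/-- Keeps the contour away from points of the real axis to the left of the vertex; it follows from
`Re (lam - b) + δ |Im lam| ≥ a - b`. -/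
theorem le_norm_of_mem_wedge {a δ : ℝ} (hδ : 0 ≤ δ) {b : ℝ} {lam : ℂ} (h : lam ∈ wedge a δ) :
    a - b ≤ (1 + δ) * ‖lam - b‖ := by
  have h1 : |(lam - b).re| ≤ ‖lam - b‖ := Complex.abs_re_le_norm _
  have h2 : |(lam - b).im| ≤ ‖lam - b‖ := Complex.abs_im_le_norm _
  simp only [wedge, mem_ofPred_eq] at h
  simp only [Complex.sub_re, Complex.ofReal_re, Complex.sub_im, Complex.ofReal_im, sub_zero]
    at h1 h2
  have h3 := le_abs_self (lam.re - b)
  have h4 := mul_le_mul_of_nonneg_left h2 hδ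
  linarith

end Contour

/-! ### The wedge integral of `1 / lam` -/

section WedgeInv

open MeasureTheory Set

variable {X : Type*} [NormedAddCommGroup X] [NormedSpace ℂ X]

theorem rayIntegral_shift (w : ℂ) (r : ℂ → X) (c b : ℝ) (z : ℂ) :
    rayIntegral w r (c + b) z
      = Complex.exp (b * z) • rayIntegral w (fun lam => r (lam + b)) c z := by
  rw [rayIntegral, rayIntegral, ← integral_smul]
  refine integral_congr_ae (Eventually.of_forall fun y => ?_)
  simp only [smul_smul]
  have h : ((c + b : ℝ) : ℂ) + y * w = c + y * w + b := by push_cast; ring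
  rw [h]
  congr 1
  rw [add_mul (_ + _), Complex.exp_add]
  ring

theorem rayIntegral_congr {w : ℂ} {r s : ℂ → X} {c : ℝ} {z : ℂ}
    (h : ∀ y : ℝ, 0 ≤ y → r (c + y * w) = s (c + y * w)) :
    rayIntegral w r c z = rayIntegral w s c z := by
  refine setIntegral_congr_fun measurableSet_Ioi fun y hy => ?_
  rw [h y (le_of_lt hy)]

theorem wedgeIntegral_congr {a δ c : ℝ} {r s : ℂ → X} {z : ℂ} (hac : a ≤ c)
    (h : ∀ lam ∈ wedge a δ, r lam = s lam) :
    wedgeIntegral δ r c z = wedgeIntegral δ s c z := by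
  rw [wedgeIntegral, wedgeIntegral, rayIntegral_congr fun y hy => h _ (mem_wedge_ray_up hac hy),
    rayIntegral_congr fun y hy => h _ (mem_wedge_ray_down hac hy)]

theorem wedgeIntegral_shift (δ : ℝ) (r : ℂ → X) (c b : ℝ) (z : ℂ) :
    wedgeIntegral δ r (c + b) z
      = Complex.exp (b * z) • wedgeIntegral δ (fun lam => r (lam + b)) c z := by
  rw [wedgeIntegral, wedgeIntegral, rayIntegral_shift, rayIntegral_shift, smul_sub]

/-- An integrable majorant independent of the exponential factor. It is obtained from `1 + y ≤ 2
|u|` and `1 + y ≤ (2 + δ) |u + 2|`, where `u` is the point of the ray with vertex `-1`. -/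
theorem norm_inv_mul_ray_le {δ s : ℝ} (hδ : 0 < δ) (hs : |s| = 1) {y : ℝ} (hy : 0 ≤ y) :
    ‖(((-1 : ℝ) + y * ⟨-δ, s⟩ : ℂ) * ((-1 : ℝ) + y * ⟨-δ, s⟩ + 2))⁻¹‖
      ≤ 2 * (2 + δ) * (1 + y ^ 2)⁻¹ := by
  set u : ℂ := ((-1 : ℝ) + y * ⟨-δ, s⟩ : ℂ) with hu
  have h1 := Complex.abs_re_le_norm u
  have h2 := Complex.abs_im_le_norm u
  have h3 := Complex.abs_re_le_norm (u + 2)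
  have h4 := Complex.abs_im_le_norm (u + 2)
  have e1 : u.re = -1 - δ * y := by simp [hu]; ring
  have e2 : u.im = s * y := by simp [hu]; ring
  have e3 : (u + 2).re = 1 - δ * y := by simp [e1]; ring
  have e4 : (u + 2).im = s * y := by simp [e2]
  rw [e1, abs_of_nonpos (by nlinarith)] at h1
  rw [e2, abs_mul, hs, abs_of_nonneg hy, one_mul] at h2
  rw [e4, abs_mul, hs, abs_of_nonneg hy, one_mul] at h4
  rw [e3] at h3
  have h3' := (le_abs_self _).trans h3
  have hδy : 0 ≤ δ * y := by positivity
  have hA : (1 + y) ≤ 2 * ‖u‖ := by linarith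
  have hB : (1 + y) ≤ (2 + δ) * ‖u + 2‖ := by nlinarith
  have hC : 1 + y ^ 2 ≤ 2 * (2 + δ) * ‖u * (u + 2)‖ := by
    rw [norm_mul]
    have := mul_le_mul hA hB (by linarith) (by positivity)
    nlinarith
  have hpos : 0 < ‖u * (u + 2)‖ := by
    have h0 : (0 : ℝ) < 2 * (2 + δ) := by positivity
    by_contra hcon
    have := norm_nonneg (u * (u + 2))
    have : ‖u * (u + 2)‖ = 0 := le_antisymm (not_lt.1 hcon) this
    rw [this] at hC
    nlinarith
  rw [norm_inv, ← div_eq_mul_inv, inv_le_comm₀ hpos (by positivity), inv_div,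
    div_le_iff₀ (by positivity)]
  linarith

/-- The factor `y > 0` is pulled out of both logarithms, and the two copies of `log y` cancel. -/
theorem tendsto_log_ray {w : ℂ} (hw : w ∈ Complex.slitPlane) (hw' : -w ∈ Complex.slitPlane) :
    Tendsto (fun y : ℝ => Complex.log (1 - y * w) - Complex.log (1 + y * w)) atTop
      (𝓝 (Complex.log (-w) - Complex.log w)) := by
  have hinv : Tendsto (fun y : ℝ => ((y⁻¹ : ℝ) : ℂ)) atTop (𝓝 0) := by
    have := (Complex.continuous_ofReal.tendsto 0).comp tendsto_inv_atTop_zero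
    simpa [Function.comp_def] using this
  have h : ∀ v : ℂ, v ∈ Complex.slitPlane →
      Tendsto (fun y : ℝ => Complex.log (((y⁻¹ : ℝ) : ℂ) + v)) atTop (𝓝 (Complex.log v)) := by
    intro v hv
    have h1 : Tendsto (fun y : ℝ => ((y⁻¹ : ℝ) : ℂ) + v) atTop (𝓝 v) := by
      simpa using hinv.add_const v
    exact (continuousAt_clog hv).tendsto.comp h1
  refine ((h _ hw').sub (h _ hw)).congr' ?_
  have hne : ∀ v : ℂ, v ∈ Complex.slitPlane → ∀ᶠ y : ℝ in atTop, ((y⁻¹ : ℝ) : ℂ) + v ≠ 0 := by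
    intro v hv
    have h1 : Tendsto (fun y : ℝ => ((y⁻¹ : ℝ) : ℂ) + v) atTop (𝓝 v) := by
      simpa using hinv.add_const v
    exact h1.eventually_ne (Complex.slitPlane_ne_zero hv)
  filter_upwards [eventually_gt_atTop 0, hne _ hw, hne _ hw'] with y hy h1 h2
  have hyc : (y : ℂ) ≠ 0 := by exact_mod_cast hy.ne'
  have e1 : (1 : ℂ) - y * w = (y : ℝ) * (((y⁻¹ : ℝ) : ℂ) + -w) := by
    push_cast; field_simp; ring
  have e2 : (1 : ℂ) + y * w = (y : ℝ) * (((y⁻¹ : ℝ) : ℂ) + w) := by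
    push_cast; field_simp
  rw [e1, e2, Complex.log_ofReal_mul hy h2, Complex.log_ofReal_mul hy h1]
  ring

/-- The limit of the ray integral of `1 / (lam (lam + 2))` as the exponential factor disappears. -/
theorem tendsto_rayIntegral_inv_mul {δ s : ℝ} (hδ : 0 < δ) (hs : |s| = 1) :
    Tendsto (fun t : ℝ => rayIntegral ⟨-δ, s⟩ (fun lam => (lam * (lam + 2))⁻¹) (-1) t) (𝓝[>] 0)
      (𝓝 ((Complex.log (-⟨-δ, s⟩) - Complex.log ⟨-δ, s⟩) / 2)) := by
  set w : ℂ := ⟨-δ, s⟩ with hw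
  have hs0 : s ≠ 0 := by rintro rfl; simp at hs
  have hcont : Continuous (fun y : ℝ => ((-1 : ℝ) : ℂ) + y * w) := by fun_prop
  have hne1 : ∀ y : ℝ, 0 ≤ y → (1 : ℂ) - y * w ∈ Complex.slitPlane := by
    intro y hy
    left
    simp [hw]
    nlinarith
  have hne2 : ∀ y : ℝ, 0 ≤ y → (1 : ℂ) + y * w ∈ Complex.slitPlane := by
    intro y hy
    rcases hy.eq_or_lt with rfl | hy
    · simp
    · right
      simp [hw, hs0, hy.ne']
  have hne3 : ∀ y : ℝ, 0 ≤ y → (((-1 : ℝ) : ℂ) + y * w) ≠ 0 := by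
    intro y hy h
    refine Complex.slitPlane_ne_zero (hne1 y hy) ?_
    push_cast at h
    linear_combination -h
  have hne4 : ∀ y : ℝ, 0 ≤ y → (((-1 : ℝ) : ℂ) + y * w + 2) ≠ 0 := by
    intro y hy h
    refine Complex.slitPlane_ne_zero (hne2 y hy) ?_
    push_cast at h
    linear_combination h
  have hrc : ContinuousOn (fun y : ℝ => ((((-1 : ℝ) : ℂ) + y * w) *
      (((-1 : ℝ) : ℂ) + y * w + 2))⁻¹) (Ici 0) :=
    ContinuousOn.inv₀ (Continuous.continuousOn (by fun_prop))
      fun y hy => mul_ne_zero (hne3 y hy) (hne4 y hy)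
  have hdom : Integrable (fun y : ℝ => ‖w‖ * (2 * (2 + δ) * (1 + y ^ 2)⁻¹))
      (volume.restrict (Ioi 0)) :=
    ((integrable_inv_one_add_sq.const_mul _).const_mul _).restrict
  have hbd : ∀ y : ℝ, 0 ≤ y → ‖((((-1 : ℝ) : ℂ) + y * w) *
      (((-1 : ℝ) : ℂ) + y * w + 2))⁻¹‖ ≤ 2 * (2 + δ) * (1 + y ^ 2)⁻¹ :=
    fun y hy => norm_inv_mul_ray_le hδ hs hy
  have hlim : Tendsto (fun t : ℝ => rayIntegral w (fun lam => (lam * (lam + 2))⁻¹) (-1) t)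
      (𝓝[>] 0) (𝓝 (∫ y in Ioi (0 : ℝ), w * ((((-1 : ℝ) : ℂ) + y * w) *
        (((-1 : ℝ) : ℂ) + y * w + 2))⁻¹)) := by
    refine tendsto_integral_filter_of_dominated_convergence _ ?_ ?_ hdom ?_
    · refine Eventually.of_forall fun t => ?_
      exact (continuousOn_ray_integrand (z := t) (r := fun lam => (lam * (lam + 2))⁻¹)
        hrc).aestronglyMeasurable measurableSet_Ioi
    · filter_upwards [self_mem_nhdsWithin] with t ht
      have ht : 0 < t := ht
      refine (ae_restrict_iff' measurableSet_Ioi).2 (Eventually.of_forall fun y hy => ?_)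
      have hy' : (0 : ℝ) ≤ y := le_of_lt hy
      rw [norm_smul, norm_mul, norm_exp_ray]
      have h1 : Real.exp (-1 * (t : ℂ).re) * Real.exp ((w * (t : ℂ)).re * y) ≤ 1 := by
        rw [← Real.exp_add, Real.exp_le_one_iff]
        have : (w * (t : ℂ)).re = -(δ * t) := by simp [hw]
        rw [this, Complex.ofReal_re]
        have : 0 ≤ δ * t * y := by positivity
        linarith
      calc _ ≤ ‖w‖ * 1 * (2 * (2 + δ) * (1 + y ^ 2)⁻¹) := by
            gcongr
            exact hbd y hy'
        _ = _ := by ring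
    · refine Eventually.of_forall fun y => ?_
      have hc : Continuous (fun t : ℝ => (w * Complex.exp (((-1 : ℝ) + y * w) * (t : ℂ))) •
          ((((-1 : ℝ) : ℂ) + y * w) * (((-1 : ℝ) : ℂ) + y * w + 2))⁻¹) := by fun_prop
      have := (hc.tendsto 0).mono_left (nhdsWithin_le_nhds (s := Ioi 0))
      simpa using this
  have hval : ∫ y in Ioi (0 : ℝ), w * ((((-1 : ℝ) : ℂ) + y * w) *
        (((-1 : ℝ) : ℂ) + y * w + 2))⁻¹ = (Complex.log (-w) - Complex.log w) / 2 - 0 := by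
    have hd : ∀ y ∈ Ici (0 : ℝ), HasDerivAt
        (fun y : ℝ => (Complex.log (1 - y * w) - Complex.log (1 + y * w)) / 2)
        (w * ((((-1 : ℝ) : ℂ) + y * w) * (((-1 : ℝ) : ℂ) + y * w + 2))⁻¹) y := by
      intro y hy
      have hlin : HasDerivAt (fun y : ℝ => (y : ℂ) * w) w y := by
        simpa using (Complex.ofRealCLM.hasDerivAt (x := y)).mul_const w
      have h1 := (hlin.const_sub 1).clog_real (hne1 y hy)
      have h2 := (hlin.const_add 1).clog_real (hne2 y hy)
      refine ((h1.sub h2).div_const 2).congr_deriv ?_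
      have i1 := Complex.slitPlane_ne_zero (hne1 y hy)
      have i2 := Complex.slitPlane_ne_zero (hne2 y hy)
      have e1 : ((-1 : ℝ) : ℂ) + y * w = -(1 - y * w) := by push_cast; ring
      have e2 : -(1 - (y : ℂ) * w) + 2 = 1 + y * w := by ring
      rw [e1, e2]
      generalize (y : ℂ) * w = v at *
      field_simp
      ring
    have := integral_Ioi_of_hasDerivAt_of_tendsto' hd ?_
      ((tendsto_log_ray (w := w) (Or.inr (by simp [hw, hs0]))
        (Or.inr (by simp [hw, hs0]))).div_const
        2)
    · rw [this]; simp
    · refine hdom.mono' ((ContinuousOn.mul continuousOn_const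
        (hrc.mono Ioi_subset_Ici_self)).aestronglyMeasurable measurableSet_Ioi) ?_
      refine (ae_restrict_iff' measurableSet_Ioi).2 (Eventually.of_forall fun y hy => ?_)
      rw [norm_mul]
      gcongr
      exact hbd y (le_of_lt hy)
  rw [hval, sub_zero] at hlim
  exact hlim

theorem log_neg_sub_log_of_im_pos {w : ℂ} (hw : 0 < w.im) :
    Complex.log (-w) - Complex.log w = -(Real.pi * Complex.I) := by
  rw [Complex.log, Complex.log, norm_neg, Complex.arg_neg_eq_arg_sub_pi_of_im_pos hw]
  push_cast
  ring

theorem log_neg_sub_log_of_im_neg {w : ℂ} (hw : w.im < 0) :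
    Complex.log (-w) - Complex.log w = Real.pi * Complex.I := by
  rw [Complex.log, Complex.log, norm_neg, Complex.arg_neg_eq_arg_add_pi_of_im_neg hw]
  push_cast
  ring

/-- The normalisation of the Dunford integral, obtained without residues. The integral `n` of `exp
(lam t) / lam` has derivative the integral of `exp (lam t)`, which is zero, so `n` is constant. Its
limit at `t = 0` is not accessible by domination, since `1 / lam` is not integrable on the rays.
Instead `G`, built from `1 / (lam (lam + 2))` with the vertex `-1` between the two poles, satisfies
`G' = e^{-2t} n` by a shift of the contour. Hence `G + e^{-2t} n / 2` is constant. It tends to `0`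
at infinity and to `-π i + n / 2` at zero. -/
theorem wedgeIntegral_inv_one {δ t : ℝ} (hδ : 0 < δ) (ht : 0 < t) :
    wedgeIntegral δ (fun lam : ℂ => lam⁻¹) 1 t = 2 * Real.pi * Complex.I := by
  have hz : ∀ t : ℝ, 0 < t → |(t : ℂ).im| < δ * (t : ℂ).re := fun t ht => by
    simpa using mul_pos hδ ht
  have hge : ∀ lam ∈ wedge 1 δ, 1 ≤ (1 + δ) * ‖lam‖ := fun lam h => by
    simpa using le_norm_of_mem_wedge hδ.le (b := 0) h
  have hne : ∀ lam ∈ wedge 1 δ, lam ≠ 0 := by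
    rintro lam h rfl
    have := hge 0 h
    simp at this
    linarith
  set n : ℝ → ℂ := fun t => wedgeIntegral δ (fun lam : ℂ => lam⁻¹) 1 t with hn
  have hn' : ∀ t : ℝ, 0 < t → HasDerivAt n 0 t := by
    intro t ht
    have h1 := hasDerivAt_wedgeIntegral (a := 1) (c := 1) (K := 1 + δ) (r := fun lam : ℂ => lam⁻¹)
      le_rfl (hz t ht)
      (continuousOn_id.inv₀ hne) (fun lam h => by
        rw [norm_inv, inv_le_iff_one_le_mul₀ (norm_pos_iff.2 (hne lam h))]
        linarith [hge lam h]) (fun lam h => by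
        rw [smul_eq_mul, mul_inv_cancel₀ (hne lam h)]
        simp [hδ.le])
    have h2 : wedgeIntegral δ (fun lam : ℂ => lam • lam⁻¹) 1 (t : ℂ) = 0 := by
      rw [wedgeIntegral_congr (a := 1) (s := fun _ => (1 : ℂ)) le_rfl
        fun lam h => by rw [smul_eq_mul, mul_inv_cancel₀ (hne lam h)]]
      exact wedgeIntegral_const (hz t ht) 1
    rw [h2] at h1
    exact h1.comp_ofReal
  set G : ℝ → ℂ := fun t => wedgeIntegral δ (fun lam : ℂ => (lam * (lam + 2))⁻¹) (-1) t with hG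
  have hbound : ∀ y : ℝ, 0 ≤ y → ∀ s : ℝ, |s| = 1 →
      ‖((((-1 : ℝ) : ℂ) + y * ⟨-δ, s⟩) * (((-1 : ℝ) : ℂ) + y * ⟨-δ, s⟩ + 2))⁻¹‖
        ≤ 2 * (2 + δ) := fun y hy s hs =>
    (norm_inv_mul_ray_le hδ hs hy).trans (mul_le_of_le_one_right (by positivity)
      (inv_le_one_of_one_le₀ (by nlinarith)))
  have hray : ∀ s : ℝ, |s| = 1 → ∀ y : ℝ, 0 ≤ y →
      (((-1 : ℝ) : ℂ) + y * ⟨-δ, s⟩ ≠ 0 ∧ ((-1 : ℝ) : ℂ) + y * ⟨-δ, s⟩ + 2 ≠ 0) ∧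
        1 ≤ (1 + δ) * ‖((-1 : ℝ) : ℂ) + y * ⟨-δ, s⟩ + 2‖ := by
    intro s hs y hy
    have hmem : ((-1 : ℝ) : ℂ) + y * ⟨-δ, s⟩ + 2 ∈ wedge 1 δ := by
      have e : ((-1 : ℝ) : ℂ) + y * ⟨-δ, s⟩ + 2 = ((1 : ℝ) : ℂ) + y * ⟨-δ, s⟩ := by
        push_cast; ring
      rw [e]
      rcases (abs_eq zero_le_one).1 hs with rfl | rfl
      · exact mem_wedge_ray_up le_rfl hy
      · exact mem_wedge_ray_down le_rfl hy
    refine ⟨⟨fun h => ?_, hne _ hmem⟩, hge _ hmem⟩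
    have := congrArg Complex.re h
    simp at this
    nlinarith
  have hG' : ∀ t : ℝ, 0 < t → HasDerivAt G (Complex.exp (-(2 * t)) * n t) t := by
    intro t ht
    have hd : ∀ s : ℝ, |s| = 1 → ((⟨-δ, s⟩ : ℂ) * (t : ℂ)).re < 0 →
        HasDerivAt (rayIntegral ⟨-δ, s⟩ (fun lam : ℂ => (lam * (lam + 2))⁻¹) (-1))
        (Complex.exp (-(2 * t)) * rayIntegral ⟨-δ, s⟩ (fun lam : ℂ => lam⁻¹) 1 t) (t : ℂ) := by
      intro s hs hst
      have h1 := hasDerivAt_rayIntegral (w := ⟨-δ, s⟩) (z := t)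
        (r := fun lam : ℂ => (lam * (lam + 2))⁻¹) (c := -1) (K := 2 * (2 + δ)) hst
        (ContinuousOn.inv₀ (Continuous.continuousOn (by fun_prop))
          fun y hy => mul_ne_zero (hray s hs y hy).1.1 (hray s hs y hy).1.2)
        (fun y hy => hbound y hy s hs) (fun y hy => by
          obtain ⟨⟨h1, h2⟩, h3⟩ := hray s hs y hy
          rw [smul_eq_mul, mul_inv, mul_inv_cancel_left₀ h1, norm_inv,
            inv_le_iff_one_le_mul₀ (norm_pos_iff.2 h2)]
          nlinarith [norm_nonneg (((-1 : ℝ) : ℂ) + y * ⟨-δ, s⟩ + 2)])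
      refine h1.congr_deriv ?_
      have h2 := rayIntegral_shift ⟨-δ, s⟩ (fun lam : ℂ => lam⁻¹) (-1) 2 t
      rw [show (-1 + 2 : ℝ) = 1 by norm_num] at h2
      rw [h2, smul_eq_mul, ← mul_assoc, ← Complex.exp_add]
      have e0 : (-(2 * t) + ((2 : ℝ) : ℂ) * t : ℂ) = 0 := by push_cast; ring
      rw [e0, Complex.exp_zero, one_mul]
      refine rayIntegral_congr fun y hy => ?_
      rw [smul_eq_mul, mul_inv, mul_inv_cancel_left₀ (hray s hs y hy).1.1]
      push_cast
      rfl
    have h1 := (hd 1 (by simp) (re_ray_up_neg (hz t ht))).sub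
      (hd (-1) (by simp) (re_ray_down_neg (hz t ht)))
    rw [← mul_sub] at h1
    exact h1.comp_ofReal
  have hnt : ∀ u : ℝ, 0 < u → n u = n t := fun u hu =>
    isOpen_Ioi.is_const_of_deriv_eq_zero isPreconnected_Ioi
      (fun x hx => (hn' x hx).differentiableAt.differentiableWithinAt)
      (fun x hx => (hn' x hx).deriv) hu ht
  set H : ℝ → ℂ := fun u => G u + Complex.exp (-(2 * u)) * (n t / 2) with hH
  have hH' : ∀ u ∈ Ioi (0 : ℝ), HasDerivAt H 0 u := by
    intro u hu
    have h1 : HasDerivAt (fun u : ℝ => Complex.exp (-(2 * u)))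
        (Complex.exp (-(2 * u)) * (-(2 * 1))) u :=
      (((Complex.ofRealCLM.hasDerivAt (x := u)).const_mul (2 : ℂ)).neg).cexp
    refine ((hG' u hu).add (h1.mul_const (n t / 2))).congr_deriv ?_
    rw [hnt u hu]
    ring
  have hHc : ∀ u : ℝ, 0 < u → H u = H t := fun u hu =>
    isOpen_Ioi.is_const_of_deriv_eq_zero isPreconnected_Ioi
      (fun x hx => (hH' x hx).differentiableAt.differentiableWithinAt)
      (fun x hx => (hH' x hx).deriv) hu ht
  have hexp : Tendsto (fun u : ℝ => Complex.exp (-(2 * u)) * (n t / 2)) atTop (𝓝 0) := by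
    have h1 : Tendsto (fun u : ℝ => Complex.exp (-(2 * u))) atTop (𝓝 0) := by
      rw [tendsto_zero_iff_norm_tendsto_zero]
      have h2 : Tendsto (fun u : ℝ => -(2 * u)) atTop atBot :=
        tendsto_neg_atTop_atBot.comp (tendsto_id.const_mul_atTop two_pos)
      refine (Real.tendsto_exp_atBot.comp h2).congr fun u => ?_
      rw [Complex.norm_exp]
      simp
    simpa using h1.mul_const (n t / 2)
  have hGinf : Tendsto G atTop (𝓝 0) := by
    have h2 : Tendsto (fun u : ℝ => 2 * (1 + δ) / δ * (2 * (2 + δ)) * Real.exp (-u)) atTop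
        (𝓝 0) := by
      simpa using (Real.tendsto_exp_atBot.comp tendsto_neg_atTop_atBot).const_mul
        (2 * (1 + δ) / δ * (2 * (2 + δ)))
    refine squeeze_zero_norm' ?_ h2
    filter_upwards [eventually_ge_atTop 1] with u hu
    have := norm_wedgeIntegral_le (c := -1) (r := fun lam : ℂ => (lam * (lam + 2))⁻¹)
      (K := 2 * (2 + δ)) (t := u) hδ (by linarith)
      fun y hy => ⟨hbound y hy 1 (by simp), hbound y hy (-1) (by simp)⟩
    refine this.trans ?_
    rw [div_le_iff₀ (by linarith)]
    rw [neg_one_mul]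
    have h0 : 0 ≤ 2 * (1 + δ) / δ * (2 * (2 + δ)) * Real.exp (-u) := by positivity
    nlinarith
  have hHt : H t = 0 := by
    have h1 : Tendsto H atTop (𝓝 0) := by simpa using hGinf.add hexp
    have h2 : Tendsto H atTop (𝓝 (H t)) := by
      refine tendsto_const_nhds.congr' ?_
      filter_upwards [eventually_gt_atTop 0] with u hu using (hHc u hu).symm
    exact tendsto_nhds_unique h2 h1
  have hG0 : Tendsto G (𝓝[>] 0) (𝓝 (-(Real.pi * Complex.I))) := by
    have h1 := (tendsto_rayIntegral_inv_mul hδ (s := 1) (by simp)).sub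
      (tendsto_rayIntegral_inv_mul hδ (s := -1) (by simp))
    rw [log_neg_sub_log_of_im_pos (by simp), log_neg_sub_log_of_im_neg (by simp)] at h1
    have e : -(Real.pi * Complex.I) = -(Real.pi * Complex.I) / 2 - Real.pi * Complex.I / 2 := by
      ring
    rw [e]
    exact h1
  have hE0 : Tendsto (fun u : ℝ => Complex.exp (-(2 * u)) * (n t / 2)) (𝓝[>] 0) (𝓝 (n t / 2)) := by
    have hc : Continuous (fun u : ℝ => Complex.exp (-(2 * u)) * (n t / 2)) := by fun_prop
    have := (hc.tendsto 0).mono_left (nhdsWithin_le_nhds (s := Ioi 0))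
    simpa using this
  have hH0 : Tendsto H (𝓝[>] 0) (𝓝 0) := by
    refine tendsto_const_nhds.congr' ?_
    filter_upwards [self_mem_nhdsWithin] with u hu
    rw [hHc u hu, hHt]
  have := tendsto_nhds_unique hH0 (hG0.add hE0)
  change n t = _
  linear_combination -2 * this

theorem wedgeIntegral_inv_sub {a c δ t : ℝ} (hδ : 0 < δ) (ht : 0 < t) (hac : a < c) :
    wedgeIntegral δ (fun lam : ℂ => (lam - a)⁻¹) c t
      = 2 * Real.pi * Complex.I * Complex.exp (a * t) := by
  obtain ⟨b, hb⟩ : ∃ b, b = c - a := ⟨_, rfl⟩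
  have hb0 : 0 < b := by linarith
  have hc : c = b + a := by linarith
  have hz : |(t : ℂ).im| < δ * (t : ℂ).re := by simpa using mul_pos hδ ht
  -- The wedge with vertex `min b 1 / 2` contains those with vertices `b` and `1` but still avoids
  -- the pole `0`, so the vertex can be moved from `b` to `1`.
  have hm : 0 < min b 1 / 2 := by positivity
  have hge : ∀ lam ∈ wedge (min b 1 / 2) δ, min b 1 / 2 ≤ (1 + δ) * ‖lam‖ := fun lam h => by
    simpa using le_norm_of_mem_wedge hδ.le (b := 0) h
  have hne : ∀ lam ∈ wedge (min b 1 / 2) δ, lam ≠ 0 := by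
    rintro lam h rfl
    have := hge 0 h
    rw [norm_zero, mul_zero] at this
    linarith
  have hinv : ∀ lam ∈ wedge (min b 1 / 2) δ, ‖lam⁻¹‖ ≤ (1 + δ) / (min b 1 / 2) := by
    intro lam h
    rw [norm_inv, inv_le_comm₀ (norm_pos_iff.2 (hne lam h)) (by positivity), inv_div,
      div_le_iff₀ (by positivity)]
    linarith [hge lam h]
  have h1 : wedgeIntegral δ (fun lam : ℂ => lam⁻¹) b t
      = wedgeIntegral δ (fun lam : ℂ => lam⁻¹) 1 t := by
    refine wedgeIntegral_vertex_eq (a := min b 1 / 2) (r' := fun lam : ℂ => -(lam ^ 2)⁻¹)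
      (K := (1 + δ) / (min b 1 / 2) + ((1 + δ) / (min b 1 / 2)) ^ 2) ?_ ?_ hz
      (fun lam h => hasDerivAt_inv (hne lam h)) ?_ ?_ ?_
    · have := min_le_left b 1; linarith
    · have := min_le_right b 1; linarith
    · exact ((continuousOn_id.pow 2).inv₀ fun lam h => pow_ne_zero 2 (hne lam h)).neg
    · intro lam h
      have := hinv lam h
      nlinarith [sq_nonneg ((1 + δ) / (min b 1 / 2))]
    · intro lam h
      have h1 := hinv lam h
      rw [norm_neg, ← inv_pow, norm_pow]
      have h2 := pow_le_pow_left₀ (norm_nonneg _) h1 2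
      have h3 := (norm_nonneg _).trans h1
      linarith
  rw [hc, wedgeIntegral_shift, smul_eq_mul]
  simp only [add_sub_cancel_right]
  rw [h1, wedgeIntegral_inv_one hδ ht]
  ring

end WedgeInv

/-! ## The analytic semigroup generated by a sectorial operator -/

section Semigroup

open Set

variable {E : Type*} [NormedAddCommGroup E] [NormedSpace ℂ E] {A : E →ₗ.[ℂ] E}

/-- A family of bounded operators solving `u' = A u` for positive times, with derivative `T'`. -/
structure IsEvolution (A : E →ₗ.[ℂ] E) (T T' : ℝ → E →L[ℂ] E) : Prop where
  hasDerivAt : ∀ t : ℝ, 0 < t → HasDerivAt T (T' t) t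
  mem_graph : ∀ t : ℝ, 0 < t → ∀ x : E, (T t x, T' t x) ∈ A.graph
  deriv_apply : ∀ t : ℝ, 0 < t → ∀ x y : E, (x, y) ∈ A.graph → T' t x = T t y
  bounded : ∃ C : ℝ, ∀ t : ℝ, 0 < t → t ≤ 1 → ‖T t‖ ≤ C
  tendsto_zero : ∀ x : E, Tendsto (fun t : ℝ => T t x) (𝓝[>] 0) (𝓝 x)

theorem HasDerivAt.comp_ofReal_vector {X : Type*} [NormedAddCommGroup X] [NormedSpace ℂ X]
    {f : ℂ → X} {f' : X} {t : ℝ} (h : HasDerivAt f f' t) :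
    HasDerivAt (fun s : ℝ => f s) f' t := by
  have := h.scomp t (Complex.ofRealCLM.hasDerivAt (x := t))
  exact this.congr_deriv (by simp)

theorem hasDerivAt_clm_apply_real {T : ℝ → E →L[ℂ] E} {T' : E →L[ℂ] E} {u : ℝ → E} {u' : E}
    {s : ℝ} (hT : HasDerivAt T T' s) (hu : HasDerivAt u u' s) :
    HasDerivAt (fun s => T s (u s)) (T' (u s) + T s u') s := by
  have h1 : HasDerivAt (fun s => (T s).restrictScalars ℝ) (T'.restrictScalars ℝ) s :=
    (ContinuousLinearMap.restrictScalarsL ℂ E E ℝ ℝ).hasFDerivAt.comp_hasDerivAt s hT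
  exact h1.clm_apply hu

/-- Uniqueness of the solutions of `u' = A u`. -/
theorem IsEvolution.eq_of_solution {T T' : ℝ → E →L[ℂ] E} (hT : IsEvolution A T T') {t : ℝ}
    (ht : 0 < t) {u u' : ℝ → E} {u₀ u₁ : E}
    (hu : ∀ s : ℝ, 0 < s → s < t → HasDerivAt u (u' s) s)
    (hg : ∀ s : ℝ, 0 < s → s < t → (u s, u' s) ∈ A.graph)
    (h₀ : Tendsto u (𝓝[>] 0) (𝓝 u₀)) (h₁ : Tendsto u (𝓝[<] t) (𝓝 u₁)) : T t u₀ = u₁ := by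
  -- The function `s ↦ T (t - s) (u s)` has zero derivative. Its limits at the two ends of `(0, t)`
  -- are the two sides of the claim.
  set v : ℝ → E := fun s => T (t - s) (u s) with hv
  have hv' : ∀ s ∈ Ioo 0 t, HasDerivAt v 0 s := by
    intro s hs
    have h1 : HasDerivAt (fun s => T (t - s)) (-T' (t - s)) s := by
      have := (hT.hasDerivAt (t - s) (sub_pos.2 hs.2)).scomp s ((hasDerivAt_id s).const_sub t)
      exact this.congr_deriv (by simp)
    refine (hasDerivAt_clm_apply_real h1 (hu s hs.1 hs.2)).congr_deriv ?_
    rw [neg_apply, hT.deriv_apply (t - s) (sub_pos.2 hs.2) _ _ (hg s hs.1 hs.2)]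
    simp
  have hc : ∀ s ∈ Ioo 0 t, v s = v (t / 2) := fun s hs =>
    isOpen_Ioo.is_const_of_deriv_eq_zero isPreconnected_Ioo
      (fun x hx => (hv' x hx).differentiableAt.differentiableWithinAt)
      (fun x hx => (hv' x hx).deriv) hs ⟨by linarith, by linarith⟩
  have hl : Tendsto v (𝓝[>] 0) (𝓝 (T t u₀)) := by
    have h1 : Tendsto (fun s => T (t - s)) (𝓝[>] 0) (𝓝 (T t)) := by
      have h2 : ContinuousAt T (t - 0) := by
        rw [sub_zero]; exact (hT.hasDerivAt t ht).continuousAt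
      have h3 : Tendsto (fun s => T (t - s)) (𝓝 0) (𝓝 (T (t - 0))) :=
        h2.tendsto.comp ((continuous_const.sub continuous_id).tendsto 0)
      rw [sub_zero] at h3
      exact h3.mono_left nhdsWithin_le_nhds
    exact isBoundedBilinearMap_apply.continuous.tendsto _ |>.comp (h1.prodMk_nhds h₀)
  have hr : Tendsto v (𝓝[<] t) (𝓝 u₁) := by
    obtain ⟨C, hC⟩ := hT.bounded
    have h1 : Tendsto (fun s => t - s) (𝓝[<] t) (𝓝[>] 0) := by
      refine tendsto_nhdsWithin_iff.2 ⟨?_, ?_⟩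
      · have : Tendsto (fun s => t - s) (𝓝 t) (𝓝 (t - t)) :=
          (continuous_const.sub continuous_id).tendsto t
        rw [sub_self] at this
        exact this.mono_left nhdsWithin_le_nhds
      · filter_upwards [self_mem_nhdsWithin] with s hs using sub_pos.2 (mem_Iio.1 hs)
    have h2 : Tendsto (fun s => T (t - s) u₁) (𝓝[<] t) (𝓝 u₁) := (hT.tendsto_zero u₁).comp h1
    -- Near `s = t` the family `T (t - s)` converges only strongly, so the moving argument is
    -- replaced by its limit at the cost of the uniform bound near time zero.
    have h3 : Tendsto (fun s => T (t - s) (u s - u₁)) (𝓝[<] t) (𝓝 0) := by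
      have h4 : Tendsto (fun s => C * ‖u s - u₁‖) (𝓝[<] t) (𝓝 0) := by
        simpa using (tendsto_iff_norm_sub_tendsto_zero.1 h₁).const_mul C
      refine squeeze_zero_norm' ?_ h4
      have h5 : ∀ᶠ s in 𝓝[<] t, t - 1 < s := nhdsWithin_le_nhds (lt_mem_nhds (by linarith))
      filter_upwards [self_mem_nhdsWithin, h5] with s hs hs'
      exact (T (t - s)).le_of_opNorm_le (hC _ (sub_pos.2 (mem_Iio.1 hs)) (by linarith)) _
    have h4 := h3.add h2
    rw [zero_add] at h4
    refine h4.congr fun s => ?_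
    simp [hv]
  have hl' : Tendsto v (𝓝[>] 0) (𝓝 (v (t / 2))) := by
    refine tendsto_const_nhds.congr' ?_
    filter_upwards [Ioo_mem_nhdsGT ht] with s hs using (hc s hs).symm
  have hr' : Tendsto v (𝓝[<] t) (𝓝 (v (t / 2))) := by
    refine tendsto_const_nhds.congr' ?_
    filter_upwards [Ioo_mem_nhdsLT ht] with s hs using (hc s hs).symm
  exact (tendsto_nhds_unique hl hl').trans (tendsto_nhds_unique hr' hr)

theorem IsEvolution.hasDerivAt_apply {T T' : ℝ → E →L[ℂ] E} (hT : IsEvolution A T T') {t : ℝ}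
    (ht : 0 < t) (x : E) : HasDerivAt (fun s => T s x) (T' t x) t := by
  simpa using hasDerivAt_clm_apply_real (hT.hasDerivAt t ht) (hasDerivAt_const t x)

theorem IsEvolution.unique {T T' S S' : ℝ → E →L[ℂ] E} (hT : IsEvolution A T T')
    (hS : IsEvolution A S S') {t : ℝ} (ht : 0 < t) : T t = S t := by
  ext x
  refine hT.eq_of_solution ht (u := fun s => S s x) (u' := fun s => S' s x)
    (fun s hs _ => hS.hasDerivAt_apply hs x) (fun s hs _ => hS.mem_graph s hs x)
    (hS.tendsto_zero x) ?_
  exact ((hS.hasDerivAt_apply ht x).continuousAt.tendsto).mono_left nhdsWithin_le_nhds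

/-- The shifted orbit `r ↦ T (r + t) x` is a solution starting at `T t x`, hence equals `T r (T t
x)` by uniqueness. -/
theorem IsEvolution.map_add {T T' : ℝ → E →L[ℂ] E} (hT : IsEvolution A T T') {s t : ℝ}
    (hs : 0 < s) (ht : 0 < t) : T (s + t) = (T s).comp (T t) := by
  ext x
  have hd : ∀ r : ℝ, 0 ≤ r → HasDerivAt (fun r => T (r + t) x) (T' (r + t) x) r := fun r hr => by
    have := (hT.hasDerivAt_apply (t := r + t) (by linarith) x).scomp r
      ((hasDerivAt_id r).add_const t)
    exact this.congr_deriv (by simp)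
  refine (hT.eq_of_solution hs (u := fun r => T (r + t) x) (u' := fun r => T' (r + t) x)
    (fun r hr _ => hd r hr.le) (fun r hr _ => hT.mem_graph _ (by linarith) x) ?_ ?_).symm
  · have := ((hd 0 le_rfl).continuousAt.tendsto).mono_left (nhdsWithin_le_nhds (s := Ioi 0))
    simpa using this
  · exact ((hd s hs.le).continuousAt.tendsto).mono_left nhdsWithin_le_nhds

theorem IsEvolution.isAnalyticSemigroup {T T' : ℝ → E →L[ℂ] E} (hT : IsEvolution A T T')
    (h0 : T 0 = ContinuousLinearMap.id ℂ E)
    (han : ∀ x : E, AnalyticOnNhd ℝ (fun t : ℝ => T t x) (Ioi 0)) : IsAnalyticSemigroup T where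
  map_zero := h0
  map_add := by
    intro s t hs ht
    rcases hs.eq_or_lt with rfl | hs
    · rw [zero_add, h0, ContinuousLinearMap.id_comp]
    rcases ht.eq_or_lt with rfl | ht
    · rw [add_zero, h0, ContinuousLinearMap.comp_id]
    exact hT.map_add hs ht
  tendsto_zero := hT.tendsto_zero
  analytic := han

theorem IsEvolution.commute_resolvent {T T' : ℝ → E →L[ℂ] E} (hT : IsEvolution A T T') {μ : ℂ}
    {S : E →L[ℂ] E} (hS : IsResolventAt A μ S) {t : ℝ} (ht : 0 < t) (x : E) :
    T t (S x) = S (T t x) := by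
  have h1 := hT.deriv_apply t ht _ _ (hS.mem_graph x)
  have h2 := (isResolventAt_iff.1 hS _ _).1 (hT.mem_graph t ht (S x))
  rw [h1] at h2
  rw [← h2]
  simp

/-- On the domain, the derivative `T t y` converges as `t → 0+`, so the one-sided derivative at zero
exists and equals `y`. Conversely, `S` commutes with `T` and maps into the domain: applied to a
convergent difference quotient it gives `S y = x + μ S x`, which is membership of `(x, y)` in the
graph. -/
theorem IsEvolution.isGenerator {T T' : ℝ → E →L[ℂ] E} (hT : IsEvolution A T T')
    (h0 : T 0 = ContinuousLinearMap.id ℂ E) {μ : ℂ} {S : E →L[ℂ] E} (hS : IsResolventAt A μ S) :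
    IsGenerator A T := by
  have hfwd : ∀ x y : E, (x, y) ∈ A.graph →
      Tendsto (fun t : ℝ => ((t : ℂ)⁻¹) • (T t x - x)) (𝓝[>] 0) (𝓝 y) := by
    intro x y hxy
    have hd : HasDerivWithinAt (fun t => T t x) y (Ici 0) 0 := by
      refine hasDerivWithinAt_Ici_of_tendsto_deriv (s := Ioi 0)
        (fun t ht => (hT.hasDerivAt_apply ht x).differentiableAt.differentiableWithinAt) ?_
        self_mem_nhdsWithin ?_
      · have := hT.tendsto_zero x
        simpa [ContinuousWithinAt, h0] using this
      · refine (hT.tendsto_zero y).congr' ?_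
        filter_upwards [self_mem_nhdsWithin] with t ht
        rw [(hT.hasDerivAt_apply ht x).deriv, hT.deriv_apply t ht x y hxy]
    rw [hasDerivWithinAt_iff_tendsto_slope] at hd
    rw [Ici_sdiff_left] at hd
    refine hd.congr fun t => ?_
    rw [slope_def_module, h0]
    simp [← Complex.coe_smul]
  intro x y
  refine ⟨hfwd x y, fun h => ?_⟩
  have h1 := (S.continuous.tendsto y).comp h
  have h2 : Tendsto (fun t : ℝ => ((t : ℂ)⁻¹) • (T t (S x) - S x)) (𝓝[>] 0) (𝓝 (S y)) := by
    refine h1.congr' ?_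
    filter_upwards [self_mem_nhdsWithin] with t ht
    simp [hT.commute_resolvent hS ht]
  have h3 := tendsto_nhds_unique h2 (hfwd _ _ (hS.mem_graph x))
  rw [isResolventAt_iff.1 hS, map_sub, map_smul, h3]
  simp

/-! ### The Dunford integral under a resolvent estimate on a wedge -/

variable [CompleteSpace E]

/-- `A - lam I` has a bounded inverse to the right of a wedge, decaying like `1 / |lam|`. -/
def HasWedgeResolvent (A : E →ₗ.[ℂ] E) (a δ M : ℝ) : Prop :=
  ∀ lam ∈ wedge a δ, ∃ S : E →L[ℂ] E, IsResolventAt A lam S ∧ ‖S‖ * (1 + ‖lam - a‖) ≤ M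

variable {a δ M : ℝ}

omit [CompleteSpace E] in
theorem HasWedgeResolvent.mem (h : HasWedgeResolvent A a δ M) {lam : ℂ} (hl : lam ∈ wedge a δ) :
    lam ∈ resolventDomain A :=
  (h lam hl).imp fun _ hS => hS.1

omit [CompleteSpace E] in
theorem HasWedgeResolvent.norm_mul_le (h : HasWedgeResolvent A a δ M) {lam : ℂ}
    (hl : lam ∈ wedge a δ) : ‖resolventFun A lam‖ * (1 + ‖lam - a‖) ≤ M := by
  obtain ⟨S, hS, hn⟩ := h lam hl
  rwa [hS.resolventFun_eq]

omit [CompleteSpace E] in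
theorem HasWedgeResolvent.norm_le (h : HasWedgeResolvent A a δ M) {lam : ℂ}
    (hl : lam ∈ wedge a δ) : ‖resolventFun A lam‖ ≤ M :=
  (le_mul_of_one_le_right (norm_nonneg _) (by linarith [norm_nonneg (lam - a)])).trans
    (h.norm_mul_le hl)

theorem HasWedgeResolvent.continuousOn (h : HasWedgeResolvent A a δ M) :
    ContinuousOn (resolventFun A) (wedge a δ) :=
  fun _ hl => (continuousAt_resolventFun (h.mem hl)).continuousWithinAt

omit [CompleteSpace E] in
theorem HasWedgeResolvent.norm_smul_le (h : HasWedgeResolvent A a δ M) {lam : ℂ}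
    (hl : lam ∈ wedge a δ) : ‖lam • resolventFun A lam‖ ≤ M * (1 + |a|) := by
  have h1 := h.norm_mul_le hl
  have h2 := h.norm_le hl
  have h3 : ‖lam‖ ≤ ‖lam - a‖ + |a| := by
    have := norm_add_le (lam - a) (a : ℂ)
    simpa using this
  rw [norm_smul]
  have h4 := mul_le_mul_of_nonneg_right h3 (norm_nonneg (resolventFun A lam))
  have h5 := mul_le_mul_of_nonneg_right h2 (abs_nonneg a)
  nlinarith [norm_nonneg (resolventFun A lam)]

theorem mem_wedge_vertex (a δ : ℝ) : (a : ℂ) ∈ wedge a δ := by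
  simp [wedge]

theorem wedge_subset {a b δ : ℝ} (h : a ≤ b) : wedge b δ ⊆ wedge a δ := by
  intro lam hl
  simp only [wedge, mem_ofPred_eq] at hl ⊢
  linarith

/-- The Dunford integral of the exponential. -/
def dunford (A : E →ₗ.[ℂ] E) (a δ : ℝ) (z : ℂ) : E →L[ℂ] E :=
  -(2 * Real.pi * Complex.I)⁻¹ • wedgeIntegral δ (resolventFun A) (a + 1) z

/-- The derivative of the Dunford integral. -/
def dunfordDeriv (A : E →ₗ.[ℂ] E) (a δ : ℝ) (z : ℂ) : E →L[ℂ] E :=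
  -(2 * Real.pi * Complex.I)⁻¹ • wedgeIntegral δ (fun lam => lam • resolventFun A lam) (a + 1) z

theorem two_pi_I_ne_zero' : (2 * Real.pi * Complex.I : ℂ) ≠ 0 := by
  simp [Real.pi_ne_zero]

theorem HasWedgeResolvent.hasDerivAt_dunford (h : HasWedgeResolvent A a δ M) {z : ℂ}
    (hz : |z.im| < δ * z.re) : HasDerivAt (dunford A a δ) (dunfordDeriv A a δ z) z := by
  have hM : 0 ≤ M := (norm_nonneg _).trans (h.norm_le (mem_wedge_vertex a δ))
  have h1 := hasDerivAt_wedgeIntegral (a := a) (c := a + 1) (K := M * (1 + |a|)) (by linarith) hz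
    h.continuousOn (fun lam hl => (h.norm_le hl).trans (by nlinarith [abs_nonneg a]))
    fun lam hl => h.norm_smul_le hl
  exact h1.const_smul (-(2 * Real.pi * Complex.I)⁻¹ : ℂ)

theorem HasWedgeResolvent.dunford_eq (h : HasWedgeResolvent A a δ M) {z : ℂ} {c : ℝ} (hc : a < c)
    (hz : |z.im| < δ * z.re) :
    dunford A a δ z = -(2 * Real.pi * Complex.I)⁻¹ • wedgeIntegral δ (resolventFun A) c z := by
  have hM : 0 ≤ M := (norm_nonneg _).trans (h.norm_le (mem_wedge_vertex a δ))
  rw [dunford, wedgeIntegral_vertex_eq (a := a) (c := a + 1) (c' := c) (K := M + M * M)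
    (r' := fun lam => resolventFun A lam * resolventFun A lam) (by linarith) hc hz
    (fun lam hl => hasDerivAt_resolventFun (h.mem hl)) (h.continuousOn.mul h.continuousOn)
    (fun lam hl => (h.norm_le hl).trans (by nlinarith))]
  intro lam hl
  refine (_root_.norm_mul_le (resolventFun A lam) (resolventFun A lam)).trans ?_
  have := mul_le_mul (h.norm_le hl) (h.norm_le hl) (norm_nonneg _) hM
  linarith

/-- The resolvent identity reads `R₀ (lam - a) R(lam) = R(lam) - R₀`, and the constant `R₀`
integrates to zero along the wedge. Thus `R₀ (T' - a T) = T`, which is the graph condition in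
resolvent form. -/
theorem HasWedgeResolvent.dunford_mem_graph (h : HasWedgeResolvent A a δ M) {z : ℂ}
    (hz : |z.im| < δ * z.re) (x : E) : (dunford A a δ z x, dunfordDeriv A a δ z x) ∈ A.graph := by
  have ha := mem_wedge_vertex a δ
  have hac : a ≤ a + 1 := by linarith
  have hR := isResolventAt_resolventFun (h.mem ha)
  set R₀ := resolventFun A a with hR₀
  have hcs : ContinuousOn (fun lam : ℂ => lam • resolventFun A lam) (wedge a δ) :=
    continuousOn_id.smul h.continuousOn
  have hca : ContinuousOn (fun lam : ℂ => (a : ℂ) • resolventFun A lam) (wedge a δ) :=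
    h.continuousOn.const_smul (a : ℂ)
  have hna : ∀ lam ∈ wedge a δ, ‖(a : ℂ) • resolventFun A lam‖ ≤ |a| * M := by
    intro lam hl
    rw [norm_smul, Complex.norm_real, Real.norm_eq_abs]
    exact mul_le_mul_of_nonneg_left (h.norm_le hl) (abs_nonneg a)
  have e1 : wedgeIntegral δ (fun lam => lam • resolventFun A lam - (a : ℂ) • resolventFun A lam)
      (a + 1) z = wedgeIntegral δ (fun lam => lam • resolventFun A lam) (a + 1) z
        - (a : ℂ) • wedgeIntegral δ (resolventFun A) (a + 1) z := by
    rw [wedgeIntegral_sub hac hz hcs hca (fun lam hl => h.norm_smul_le hl) hna]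
    congr 1
    exact wedgeIntegral_comp ((a : ℂ) • ContinuousLinearMap.id ℂ (E →L[ℂ] E)) hac hz
      h.continuousOn fun lam hl => h.norm_le hl
  have e2 := wedgeIntegral_comp (ContinuousLinearMap.mul ℂ (E →L[ℂ] E) R₀)
    (r := fun lam => lam • resolventFun A lam - (a : ℂ) • resolventFun A lam) hac hz (hcs.sub hca)
    fun lam hl => (norm_sub_le _ _).trans (add_le_add (h.norm_smul_le hl) (hna lam hl))
  have e3 : wedgeIntegral δ (fun lam => ContinuousLinearMap.mul ℂ (E →L[ℂ] E) R₀
      (lam • resolventFun A lam - (a : ℂ) • resolventFun A lam)) (a + 1) z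
      = wedgeIntegral δ (resolventFun A) (a + 1) z := by
    rw [wedgeIntegral_congr (s := fun lam => resolventFun A lam - R₀) hac,
      wedgeIntegral_sub hac hz h.continuousOn continuousOn_const (fun lam hl => h.norm_le hl)
        (fun _ _ => le_rfl), wedgeIntegral_const hz, sub_zero]
    intro lam hl
    have := hR.identity (isResolventAt_resolventFun (h.mem hl))
    rw [← sub_smul, ContinuousLinearMap.mul_apply', mul_smul_comm, ← neg_sub R₀, this, ← neg_smul,
      neg_sub]
  rw [e3] at e2
  have e4 : R₀ * (wedgeIntegral δ (fun lam => lam • resolventFun A lam) (a + 1) z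
        - (a : ℂ) • wedgeIntegral δ (resolventFun A) (a + 1) z)
      = wedgeIntegral δ (resolventFun A) (a + 1) z := by
    rw [← e1]
    exact e2.symm
  rw [isResolventAt_iff.1 hR]
  have e5 := congrArg (fun B : E →L[ℂ] E => -(2 * Real.pi * Complex.I)⁻¹ • B x) e4
  simp only [mul_apply_eq_comp, _root_.sub_apply, _root_.smul_apply] at e5
  rw [dunford, dunfordDeriv]
  simp only [_root_.smul_apply]
  refine Eq.trans ?_ e5
  rw [smul_comm (a : ℂ), ← smul_sub, map_smul]

theorem HasWedgeResolvent.dunford_commute (h : HasWedgeResolvent A a δ M) {z : ℂ}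
    (hz : |z.im| < δ * z.re) : dunford A a δ z * resolventFun A a
      = resolventFun A a * dunford A a δ z := by
  have ha := mem_wedge_vertex a δ
  have hac : a ≤ a + 1 := by linarith
  have hR := isResolventAt_resolventFun (h.mem ha)
  have e1 := wedgeIntegral_comp (ContinuousLinearMap.mul ℂ (E →L[ℂ] E) (resolventFun A a)) hac hz
    h.continuousOn fun lam hl => h.norm_le hl
  have e2 := wedgeIntegral_comp ((ContinuousLinearMap.mul ℂ (E →L[ℂ] E)).flip (resolventFun A a))
    hac hz h.continuousOn fun lam hl => h.norm_le hl
  have e3 : wedgeIntegral δ (fun lam => ContinuousLinearMap.mul ℂ (E →L[ℂ] E) (resolventFun A a)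
      (resolventFun A lam)) (a + 1) z = wedgeIntegral δ (fun lam =>
      (ContinuousLinearMap.mul ℂ (E →L[ℂ] E)).flip (resolventFun A a)
      (resolventFun A lam)) (a + 1) z := by
    refine wedgeIntegral_congr hac fun lam hl => ?_
    rw [ContinuousLinearMap.mul_apply', ContinuousLinearMap.flip_apply,
      ContinuousLinearMap.mul_apply']
    rcases eq_or_ne lam a with rfl | hne
    · rfl
    have h1 := hR.identity (isResolventAt_resolventFun (h.mem hl))
    have h2 := (isResolventAt_resolventFun (h.mem hl)).identity hR
    have h3 : ((a : ℂ) - lam) • (resolventFun A a * resolventFun A lam)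
        = ((a : ℂ) - lam) • (resolventFun A lam * resolventFun A a) := by
      rw [← h1, ← neg_sub lam, neg_smul, ← h2, neg_sub]
    exact smul_right_injective _ (sub_ne_zero.2 hne.symm) h3
  rw [dunford, smul_mul_assoc, mul_smul_comm]
  congr 1
  rw [e1, e2] at e3
  exact e3.symm

/-- Write `x = R₀ v` with `v = y - a x`. Since `R₀` commutes with the integral, `T x = R₀ (T v)` has
image `T v + a T x = T y` under `A`, and this image is unique. -/
theorem HasWedgeResolvent.dunfordDeriv_apply (h : HasWedgeResolvent A a δ M) {z : ℂ}
    (hz : |z.im| < δ * z.re) {x y : E} (hxy : (x, y) ∈ A.graph) :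
    dunfordDeriv A a δ z x = dunford A a δ z y := by
  have hR := isResolventAt_resolventFun (h.mem (mem_wedge_vertex a δ))
  have h1 := (isResolventAt_iff.1 hR _ _).1 hxy
  have h2 := congrArg (fun B : E →L[ℂ] E => B (y - (a : ℂ) • x)) (h.dunford_commute hz)
  simp only [mul_apply_eq_comp] at h2
  rw [h1] at h2
  have h3 := hR.mem_graph (dunford A a δ z (y - (a : ℂ) • x))
  rw [← h2] at h3
  have h4 := LinearPMap.mem_graph_snd_inj A (h.dunford_mem_graph hz x) h3 rfl
  rw [h4]
  simp

theorem le_norm_on_wedge {a δ t : ℝ} (hδ : 0 < δ) (ht : 0 < t) {lam : ℂ}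
    (hl : lam ∈ wedge (a + t⁻¹) δ) : 1 ≤ (1 + δ) * t * ‖lam - a‖ := by
  have h1 := le_norm_of_mem_wedge hδ.le (b := a) hl
  rw [add_sub_cancel_left, inv_le_iff_one_le_mul₀ ht] at h1
  linarith

omit [CompleteSpace E] in
theorem HasWedgeResolvent.norm_le_of_mem (h : HasWedgeResolvent A a δ M) (hδ : 0 < δ) {t : ℝ}
    (ht : 0 < t) {lam : ℂ} (hl : lam ∈ wedge (a + t⁻¹) δ) :
    ‖resolventFun A lam‖ ≤ M * ((1 + δ) * t) := by
  have h1 := le_norm_on_wedge hδ ht hl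
  have h2 := h.norm_mul_le (wedge_subset (by linarith [inv_pos.2 ht]) hl)
  have h3 := norm_nonneg (resolventFun A lam)
  have h5 : ‖resolventFun A lam‖ * ‖lam - a‖ ≤ M := by nlinarith
  calc ‖resolventFun A lam‖ ≤ ‖resolventFun A lam‖ * ((1 + δ) * t * ‖lam - a‖) :=
        le_mul_of_one_le_right h3 h1
    _ = ‖resolventFun A lam‖ * ‖lam - a‖ * ((1 + δ) * t) := by ring
    _ ≤ M * ((1 + δ) * t) := by gcongr

theorem norm_dunford_factor_le (X : Type*) [NormedAddCommGroup X] [NormedSpace ℂ X] (x : X) :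
    ‖-(2 * Real.pi * Complex.I)⁻¹ • x‖ ≤ ‖x‖ := by
  rw [norm_smul, norm_neg, norm_inv]
  refine mul_le_of_le_one_left (norm_nonneg _) (inv_le_one_of_one_le₀ ?_)
  have := Real.pi_gt_three
  simp [abs_of_pos Real.pi_pos]
  linarith

/-- The vertex is placed at `a + 1/t`. There the resolvent is at most `M (1 + δ) t`, which cancels
the factor `1/t` of the contour integral, while `exp ((a + 1/t) t)` costs only a factor `e` beyond
`exp (a t)`. -/
theorem HasWedgeResolvent.norm_dunford_le (h : HasWedgeResolvent A a δ M) (hδ : 0 < δ) {t : ℝ}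
    (ht : 0 < t) : ‖dunford A a δ t‖
      ≤ 2 * (1 + δ) / δ * Real.exp 1 * (M * (1 + δ)) * Real.exp (a * t) := by
  have hz : |(t : ℂ).im| < δ * (t : ℂ).re := by simpa using mul_pos hδ ht
  rw [h.dunford_eq (c := a + t⁻¹) (by linarith [inv_pos.2 ht]) hz]
  refine (norm_dunford_factor_le (E →L[ℂ] E) _).trans ?_
  refine (norm_wedgeIntegral_le (K := M * ((1 + δ) * t)) hδ ht fun y hy =>
    ⟨h.norm_le_of_mem hδ ht (mem_wedge_ray_up le_rfl hy),
     h.norm_le_of_mem hδ ht (mem_wedge_ray_down le_rfl hy)⟩).trans (le_of_eq ?_)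
  rw [add_mul, inv_mul_cancel₀ ht.ne', Real.exp_add]
  field_simp

/-- The behaviour at time zero on the domain of the generator. -/
theorem HasWedgeResolvent.norm_dunford_sub_le (h : HasWedgeResolvent A a δ M) (hδ : 0 < δ) {t : ℝ}
    (ht : 0 < t) {x y : E} (hxy : (x, y) ∈ A.graph) :
    ‖dunford A a δ t x - Complex.exp (a * t) • x‖
      ≤ 2 * (1 + δ) / δ * Real.exp (a * t + 1) *
        (M * ‖y - (a : ℂ) • x‖ * (1 + δ) ^ 2) * t := by
  have hz : |(t : ℂ).im| < δ * (t : ℂ).re := by simpa using mul_pos hδ ht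
  have hti := inv_pos.2 ht
  set c := a + t⁻¹ with hc
  have hac : a < c := by linarith
  set v := y - (a : ℂ) • x with hv
  have hpos : ∀ lam ∈ wedge c δ, 0 < ‖lam - a‖ := by
    intro lam hl
    have h1 := le_norm_on_wedge hδ ht hl
    by_contra hcon
    have h2 : ‖lam - a‖ = 0 := le_antisymm (not_lt.1 hcon) (norm_nonneg _)
    rw [h2] at h1
    linarith
  have hne : ∀ lam ∈ wedge c δ, lam - a ≠ 0 := fun lam hl => norm_pos_iff.1 (hpos lam hl)
  have hinv : ∀ lam ∈ wedge c δ, ‖(lam - a)⁻¹‖ ≤ (1 + δ) * t := by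
    intro lam hl
    rw [norm_inv, inv_le_iff_one_le_mul₀ (hpos lam hl)]
    exact le_norm_on_wedge hδ ht hl
  have hsub := wedge_subset (δ := δ) hac.le
  -- This splits off `-x / (lam - a)`, whose wedge integral is `-2πi exp (a t) x`. The minus sign is
  -- that of the convention `(A - lam)⁻¹` and is undone by the prefactor of `dunford`. The remaining
  -- term is quadratically small in `t` on the contour.
  have hRx : ∀ lam ∈ wedge c δ, resolventFun A lam x
      = (lam - a)⁻¹ • resolventFun A lam v - (lam - a)⁻¹ • x := by
    intro lam hl
    have hR := isResolventAt_resolventFun (h.mem (hsub hl))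
    have h1 := (isResolventAt_iff.1 hR _ _).1 hxy
    have h2 : y - lam • x = v - (lam - a) • x := by rw [hv, sub_smul]; abel
    rw [h2, map_sub, map_smul, sub_eq_iff_eq_add] at h1
    rw [h1, smul_add, smul_smul, inv_mul_cancel₀ (hne lam hl), one_smul]
    abel
  have hK : ∀ lam ∈ wedge c δ, ‖(lam - a)⁻¹ • resolventFun A lam v‖
      ≤ M * ‖v‖ * (1 + δ) ^ 2 * t ^ 2 := by
    intro lam hl
    rw [norm_smul]
    have h2 := (resolventFun A lam).le_of_opNorm_le (h.norm_le_of_mem hδ ht hl) v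
    calc _ ≤ ((1 + δ) * t) * (M * ((1 + δ) * t) * ‖v‖) :=
          mul_le_mul (hinv lam hl) h2 (norm_nonneg _) (by positivity)
      _ = _ := by ring
  have hcinv : ContinuousOn (fun lam : ℂ => (lam - a)⁻¹) (wedge c δ) :=
    (continuousOn_id.sub continuousOn_const).inv₀ hne
  have hcv : ContinuousOn (fun lam : ℂ => (lam - a)⁻¹ • resolventFun A lam v) (wedge c δ) :=
    hcinv.smul ((h.continuousOn.mono hsub).clm_apply continuousOn_const)
  have e1 : wedgeIntegral δ (fun lam => resolventFun A lam x) c t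
      = wedgeIntegral δ (fun lam => (lam - a)⁻¹ • resolventFun A lam v) c t
        - wedgeIntegral δ (fun lam => (lam - a)⁻¹ • x) c t := by
    rw [← wedgeIntegral_sub le_rfl hz hcv (s := fun lam => (lam - a)⁻¹ • x)
      (hcinv.smul continuousOn_const) hK
      (K' := (1 + δ) * t * ‖x‖) fun lam hl => by
        rw [norm_smul]; exact mul_le_mul_of_nonneg_right (hinv lam hl) (norm_nonneg _)]
    exact wedgeIntegral_congr le_rfl hRx
  have e2 : wedgeIntegral δ (fun lam => (lam - a)⁻¹ • x) c t
      = (2 * Real.pi * Complex.I * Complex.exp (a * t)) • x := by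
    rw [← wedgeIntegral_inv_sub hδ ht hac]
    exact wedgeIntegral_comp ((ContinuousLinearMap.id ℂ ℂ).smulRight x) le_rfl hz hcinv hinv
  have e3 : wedgeIntegral δ (fun lam => resolventFun A lam x) c t
      = wedgeIntegral δ (resolventFun A) c t x :=
    wedgeIntegral_comp (ContinuousLinearMap.apply ℂ E x) hac.le hz h.continuousOn
      fun lam hl => h.norm_le hl
  have e4 : dunford A a δ t x - Complex.exp (a * t) • x = -(2 * Real.pi * Complex.I)⁻¹ •
      wedgeIntegral δ (fun lam => (lam - a)⁻¹ • resolventFun A lam v) c t := by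
    rw [h.dunford_eq hac hz, _root_.smul_apply, ← e3, e1, e2, smul_sub, smul_smul]
    have : -(2 * Real.pi * Complex.I)⁻¹ * (2 * Real.pi * Complex.I * Complex.exp (a * t))
        = -Complex.exp (a * t) := by
      rw [neg_mul, inv_mul_cancel_left₀ two_pi_I_ne_zero']
    rw [this, neg_smul (Complex.exp _)]
    abel
  rw [e4]
  refine (norm_dunford_factor_le _ _).trans ?_
  refine (norm_wedgeIntegral_le hδ ht fun y hy => ⟨hK _ (mem_wedge_ray_up le_rfl hy),
     hK _ (mem_wedge_ray_down le_rfl hy)⟩).trans (le_of_eq ?_)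
  rw [hc, add_mul, inv_mul_cancel₀ ht.ne']
  field_simp

theorem HasWedgeResolvent.tendsto_dunford (h : HasWedgeResolvent A a δ M) (hδ : 0 < δ)
    (hA : Dense (A.domain : Set E)) (x : E) :
    Tendsto (fun t : ℝ => dunford A a δ t x) (𝓝[>] 0) (𝓝 x) := by
  have hdom : ∀ x ∈ A.domain, Tendsto (fun t : ℝ => dunford A a δ t x) (𝓝[>] 0) (𝓝 x) := by
    intro x hx
    obtain ⟨y, hxy⟩ := LinearPMap.mem_domain_iff.1 hx
    have h1 : Tendsto (fun t : ℝ => Complex.exp (a * t) • x) (𝓝[>] 0) (𝓝 x) := by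
      have hc : Continuous (fun t : ℝ => Complex.exp (a * t) • x) := by fun_prop
      simpa using (hc.tendsto 0).mono_left (nhdsWithin_le_nhds (s := Ioi 0))
    have h2 : Tendsto (fun t : ℝ => 2 * (1 + δ) / δ * Real.exp (a * t + 1) *
        (M * ‖y - (a : ℂ) • x‖ * (1 + δ) ^ 2) * t) (𝓝[>] 0) (𝓝 0) := by
      have hc : Continuous (fun t : ℝ => 2 * (1 + δ) / δ * Real.exp (a * t + 1) *
        (M * ‖y - (a : ℂ) • x‖ * (1 + δ) ^ 2) * t) := by fun_prop
      simpa using (hc.tendsto 0).mono_left (nhdsWithin_le_nhds (s := Ioi 0))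
    have h3 : Tendsto (fun t : ℝ => dunford A a δ t x - Complex.exp (a * t) • x) (𝓝[>] 0) (𝓝 0) :=
      squeeze_zero_norm' (by
        filter_upwards [self_mem_nhdsWithin] with t ht
        exact h.norm_dunford_sub_le hδ ht hxy) h2
    simpa using h3.add h1
  obtain ⟨C, hC0, hC⟩ : ∃ C : ℝ, 0 ≤ C ∧ ∀ t : ℝ, 0 < t → t ≤ 1 → ‖dunford A a δ t‖ ≤ C := by
    have hM : 0 ≤ M := (norm_nonneg _).trans (h.norm_le (mem_wedge_vertex a δ))
    refine ⟨2 * (1 + δ) / δ * Real.exp 1 * (M * (1 + δ)) * Real.exp |a|, by positivity,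
      fun t ht ht1 => (h.norm_dunford_le hδ ht).trans ?_⟩
    gcongr
    have := mul_le_mul_of_nonneg_right (le_abs_self a) ht.le
    nlinarith [abs_nonneg a]
  rw [Metric.tendsto_nhds]
  intro ε hε
  obtain ⟨x', hx', hd⟩ := Metric.mem_closure_iff.1 (hA.closure_eq ▸ mem_univ x : x ∈ closure _)
    (ε / (2 * (C + 1))) (by positivity)
  have h1 : ∀ᶠ t : ℝ in 𝓝[>] 0, t ≤ 1 :=
    nhdsWithin_le_nhds ((gt_mem_nhds zero_lt_one).mono fun _ h => le_of_lt h)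
  filter_upwards [self_mem_nhdsWithin, h1,
    (Metric.tendsto_nhds.1 (hdom x' hx')) (ε / 2) (by positivity)] with t ht ht1 htd
  rw [dist_eq_norm] at hd htd ⊢
  have h2 := (dunford A a δ t).le_of_opNorm_le (hC t ht ht1) (x - x')
  have h3 : dunford A a δ t x - x
      = dunford A a δ t (x - x') + (dunford A a δ t x' - x') - (x - x') := by
    rw [map_sub]; abel
  have h4 : (C + 1) * ‖x - x'‖ < ε / 2 := by
    rw [lt_div_iff₀ (by positivity)] at hd
    linarith
  rw [h3]
  have h5 := norm_sub_le (dunford A a δ t (x - x') + (dunford A a δ t x' - x')) (x - x')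
  have h6 := norm_add_le (dunford A a δ t (x - x')) (dunford A a δ t x' - x')
  linarith

open Classical in
/-- The semigroup given by the Dunford integral, extended by the identity. -/
def dunfordSemigroup (A : E →ₗ.[ℂ] E) (a δ t : ℝ) : E →L[ℂ] E :=
  if 0 < t then dunford A a δ t else ContinuousLinearMap.id ℂ E

omit [CompleteSpace E] in
theorem dunfordSemigroup_of_pos {t : ℝ} (ht : 0 < t) :
    dunfordSemigroup A a δ t = dunford A a δ t := if_pos ht

omit [CompleteSpace E] in
theorem dunfordSemigroup_zero : dunfordSemigroup A a δ 0 = ContinuousLinearMap.id ℂ E :=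
  if_neg (lt_irrefl 0)

theorem HasWedgeResolvent.isEvolution (h : HasWedgeResolvent A a δ M) (hδ : 0 < δ)
    (hA : Dense (A.domain : Set E)) :
    IsEvolution A (dunfordSemigroup A a δ) fun t => dunfordDeriv A a δ t := by
  have hz : ∀ t : ℝ, 0 < t → |(t : ℂ).im| < δ * (t : ℂ).re := fun t ht => by
    simpa using mul_pos hδ ht
  constructor
  · intro t ht
    refine (h.hasDerivAt_dunford (hz t ht)).comp_ofReal_vector.congr_of_eventuallyEq ?_
    filter_upwards [lt_mem_nhds ht] with s hs using dunfordSemigroup_of_pos hs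
  · intro t ht x
    rw [dunfordSemigroup_of_pos ht]
    exact h.dunford_mem_graph (hz t ht) x
  · intro t ht x y hxy
    rw [dunfordSemigroup_of_pos ht]
    exact h.dunfordDeriv_apply (hz t ht) hxy
  · have hM : 0 ≤ M := (norm_nonneg _).trans (h.norm_le (mem_wedge_vertex a δ))
    refine ⟨2 * (1 + δ) / δ * Real.exp 1 * (M * (1 + δ)) * Real.exp |a|,
      fun t ht ht1 => ?_⟩
    rw [dunfordSemigroup_of_pos ht]
    refine (h.norm_dunford_le hδ ht).trans ?_
    gcongr
    have := mul_le_mul_of_nonneg_right (le_abs_self a) ht.le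
    nlinarith [abs_nonneg a]
  · intro x
    refine (h.tendsto_dunford hδ hA x).congr' ?_
    filter_upwards [self_mem_nhdsWithin] with t ht
    rw [dunfordSemigroup_of_pos ht]

/-- The Dunford integral is complex differentiable in the open sector `|Im z| < δ Re z`, which
contains the positive half-line. -/
theorem HasWedgeResolvent.analyticOnNhd (h : HasWedgeResolvent A a δ M) (hδ : 0 < δ) (x : E) :
    AnalyticOnNhd ℝ (fun t : ℝ => dunfordSemigroup A a δ t x) (Ioi 0) := by
  intro t ht
  have hz : |(t : ℂ).im| < δ * (t : ℂ).re := by simpa using mul_pos hδ ht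
  have hopen : IsOpen {z : ℂ | |z.im| < δ * z.re} :=
    isOpen_lt Complex.continuous_im.abs (continuous_const.mul Complex.continuous_re)
  have h1 : AnalyticAt ℂ (fun z => dunford A a δ z x) (t : ℂ) := by
    refine DifferentiableOn.analyticAt (s := {z : ℂ | |z.im| < δ * z.re}) (fun z hz => ?_)
      (hopen.mem_nhds hz)
    exact ((h.hasDerivAt_dunford hz).clm_apply
      (hasDerivAt_const z x)).differentiableAt.differentiableWithinAt
  have h2 : AnalyticAt ℝ (fun s : ℝ => dunford A a δ s x) t :=
    (h1.restrictScalars (𝕜 := ℝ)).comp (f := fun s : ℝ => (s : ℂ))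
      (Complex.ofRealCLM.analyticAt t)
  refine h2.congr ?_
  filter_upwards [lt_mem_nhds ht] with s hs
  rw [dunfordSemigroup_of_pos hs]

theorem HasWedgeResolvent.norm_semigroup_le (h : HasWedgeResolvent A a δ M) (hδ : 0 < δ) :
    ∃ C : ℝ, 0 < C ∧ ∀ t : ℝ, 0 ≤ t → ‖dunfordSemigroup A a δ t‖ ≤ C * Real.exp (a * t) := by
  have hM : 0 ≤ M := (norm_nonneg _).trans (h.norm_le (mem_wedge_vertex a δ))
  refine ⟨2 * (1 + δ) / δ * Real.exp 1 * (M * (1 + δ)) + 1, by positivity, fun t ht => ?_⟩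
  rcases ht.eq_or_lt with rfl | ht
  · rw [dunfordSemigroup_zero, mul_zero, Real.exp_zero, mul_one]
    refine ContinuousLinearMap.norm_id_le.trans ?_
    have : 0 ≤ 2 * (1 + δ) / δ * Real.exp 1 * (M * (1 + δ)) := by positivity
    linarith
  · rw [dunfordSemigroup_of_pos ht]
    refine (h.norm_dunford_le hδ ht).trans ?_
    gcongr
    linarith

end Semigroup

/-! ## Operators with resolvent estimates in a sector -/

section SectorEstimate

open Set

variable {E : Type*} [NormedAddCommGroup E] [NormedSpace ℂ E] {A : E →ₗ.[ℂ] E}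

theorem IsResolventAt.isClosed {τ : ℂ} {S : E →L[ℂ] E} (h : IsResolventAt A τ S) :
    A.IsClosed := by
  have : (A.graph : Set (E × E)) = {v : E × E | S (v.2 - τ • v.1) = v.1} := by
    ext ⟨x, y⟩
    exact isResolventAt_iff.1 h x y
  rw [LinearPMap.IsClosed, this]
  exact isClosed_eq (by fun_prop) (by fun_prop)

/-- The resolvent decays like `1 / |τ|` in the sector `Re τ ≥ -|Im τ|`, for large `τ`. -/
def HasSectorEstimate (A : E →ₗ.[ℂ] E) (ρ M : ℝ) : Prop :=
  ∀ τ : ℂ, -|τ.im| ≤ τ.re → ρ ≤ ‖τ‖ → ∃ S : E →L[ℂ] E, IsResolventAt A τ S ∧ ‖τ‖ * ‖S‖ ≤ M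

theorem re_le_abs_im_of_le_abs_arg {ζ : ℂ} (h : Real.pi / 4 ≤ |Complex.arg ζ|) :
    ζ.re ≤ |ζ.im| := by
  by_contra! hlt
  have hpos : 0 < ζ.re := (abs_nonneg _).trans_lt hlt
  have h1 : Real.cos |Complex.arg ζ| ≤ Real.cos (Real.pi / 4) :=
    Real.cos_le_cos_of_nonneg_of_le_pi (by positivity) (Complex.abs_arg_le_pi ζ) h
  rw [Real.cos_abs, Real.cos_pi_div_four] at h1
  have hn : 0 < ‖ζ‖ := norm_pos_iff.2 fun h0 => by simp [h0] at hpos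
  rw [Complex.cos_arg (norm_pos_iff.1 hn), div_le_iff₀ hn] at h1
  have h2 : ζ.re ^ 2 ≤ (√2 / 2 * ‖ζ‖) ^ 2 := pow_le_pow_left₀ hpos.le h1 2
  have h3 : ‖ζ‖ ^ 2 = ζ.re ^ 2 + ζ.im ^ 2 := by
    rw [Complex.sq_norm, Complex.normSq_apply]; ring
  rw [mul_pow, div_pow, Real.sq_sqrt (by norm_num), h3] at h2
  have h4 : |ζ.im| ^ 2 < ζ.re ^ 2 := pow_lt_pow_left₀ hlt (abs_nonneg _) two_ne_zero
  rw [sq_abs] at h4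
  linarith

theorem HasSectorEstimate.isSectorial_neg {ρ M : ℝ} (h : HasSectorEstimate A ρ M)
    (hA : Dense (A.domain : Set E)) : IsSectorial (-A) := by
  -- With the vertex at `-a₀`, the closed sector satisfies `|Re lam| + |Im lam| ≥ a₀`, so `‖lam‖ ≥
  -- a₀ / 2 = max ρ 1`. Hence the sector estimate applies at `-lam`, and `‖lam + a₀‖ ≤ 3 ‖lam‖`.
  set a₀ : ℝ := 2 * max ρ 1 with ha₀
  have hρ1 : 1 ≤ max ρ 1 := le_max_right _ _
  have key : ∀ lam : ℂ, Real.pi / 4 ≤ |Complex.arg (lam - ((-a₀ : ℝ) : ℂ))| →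
      ∃ S : E →L[ℂ] E, IsResolventAt (-A) lam S ∧
        ‖lam - ((-a₀ : ℝ) : ℂ)‖ * ‖S‖ ≤ 3 * M := by
    intro lam hl
    have h1 := re_le_abs_im_of_le_abs_arg hl
    simp only [Complex.sub_re, Complex.ofReal_re, Complex.sub_im, Complex.ofReal_im, sub_zero] at h1
    have h2 : -|(-lam).im| ≤ (-lam).re := by simp; linarith
    have h3 := Complex.abs_re_le_norm lam
    have h4 := Complex.abs_im_le_norm lam
    have h5 := neg_abs_le lam.re
    have h6 : max ρ 1 ≤ ‖lam‖ := by linarith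
    obtain ⟨S, hS, hn⟩ := h (-lam) h2 (by rw [norm_neg]; exact (le_max_left _ _).trans h6)
    refine ⟨-S, hS.neg, ?_⟩
    rw [norm_neg] at hn ⊢
    have h7 : ‖lam - ((-a₀ : ℝ) : ℂ)‖ ≤ 3 * ‖lam‖ := by
      refine (norm_sub_le _ _).trans ?_
      rw [Complex.norm_real, Real.norm_eq_abs, abs_neg, abs_of_nonneg (by linarith)]
      linarith
    nlinarith [norm_nonneg S]
  refine ⟨?_, ?_, -a₀, Real.pi / 4, max (3 * M) 1, by positivity, ?_, le_max_right _ _, ?_⟩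
  · obtain ⟨S, hS, -⟩ := key (-1 + ((-a₀ : ℝ) : ℂ)) (by
      rw [add_sub_cancel_right, Complex.arg_neg_one, abs_of_pos Real.pi_pos]
      linarith [Real.pi_pos])
    exact hS.isClosed
  · exact hA
  · linarith [Real.pi_pos]
  · intro lam hne hl
    obtain ⟨S, hS, hn⟩ := key lam hl
    refine ⟨S, hS, ?_⟩
    rw [le_div_iff₀ (norm_pos_iff.2 (sub_ne_zero.2 hne)), mul_comm]
    exact hn.trans (le_max_left _ _)

variable [CompleteSpace E]

/-- If the closed half-plane `Re τ ≥ -β` belongs to the resolvent set of an operator with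
a sector estimate, then so does a slightly larger wedge. -/
theorem HasSectorEstimate.exists_hasWedgeResolvent {ρ M₀ β : ℝ} (h : HasSectorEstimate A ρ M₀)
    (hβ : 0 < β) (hres : ∀ τ : ℂ, -β ≤ τ.re → τ ∈ resolventDomain A) :
    ∃ δ M : ℝ, 0 < δ ∧ HasWedgeResolvent A (-β) δ M := by
  -- For `δ ≤ 1/2`, a point of the wedge outside the sector `Re τ ≥ -|Im τ|` has `|Re τ|` and `|Im
  -- τ|` below `2β`. Beyond radius `4β + 1` the wedge therefore lies in the sector. The summand `1`
  -- also gives `‖τ‖ ≥ 1` there.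
  set r : ℝ := max ρ (4 * β + 1) with hr
  have hr0 : 4 * β + 1 ≤ r := le_max_right _ _
  set K : Set ℂ := {τ | -β ≤ τ.re} ∩ Metric.closedBall 0 r with hK
  have hKc : IsCompact K := (isCompact_closedBall _ _).inter_left
    (isClosed_le continuous_const Complex.continuous_re)
  obtain ⟨η, hη, hsub⟩ := hKc.exists_thickening_subset_open isOpen_resolventDomain
    fun τ hτ => hres τ hτ.1
  -- Points of the wedge in the ball lie at horizontal distance at most `δ r ≤ η / 2` from the line
  -- `Re τ = -β`, hence inside the `η`-thickening of `K`.
  set δ : ℝ := min (1 / 2) (η / (2 * r)) with hδ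
  have hrpos : 0 < r := by linarith
  have hδ0 : 0 < δ := by positivity
  have hδ1 : δ ≤ 1 / 2 := min_le_left _ _
  have hδ2 : δ * r < η := by
    have : δ * r ≤ η / (2 * r) * r := by gcongr; exact min_le_right _ _
    have h2 : η / (2 * r) * r = η / 2 := by field_simp
    linarith
  set W : Set ℂ := wedge (-β) δ ∩ Metric.closedBall 0 r with hW
  have hWc : IsCompact W := by
    refine (isCompact_closedBall _ _).inter_left (isClosed_le ?_ Complex.continuous_re)
    exact continuous_const.sub (continuous_const.mul Complex.continuous_im.abs)
  have hWres : W ⊆ resolventDomain A := by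
    rintro τ ⟨hτ, hτr⟩
    rw [mem_closedBall_zero_iff] at hτr
    simp only [wedge, mem_ofPred_eq] at hτ
    rcases le_total (-β) τ.re with h1 | h1
    · exact hres τ h1
    apply hsub
    rw [Metric.mem_thickening_iff]
    refine ⟨⟨-β, τ.im⟩, ⟨by simp, ?_⟩, ?_⟩
    · rw [mem_closedBall_zero_iff]
      refine le_trans ?_ hτr
      rw [← sq_le_sq₀ (norm_nonneg _) (norm_nonneg _), Complex.sq_norm, Complex.sq_norm,
        Complex.normSq_apply, Complex.normSq_apply]
      simp only
      nlinarith
    · have h2 : τ - ⟨-β, τ.im⟩ = ((τ.re + β : ℝ) : ℂ) := by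
        apply Complex.ext <;> simp
      rw [dist_eq_norm, h2, Complex.norm_real, Real.norm_eq_abs, abs_of_nonpos (by linarith)]
      have h3 := mul_le_mul_of_nonneg_left ((Complex.abs_im_le_norm τ).trans hτr) hδ0.le
      linarith
  obtain ⟨C, hC⟩ := hWc.exists_bound_of_continuousOn (f := resolventFun A)
    fun τ hτ => (continuousAt_resolventFun (hWres hτ)).continuousWithinAt
  refine ⟨δ, max (C * (1 + r + β)) (M₀ * (2 + β)), hδ0, fun τ hτ => ?_⟩
  have htri : ‖τ - ((-β : ℝ) : ℂ)‖ ≤ ‖τ‖ + β := by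
    refine (norm_sub_le _ _).trans ?_
    rw [Complex.norm_real, Real.norm_eq_abs, abs_neg, abs_of_pos hβ]
  rcases le_total ‖τ‖ r with h1 | h1
  · have hτW : τ ∈ W := ⟨hτ, by rwa [mem_closedBall_zero_iff]⟩
    refine ⟨_, isResolventAt_resolventFun (hWres hτW), le_trans ?_ (le_max_left _ _)⟩
    have h2 := hC τ hτW
    exact mul_le_mul h2 (by linarith) (by positivity) ((norm_nonneg _).trans h2)
  · have hsec : -|τ.im| ≤ τ.re := by
      simp only [wedge, mem_ofPred_eq] at hτ
      by_contra! hcon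
      have h2 : ‖τ‖ ≤ |τ.re| + |τ.im| := Complex.norm_le_abs_re_add_abs_im τ
      have h3 : |τ.re| = -τ.re := abs_of_nonpos (by linarith [abs_nonneg τ.im])
      have h4 := mul_le_mul_of_nonneg_right hδ1 (abs_nonneg τ.im)
      linarith
    obtain ⟨S, hS, hn⟩ := h τ hsec ((le_max_left _ _).trans h1)
    refine ⟨S, hS, le_trans ?_ (le_max_right _ _)⟩
    have h2 : 1 + ‖τ - ((-β : ℝ) : ℂ)‖ ≤ (2 + β) * ‖τ‖ := by nlinarith
    calc ‖S‖ * (1 + ‖τ - ((-β : ℝ) : ℂ)‖) ≤ ‖S‖ * ((2 + β) * ‖τ‖) := by gcongr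
      _ = ‖τ‖ * ‖S‖ * (2 + β) := by ring
      _ ≤ _ := by gcongr

/-- Generation of an analytic semigroup, with its decay rates. -/
theorem HasSectorEstimate.exists_semigroup {ρ M₀ : ℝ} (h : HasSectorEstimate A ρ M₀)
    (hA : Dense (A.domain : Set E)) {ι : Type*} [Nonempty ι] (β : ι → ℝ) (hβ : ∀ i, 0 < β i)
    (hres : ∀ i, ∀ τ : ℂ, -β i ≤ τ.re → τ ∈ resolventDomain A) :
    ∃ T : ℝ → E →L[ℂ] E, IsAnalyticSemigroup T ∧ IsGenerator A T ∧
      ∀ i, ∃ C : ℝ, 0 < C ∧ ∀ t : ℝ, 0 ≤ t → ‖T t‖ ≤ C * Real.exp (-β i * t) := by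
  obtain ⟨i₀⟩ := ‹Nonempty ι›
  obtain ⟨δ₀, M, hδ₀, hw₀⟩ := h.exists_hasWedgeResolvent (hβ i₀) (hres i₀)
  have hev := hw₀.isEvolution hδ₀ hA
  refine ⟨dunfordSemigroup A (-β i₀) δ₀, hev.isAnalyticSemigroup dunfordSemigroup_zero
    (hw₀.analyticOnNhd hδ₀), hev.isGenerator dunfordSemigroup_zero
    (isResolventAt_resolventFun (hw₀.mem (mem_wedge_vertex _ _))), fun i => ?_⟩
  obtain ⟨δ, M', hδ, hw⟩ := h.exists_hasWedgeResolvent (hβ i) (hres i)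
  obtain ⟨C, hC, hb⟩ := hw.norm_semigroup_le hδ
  refine ⟨C, hC, fun t ht => ?_⟩
  -- Both Dunford integrals solve `u' = A u` with the same initial values, so one semigroup inherits
  -- the decay rates of all wedges.
  have heq : dunfordSemigroup A (-β i₀) δ₀ t = dunfordSemigroup A (-β i) δ t := by
    rcases ht.eq_or_lt with rfl | ht
    · rw [dunfordSemigroup_zero, dunfordSemigroup_zero]
    · exact hev.unique (hw.isEvolution hδ hA) ht
  rw [heq]
  exact hb t ht

end SectorEstimate

/-! ## Square-summable sequences -/

section EllTwoTools

theorem memEllTwo_iff {f : ℕ → ℂ} : Memℓp f 2 ↔ Summable fun i => ‖f i‖ ^ 2 := by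
  rw [memℓp_gen_iff (by simp)]
  simp

theorem memEllTwo_shift_iff {f : ℕ → ℂ} : Memℓp (fun k => f (k + 2)) 2 ↔ Memℓp f 2 := by
  rw [memEllTwo_iff, memEllTwo_iff]
  exact summable_nat_add_iff (f := fun i => ‖f i‖ ^ 2) 2

namespace EllTwo

theorem summable_sq (x : EllTwo) : Summable fun i => ‖x i‖ ^ 2 := memEllTwo_iff.1 (lp.memℓp x)

theorem sq_norm (x : EllTwo) : ‖x‖ ^ 2 = ∑' i, ‖x i‖ ^ 2 := by
  have := lp.norm_rpow_eq_tsum (p := 2) (by simp) x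
  simpa using this

/-- The sequence without its first two terms. -/
def tail : EllTwo →ₗ[ℂ] EllTwo where
  toFun w := ⟨fun k => w (k + 2), memEllTwo_shift_iff.2 (lp.memℓp w)⟩
  map_add' _ _ := rfl
  map_smul' _ _ := rfl

@[simp] theorem tail_apply (w : EllTwo) (k : ℕ) : tail w k = w (k + 2) := rfl

theorem sq_norm_eq (w : EllTwo) : ‖w‖ ^ 2 = ‖w 0‖ ^ 2 + ‖w 1‖ ^ 2 + ‖tail w‖ ^ 2 := by
  rw [sq_norm, sq_norm, ← (summable_sq w).sum_add_tsum_nat_add 2]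
  simp [Finset.sum_range_succ]

theorem norm_tail_le (w : EllTwo) : ‖tail w‖ ≤ ‖w‖ := by
  rw [← sq_le_sq₀ (norm_nonneg _) (norm_nonneg _), sq_norm_eq w]
  nlinarith [sq_nonneg ‖w 0‖, sq_nonneg ‖w 1‖]

theorem norm_apply_le (w : EllTwo) (i : ℕ) : ‖w i‖ ≤ ‖w‖ := lp.norm_apply_le_norm (by simp) w i

theorem norm_le (w : EllTwo) : ‖w‖ ≤ ‖w 0‖ + ‖w 1‖ + ‖tail w‖ := by
  rw [← sq_le_sq₀ (norm_nonneg _) (by positivity), sq_norm_eq w]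
  nlinarith [norm_nonneg (w 0), norm_nonneg (w 1), norm_nonneg (tail w),
    mul_nonneg (norm_nonneg (w 0)) (norm_nonneg (w 1)),
    mul_nonneg (norm_nonneg (w 0)) (norm_nonneg (tail w)),
    mul_nonneg (norm_nonneg (w 1)) (norm_nonneg (tail w))]

/-- The bounded operator dropping the first two terms. -/
def tailL : EllTwo →L[ℂ] EllTwo := tail.mkContinuous 1 fun w => by
  rw [one_mul]; exact norm_tail_le w

/-- The sequence with first two terms `a`, `b`, followed by `c`. -/
def cons (a b : ℂ) (c : EllTwo) : EllTwo :=
  ⟨fun n => match n with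
    | 0 => a
    | 1 => b
    | k + 2 => c k, memEllTwo_shift_iff.1 (lp.memℓp c)⟩

@[simp] theorem cons_zero (a b : ℂ) (c : EllTwo) : cons a b c 0 = a := rfl
@[simp] theorem cons_one (a b : ℂ) (c : EllTwo) : cons a b c 1 = b := rfl
@[simp] theorem cons_add_two (a b : ℂ) (c : EllTwo) (k : ℕ) : cons a b c (k + 2) = c k := rfl
@[simp] theorem tail_cons (a b : ℂ) (c : EllTwo) : tail (cons a b c) = c := rfl

/-- The sequence with the single nonzero term `a` at index `i`. -/
def unit (i : ℕ) (a : ℂ) : EllTwo := lp.single (E := fun _ : ℕ => ℂ) 2 i a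

theorem unit_apply (i : ℕ) (a : ℂ) (j : ℕ) : unit i a j = if j = i then a else 0 := by
  rw [unit, lp.single_apply]
  rcases eq_or_ne j i with rfl | h
  · simp
  · simp [h]

/-- Multiplication by a bounded sequence. -/
theorem exists_mul (a : ℕ → ℂ) {C : ℝ} (ha : ∀ k, ‖a k‖ ≤ C) (x : EllTwo) :
    ∃ y : EllTwo, (∀ k, y k = a k * x k) ∧ ‖y‖ ≤ C * ‖x‖ := by
  have hC : 0 ≤ C := (norm_nonneg _).trans (ha 0)
  have hle : ∀ k, ‖a k * x k‖ ^ 2 ≤ C ^ 2 * ‖x k‖ ^ 2 := fun k => by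
    rw [norm_mul, mul_pow]
    gcongr
    exact ha k
  have hs : Summable fun k => ‖a k * x k‖ ^ 2 :=
    ((summable_sq x).mul_left (C ^ 2)).of_nonneg_of_le (fun _ => by positivity) hle
  refine ⟨⟨fun k => a k * x k, memEllTwo_iff.2 hs⟩, fun _ => rfl, ?_⟩
  rw [← sq_le_sq₀ (norm_nonneg _) (by positivity), mul_pow, sq_norm, sq_norm, ← tsum_mul_left]
  exact hs.tsum_le_tsum hle ((summable_sq x).mul_left (C ^ 2))

end EllTwo

end EllTwoTools

/-! ## The graph of the generator -/

namespace BubbleParams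

variable (p : BubbleParams)

/-- The sequence `Γ` as an element of `ℓ²`. -/
def gamVec : EllTwo := ⟨fun k => (p.Gam k : ℂ), memEllTwo_iff.2 (by
  refine p.hasSum_Gam_sq.summable.congr fun k => ?_
  rw [Complex.norm_real, Real.norm_eq_abs, sq_abs, sq])⟩

@[simp] theorem gamVec_apply (k : ℕ) : p.gamVec k = p.Gam k := rfl

/-- The functional `c ↦ ∑ Γ_k c_k`. -/
def gamPair : EllTwo →L[ℂ] ℂ := innerSL ℂ p.gamVec

theorem hasSum_gamPair (c : EllTwo) : HasSum (fun k => (p.Gam k : ℂ) * c k) (p.gamPair c) := by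
  have := lp.hasSum_inner (𝕜 := ℂ) p.gamVec c
  simpa [mul_comm, gamPair] using this

theorem norm_gamPair_le (c : EllTwo) : ‖p.gamPair c‖ ≤ ‖p.gamVec‖ * ‖c‖ :=
  norm_inner_le_norm (𝕜 := ℂ) p.gamVec c

/-- `m = 3 γ² / (4 π (γ - 1))`, so that `m ∑ Γ_k² = γ - 1`. -/
def mcoef : ℝ := 3 * p.gam ^ 2 / (4 * Real.pi * (p.gam - 1))

theorem gam_pos : 0 < p.gam := by linarith [p.one_lt_gam]

theorem mcoef_pos : 0 < p.mcoef := by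
  have := p.one_lt_gam
  have := p.gam_pos
  have h : 0 < p.gam - 1 := by linarith
  have := Real.pi_pos
  unfold mcoef
  positivity

theorem gamPair_gamVec : (p.mcoef : ℂ) * p.gamPair p.gamVec = p.gam - 1 := by
  have h1 := p.hasSum_gamPair p.gamVec
  have h2 : HasSum (fun k => (p.Gam k : ℂ) * p.gamVec k)
      ((4 * Real.pi * (p.gam - 1) ^ 2 / (3 * p.gam ^ 2) : ℝ) : ℂ) := by
    have := Complex.hasSum_ofReal.2 p.hasSum_Gam_sq
    simpa using this
  rw [h1.unique h2, ← Complex.ofReal_mul]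
  have e : p.mcoef * (4 * Real.pi * (p.gam - 1) ^ 2 / (3 * p.gam ^ 2)) = p.gam - 1 := by
    have h3 := p.gam_pos.ne'
    have h4 : p.gam - 1 ≠ 0 := by linarith [p.one_lt_gam]
    have := Real.pi_ne_zero
    unfold mcoef
    field_simp
  rw [e]
  push_cast
  rfl

/-- The coefficient `3 ρ_* / R_*`. -/
def acoef : ℝ := 3 * p.rhos / p.Rs

/-- The mass functional as a bounded functional. -/
def massL : EllTwo →L[ℂ] ℂ :=
  -((p.mcoef / p.gam : ℝ) : ℂ) • p.gamPair.comp EllTwo.tailL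
    - (p.acoef : ℂ) • lp.evalCLM ℂ (fun _ : ℕ => ℂ) 2 0

theorem massL_eq (w : EllTwo) :
    p.massL w = -((p.mcoef / p.gam : ℝ) : ℂ) * p.gamPair (EllTwo.tail w) - p.acoef * w 0 := rfl

theorem massL_eq_massZ (w : EllTwo) : p.massL w = p.massZ w := by
  rw [massL_eq, massZ, ← (p.hasSum_gamPair (EllTwo.tail w)).tsum_eq]
  have h3 : (p.gam : ℂ) ≠ 0 := by exact_mod_cast p.gam_pos.ne'
  have h4 : (p.gam : ℂ) - 1 ≠ 0 := by
    have : p.gam - 1 ≠ 0 := by linarith [p.one_lt_gam]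
    exact_mod_cast this
  have h5 : (Real.pi : ℂ) ≠ 0 := by exact_mod_cast Real.pi_ne_zero
  have e1 : ((p.mcoef / p.gam : ℝ) : ℂ) = 3 / (4 * Real.pi) * (p.gam / (p.gam - 1)) := by
    unfold mcoef
    push_cast
    field_simp
  have e2 : (p.acoef : ℂ) = 3 * p.rhos / p.Rs := by
    unfold acoef
    push_cast
    rfl
  rw [e1, e2]
  rfl

/-- `κ̄ λ_{k+1}` -/
def freq (k : ℕ) : ℝ := p.kbar * eig k

/-- `Rg T_∞ / (ρ_l R_*)` -/
def bcoef : ℝ := p.Rg * p.Tinf / (p.rhol * p.Rs)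

/-- `4 μ_l / (ρ_l R_*²)` -/
def nucoef : ℝ := 4 * p.mul / (p.rhol * p.Rs ^ 2)

/-- `2 σ / (ρ_l R_*³)` -/
def scoef : ℝ := 2 * p.sig / (p.rhol * p.Rs ^ 3)

/-- The equations `u = 𝓛₋ w`, with all infinite sums expressed through the mass functional. -/
def IsImage (w u : EllTwo) : Prop :=
  u 0 = w 1 ∧ u 1 = p.bcoef * p.massL w + p.scoef * w 0 - p.nucoef * w 1 ∧
    ∀ k, u (k + 2) = -p.freq k * w (k + 2) - p.Gam k * p.massL u

theorem isImage_of_mem_graph {w u : EllTwo} (h : (w, u) ∈ p.generator.graph) : p.IsImage w u := by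
  obtain ⟨w', hw, hu⟩ := LinearPMap.mem_graph_iff _ |>.1 h
  simp only at hw hu
  obtain ⟨h0, h1, h2⟩ := p.generator_dynamics w'
  rw [hw, hu] at h0 h1 h2
  refine ⟨h0, ?_, fun k => ?_⟩
  · rw [h1, massL_eq_massZ]
    unfold bcoef scoef nucoef
    push_cast
    rfl
  · rw [h2, massL_eq_massZ]
    unfold freq
    push_cast
    rfl

/-- The coefficient `e_j Γ_j` equals `m q_j Γ_j`, so the infinite sum in every thermal row is a
multiple of the pairing of `Γ` with `x`. The thermal part of the image is then `-x` plus a multiple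
of `Γ`, which is square-summable. -/
theorem mem_domain_of_weighted {w x : EllTwo} (hx : ∀ k, x k = p.freq k * w (k + 2)) :
    w ∈ p.generator.domain := by
  set row : ℕ → ℕ → ℂ := fun i j => (p.entry i j : ℂ) * w j with hrow
  have hstep : ∀ i a, HasSum (fun j => row i (j + 2)) a →
      HasSum (row i) (a + (row i 0 + row i 1)) := by
    intro i a h
    have := (hasSum_nat_add_iff (f := row i) 2).1 h
    simpa [Finset.sum_range_succ] using this
  have h0 : HasSum (fun j => row 0 (j + 2)) 0 := by
    simp [hrow, entry, hasSum_zero]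
  have h1 : HasSum (fun j => row 1 (j + 2)) (-p.d * p.gamPair (EllTwo.tail w)) := by
    refine ((p.hasSum_gamPair (EllTwo.tail w)).mul_left (-p.d : ℂ)).congr_fun fun j => ?_
    simp [hrow, entry]
    ring
  have h2 : ∀ k, HasSum (fun j => row (k + 2) (j + 2))
      (-x k - p.mcoef * p.Gam k * p.gamPair x) := by
    intro k
    have hd : HasSum (fun j => if j = k then -x k else 0) (-x k) := hasSum_ite_eq k (-x k)
    refine (hd.sub ((p.hasSum_gamPair x).mul_left ((p.mcoef : ℂ) * p.Gam k))).congr_fun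
      fun j => ?_
    have he : (p.e j : ℂ) = p.freq j * p.mcoef := by
      unfold e freq mcoef
      push_cast
      rfl
    rw [hx j, hrow]
    simp only [entry]
    push_cast
    rw [he]
    rcases eq_or_ne j k with rfl | hjk
    · rw [if_pos rfl, if_pos rfl, hx j]
      unfold freq
      push_cast
      ring
    · rw [if_neg hjk, if_neg hjk.symm]
      push_cast
      ring
  refine ⟨fun i => ?_, ?_⟩
  · match i with
    | 0 => exact (hstep _ _ h0).summable
    | 1 => exact (hstep _ _ h1).summable
    | k + 2 => exact (hstep _ _ (h2 k)).summable
  · rw [← memEllTwo_shift_iff]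
    set y : EllTwo := -x - ((p.mcoef : ℂ) * p.gamPair x) • p.gamVec
      + ((3 * p.rhos / p.Rs * p.gam : ℝ) * w 1 : ℂ) • p.gamVec with hy
    convert lp.memℓp y using 1
    funext k
    have : matVec (fun i j => (p.entry i j : ℂ)) w (k + 2) = _ := (hstep _ _ (h2 k)).tsum_eq
    rw [this, hy]
    simp only [lp.coeFn_add, lp.coeFn_sub, lp.coeFn_neg, lp.coeFn_smul, Pi.add_apply, Pi.sub_apply,
      Pi.neg_apply, Pi.smul_apply, smul_eq_mul, gamVec_apply, hrow, entry]
    push_cast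
    ring

/-- The thermal rows show that `q_k c_k` is square-summable, so `w` is in the domain. They define
`u` only implicitly, through `massL u`. The difference `v` from the true image has tail `-massL v ·
Γ`, whence `massL v = ((γ - 1)/γ) massL v`, and so `massL v = 0`. -/
theorem mem_graph_of_isImage {w u : EllTwo} (h : p.IsImage w u) : (w, u) ∈ p.generator.graph := by
  have hdom : w ∈ p.generator.domain := by
    refine p.mem_domain_of_weighted (x := -EllTwo.tail u - p.massL u • p.gamVec) fun k => ?_
    simp only [lp.coeFn_sub, lp.coeFn_neg, lp.coeFn_smul, Pi.sub_apply,
      Pi.neg_apply, Pi.smul_apply, smul_eq_mul, gamVec_apply, EllTwo.tail_apply, h.2.2 k]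
    ring
  obtain ⟨u', hu'⟩ := LinearPMap.mem_domain_iff.1 hdom
  have h' := p.isImage_of_mem_graph hu'
  set v := u - u' with hv
  have hv0 : v 0 = 0 := by
    rw [hv, lp.coeFn_sub, Pi.sub_apply, h.1, h'.1, sub_self]
  have hv1 : v 1 = 0 := by
    rw [hv, lp.coeFn_sub, Pi.sub_apply, h.2.1, h'.2.1, sub_self]
  have hv2 : ∀ k, v (k + 2) = -p.Gam k * p.massL v := by
    intro k
    rw [hv, map_sub, lp.coeFn_sub, Pi.sub_apply, h.2.2, h'.2.2]
    ring
  have htail : EllTwo.tail v = -p.massL v • p.gamVec := by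
    apply lp.ext
    funext k
    rw [EllTwo.tail_apply, hv2, lp.coeFn_smul, Pi.smul_apply, smul_eq_mul, gamVec_apply]
    ring
  have hz : p.massL v = 0 := by
    have h1 := p.massL_eq v
    rw [htail, hv0, map_smul, smul_eq_mul] at h1
    have h2 := p.gamPair_gamVec
    have hg : (p.gam : ℂ) ≠ 0 := by exact_mod_cast p.gam_pos.ne'
    push_cast at h1
    field_simp at h1
    linear_combination h1 + p.massL v * h2
  have hv' : v = 0 := by
    apply lp.ext
    funext i
    match i with
    | 0 => simpa using hv0
    | 1 => simpa using hv1
    | k + 2 => simp [hv2, hz]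
  rw [sub_eq_zero.1 hv']
  exact hu'

theorem mem_graph_iff {w u : EllTwo} : (w, u) ∈ p.generator.graph ↔ p.IsImage w u :=
  ⟨p.isImage_of_mem_graph, p.mem_graph_of_isImage⟩

theorem generator_isClosed : p.generator.IsClosed := by
  have : (p.generator.graph : Set (EllTwo × EllTwo)) = {v | p.IsImage v.1 v.2} := by
    ext ⟨w, u⟩
    exact p.mem_graph_iff
  rw [LinearPMap.IsClosed, this]
  have hev : ∀ i, Continuous fun w : EllTwo => w i := fun i =>
    (lp.evalCLM ℂ (fun _ : ℕ => ℂ) 2 i).continuous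
  have h1 : ∀ i, Continuous fun v : EllTwo × EllTwo => v.1 i := fun i => (hev i).comp continuous_fst
  have h2 : ∀ i, Continuous fun v : EllTwo × EllTwo => v.2 i := fun i => (hev i).comp continuous_snd
  have hm := p.massL.continuous
  refine (isClosed_eq (h2 0) (h1 1)).inter ((isClosed_eq (h2 1) ?_).inter ?_)
  · exact ((continuous_const.mul (hm.comp continuous_fst)).add
      (continuous_const.mul (h1 0))).sub (continuous_const.mul (h1 1))
  · have : {v : EllTwo × EllTwo | ∀ k, v.2 (k + 2) = -p.freq k * v.1 (k + 2)
        - p.Gam k * p.massL v.2} = ⋂ k, {v : EllTwo × EllTwo | v.2 (k + 2)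
          = -p.freq k * v.1 (k + 2) - p.Gam k * p.massL v.2} := by
      ext v; simp
    change _root_.IsClosed {v : EllTwo × EllTwo | ∀ k, _}
    rw [this]
    exact isClosed_iInter fun k => isClosed_eq (h2 _) ((continuous_const.mul (h1 _)).sub
      (continuous_const.mul (hm.comp continuous_snd)))

theorem generator_dense : Dense (p.generator.domain : Set EllTwo) := by
  have hs : ∀ i, EllTwo.unit i 1 ∈ p.generator.domain := by
    intro i
    obtain ⟨x, hx⟩ : ∃ x : EllTwo, ∀ k, x k = p.freq k * EllTwo.unit i 1 (k + 2) := by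
      match i with
      | 0 => exact ⟨0, fun k => by simp [EllTwo.unit_apply]⟩
      | 1 => exact ⟨0, fun k => by simp [EllTwo.unit_apply]⟩
      | j + 2 =>
        refine ⟨EllTwo.unit j (p.freq j : ℂ), fun k => ?_⟩
        rcases eq_or_ne k j with rfl | hkj
        · simp [EllTwo.unit_apply]
        · simp [EllTwo.unit_apply, hkj]
    exact p.mem_domain_of_weighted hx
  intro w
  have h := lp.hasSum_single (E := fun _ : ℕ => ℂ) (p := 2) (by simp) w
  refine mem_closure_of_tendsto h (Eventually.of_forall fun s => ?_)
  refine Submodule.sum_mem _ fun i _ => ?_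
  have : lp.single (E := fun _ : ℕ => ℂ) 2 i (w i) = w i • EllTwo.unit i 1 := by
    rw [EllTwo.unit, ← lp.single_smul]; simp
  rw [this]
  exact Submodule.smul_mem _ _ (hs i)

end BubbleParams

/-! ## The spectrum of the generator -/

namespace BubbleParams

variable (p : BubbleParams)

theorem kbar_pos : 0 < p.kbar := by
  have h1 := p.kappa_pos
  have h2 := p.rhos_pos
  have h3 := p.Rs_pos
  have h4 : 0 < p.cp := by rw [p.cp_eq']; linarith [p.cv_pos, p.Rg_pos]
  unfold kbar
  rw [p.chi_eq]
  positivity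

theorem freq_eq (k : ℕ) : p.freq k = Real.pi ^ 2 * p.kbar * ((k : ℝ) + 1) ^ 2 := by
  unfold freq eig
  ring

theorem freq_pos (k : ℕ) : 0 < p.freq k := by
  have := p.kbar_pos
  have := Real.pi_pos
  rw [freq_eq]
  positivity

theorem pole_eq (k : ℕ) : p.pole k = -(p.freq k : ℂ) := by
  rw [pole, freq_eq]
  push_cast
  ring

theorem freq_injective : Function.Injective p.freq := by
  intro j k h
  rw [freq_eq, freq_eq] at h
  have h1 : Real.pi ^ 2 * p.kbar ≠ 0 := by
    have := p.kbar_pos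
    have := Real.pi_pos
    positivity
  have h2 := mul_left_cancel₀ h1 h
  have h3 := (sq_eq_sq₀ (by positivity) (by positivity)).1 h2
  exact_mod_cast add_right_cancel h3

theorem Gam_ne_zero (k : ℕ) : (p.Gam k : ℂ) ≠ 0 := by
  have h : p.gam - 1 ≠ 0 := by linarith [p.one_lt_gam]
  have := p.gam_pos
  have := Real.pi_pos
  have : p.Gam k ≠ 0 := by
    unfold Gam
    positivity
  exact_mod_cast this

theorem tendsto_freq : Tendsto p.freq atTop atTop := by
  have h1 : 0 < Real.pi ^ 2 * p.kbar := by
    have := p.kbar_pos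
    have := Real.pi_pos
    positivity
  have h2 : Tendsto (fun k : ℕ => Real.pi ^ 2 * p.kbar * ((k : ℝ) + 1) ^ 2) atTop atTop :=
    ((tendsto_pow_atTop two_ne_zero).comp
      (tendsto_natCast_atTop_atTop.atTop_add tendsto_const_nhds)).const_mul_atTop h1
  exact h2.congr fun k => (p.freq_eq k).symm

/-- The frequencies tend to infinity. At a pole the singular term is harmless because the inverse of
zero is zero, so `invMul` is defined for every `τ`. -/
theorem exists_inv_bound (τ : ℂ) : ∃ C : ℝ, ∀ k, ‖((p.freq k : ℂ) + τ)⁻¹‖ ≤ C := by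
  have h1 : Tendsto (fun k => ‖(p.freq k : ℂ) + τ‖) atTop atTop := by
    refine tendsto_atTop_mono (fun k => ?_) (tendsto_atTop_add_const_right _ (-‖τ‖) p.tendsto_freq)
    have h2 := norm_sub_norm_le (p.freq k : ℂ) (-τ)
    rw [sub_neg_eq_add, norm_neg, Complex.norm_real, Real.norm_eq_abs] at h2
    linarith [le_abs_self (p.freq k)]
  have h2 : Tendsto (fun k => ‖((p.freq k : ℂ) + τ)⁻¹‖) atTop (𝓝 0) := by
    simpa [Function.comp_def] using tendsto_inv_atTop_zero.comp h1
  obtain ⟨C, hC⟩ := h2.bddAbove_range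
  exact ⟨C, fun k => hC ⟨k, rfl⟩⟩

/-- Multiplication by `(κ̄ λ_k + τ)⁻¹`, the term being dropped at a pole. -/
def invMul (τ : ℂ) (x : EllTwo) : EllTwo :=
  (EllTwo.exists_mul (fun k => ((p.freq k : ℂ) + τ)⁻¹) (p.exists_inv_bound τ).choose_spec x).choose

@[simp] theorem invMul_apply (τ : ℂ) (x : EllTwo) (k : ℕ) :
    p.invMul τ x k = ((p.freq k : ℂ) + τ)⁻¹ * x k :=
  (EllTwo.exists_mul (fun k => ((p.freq k : ℂ) + τ)⁻¹)
    (p.exists_inv_bound τ).choose_spec x).choose_spec.1 k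

theorem norm_invMul_le {τ : ℂ} {C : ℝ} (h : ∀ k, ‖((p.freq k : ℂ) + τ)⁻¹‖ ≤ C) (x : EllTwo) :
    ‖p.invMul τ x‖ ≤ C * ‖x‖ := by
  obtain ⟨y, hy, hn⟩ := EllTwo.exists_mul _ h x
  have : p.invMul τ x = y := by
    apply lp.ext
    funext k
    rw [invMul_apply, hy]
  rwa [this]

/-- `m / γ` -/
def mg : ℂ := ((p.mcoef / p.gam : ℝ) : ℂ)

theorem mg_ne_zero : p.mg ≠ 0 := by
  have : p.mcoef / p.gam ≠ 0 := (div_pos p.mcoef_pos p.gam_pos).ne'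
  unfold mg
  exact_mod_cast this

/-- `∑ Γ_k² / (κ̄ λ_k + τ)` -/
def hfun (τ : ℂ) : ℂ := p.gamPair (p.invMul τ p.gamVec)

/-- The thermal response `1 - τ (m / γ) ∑ Γ_k² / (κ̄ λ_k + τ)`. -/
def yfun (τ : ℂ) : ℂ := 1 - τ * p.mg * p.hfun τ

/-- The polynomial `P / (ρ_l R_*)`. -/
def pfun (τ : ℂ) : ℂ := τ ^ 2 + p.nucoef * τ - p.scoef

/-- A multiple of `Q`. -/
def detfun (τ : ℂ) : ℂ := p.yfun τ * p.pfun τ + p.bcoef * p.acoef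

theorem hasSum_hfun (τ : ℂ) :
    HasSum (fun k => (p.Gam k : ℂ) ^ 2 * ((p.freq k : ℂ) + τ)⁻¹) (p.hfun τ) := by
  refine (p.hasSum_gamPair (p.invMul τ p.gamVec)).congr_fun fun k => ?_
  rw [invMul_apply, gamVec_apply]
  ring

theorem P_eq (τ : ℂ) : p.P τ = p.rhol * p.Rs * p.pfun τ := by
  have h1 : (p.rhol : ℂ) ≠ 0 := by exact_mod_cast p.rhol_pos.ne'
  have h2 : (p.Rs : ℂ) ≠ 0 := by exact_mod_cast p.Rs_pos.ne'
  unfold P pfun nucoef scoef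
  push_cast
  field_simp

theorem mcoef_mul_Gam_sq (k : ℕ) :
    p.mcoef * p.Gam k ^ 2 = 6 / Real.pi ^ 2 * (p.gam - 1) / ((k : ℝ) + 1) ^ 2 := by
  have hg := p.gam_pos.ne'
  have hg1 : p.gam - 1 ≠ 0 := by linarith [p.one_lt_gam]
  have hpi := Real.pi_ne_zero
  have hs2 : (√2 : ℝ) ^ 2 = 2 := Real.sq_sqrt (by norm_num)
  have hsp : √Real.pi ^ 2 = Real.pi := Real.sq_sqrt Real.pi_pos.le
  have hm : ((-1 : ℝ) ^ k) ^ 2 = 1 := by rw [← pow_mul, mul_comm, pow_mul]; norm_num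
  have e : p.Gam k ^ 2 = 4 * √2 ^ 2 * (p.gam - 1) ^ 2 / (√Real.pi ^ 2 * p.gam ^ 2)
      * (((-1 : ℝ) ^ k) ^ 2 / ((k : ℝ) + 1) ^ 2) := by
    unfold Gam
    rw [mul_pow, div_pow, div_pow, mul_pow, mul_pow, mul_pow]
    ring
  rw [e, hs2, hsp, hm]
  unfold mcoef
  have hk : (k : ℝ) + 1 ≠ 0 := by positivity
  field_simp
  ring

/-- The two series agree term by term, because `m Γ_k²` is `6 (γ - 1) / (π² (k + 1)²)`. -/
theorem Q_eq (τ : ℂ) :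
    p.Q τ = 4 * Real.pi * p.rhol * p.Rs / (3 * (p.Rg * p.Tinf)) * p.detfun τ := by
  have hg : (p.gam : ℂ) ≠ 0 := by exact_mod_cast p.gam_pos.ne'
  have hpi : (Real.pi : ℂ) ≠ 0 := by exact_mod_cast Real.pi_ne_zero
  have h1 : (p.rhol : ℂ) ≠ 0 := by exact_mod_cast p.rhol_pos.ne'
  have h2 : (p.Rs : ℂ) ≠ 0 := by exact_mod_cast p.Rs_pos.ne'
  have h3 : (p.Rg : ℂ) ≠ 0 := by exact_mod_cast p.Rg_pos.ne'
  have h4 : (p.Tinf : ℂ) ≠ 0 := by exact_mod_cast p.Tinf_pos.ne'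
  have hsum : 8 * (p.gam - 1) / (Real.pi * p.gam) *
        ∑' j : ℕ, τ / (((j : ℂ) + 1) ^ 2 * (Real.pi ^ 2 * p.kbar * ((j : ℂ) + 1) ^ 2 + τ))
      = 4 * Real.pi / 3 * (τ * p.mg * p.hfun τ) := by
    rw [← (p.hasSum_hfun τ).tsum_eq, ← tsum_mul_left, ← tsum_mul_left, ← tsum_mul_left]
    refine tsum_congr fun k => ?_
    have e1 : (p.mcoef : ℂ) * (p.Gam k : ℂ) ^ 2
        = 6 / Real.pi ^ 2 * (p.gam - 1) / ((k : ℂ) + 1) ^ 2 := by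
      exact_mod_cast congrArg (fun x : ℝ => (x : ℂ)) (p.mcoef_mul_Gam_sq k)
    have e2 : (p.freq k : ℂ) = Real.pi ^ 2 * p.kbar * ((k : ℂ) + 1) ^ 2 := by
      exact_mod_cast congrArg (fun x : ℝ => (x : ℂ)) (p.freq_eq k)
    have e3 : p.mg = p.mcoef / p.gam := by unfold mg; push_cast; rfl
    have e4 : 4 * Real.pi / 3 * (τ * p.mg * ((p.Gam k : ℂ) ^ 2 * ((p.freq k : ℂ) + τ)⁻¹))
        = 4 * Real.pi / 3 * τ / p.gam * (p.mcoef * (p.Gam k : ℂ) ^ 2)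
          * ((p.freq k : ℂ) + τ)⁻¹ := by
      rw [e3]; ring
    rw [e4, e1, e2]
    generalize (Real.pi : ℂ) ^ 2 * p.kbar * ((k : ℂ) + 1) ^ 2 + τ = c
    rw [div_eq_mul_inv τ, mul_inv]
    generalize c⁻¹ = c'
    have hk : (k : ℂ) + 1 ≠ 0 := Nat.cast_add_one_ne_zero k
    field_simp
    ring
  rw [Q, hsum, P_eq, detfun, yfun, bcoef, acoef]
  push_cast
  field_simp

theorem Q_eq_zero_iff (τ : ℂ) : p.Q τ = 0 ↔ p.detfun τ = 0 := by
  have hpi : (Real.pi : ℂ) ≠ 0 := by exact_mod_cast Real.pi_ne_zero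
  have h1 : (p.rhol : ℂ) ≠ 0 := by exact_mod_cast p.rhol_pos.ne'
  have h2 : (p.Rs : ℂ) ≠ 0 := by exact_mod_cast p.Rs_pos.ne'
  have h3 : (p.Rg : ℂ) ≠ 0 := by exact_mod_cast p.Rg_pos.ne'
  have h4 : (p.Tinf : ℂ) ≠ 0 := by exact_mod_cast p.Tinf_pos.ne'
  rw [Q_eq, mul_eq_zero, or_iff_right]
  simp [hpi, h1, h2, h3, h4]

theorem P_eq_zero_iff (τ : ℂ) : p.P τ = 0 ↔ p.pfun τ = 0 := by
  have h1 : (p.rhol : ℂ) ≠ 0 := by exact_mod_cast p.rhol_pos.ne'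
  have h2 : (p.Rs : ℂ) ≠ 0 := by exact_mod_cast p.Rs_pos.ne'
  rw [P_eq, mul_eq_zero, or_iff_right]
  simp [h1, h2]

theorem massL_cons (a b : ℂ) (c : EllTwo) :
    p.massL (EllTwo.cons a b c) = -p.mg * p.gamPair c - p.acoef * a := by
  rw [massL_eq, EllTwo.tail_cons, EllTwo.cons_zero]
  rfl

/-- The resolvent equation in coordinates. -/
theorem isImage_resolvent_iff {w f : EllTwo} {τ : ℂ} :
    p.IsImage w (f + τ • w) ↔ w 1 = τ * w 0 + f 0 ∧
      p.pfun τ * w 0 - p.bcoef * p.massL w = -f 1 - (τ + p.nucoef) * f 0 ∧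
      ∀ k, ((p.freq k : ℂ) + τ) * w (k + 2)
        = -f (k + 2) - p.Gam k * (p.massL f + τ * p.massL w) := by
  unfold IsImage pfun
  simp only [map_add, map_smul, smul_eq_mul, lp.coeFn_add, lp.coeFn_smul, Pi.add_apply,
    Pi.smul_apply]
  constructor
  · rintro ⟨h0, h1, h2⟩
    refine ⟨by linear_combination -h0, ?_, fun k => by linear_combination h2 k⟩
    -- Substituting `w₁ = τ R + f₀` into the momentum row produces the quadratic `pfun` and the
    -- datum `(τ + ν) f₀`.
    linear_combination h1 + (τ + p.nucoef) * h0
  · rintro ⟨h0, h1, h2⟩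
    refine ⟨by linear_combination -h0, ?_, fun k => by linear_combination h2 k⟩
    linear_combination h1 + (τ + p.nucoef) * h0

theorem gamPair_unit (k : ℕ) (α : ℂ) : p.gamPair (EllTwo.unit k α) = p.Gam k * α := by
  refine (p.hasSum_gamPair (EllTwo.unit k α)).unique ?_
  refine (hasSum_ite_eq k ((p.Gam k : ℂ) * α)).congr_fun fun j => ?_
  rw [EllTwo.unit_apply]
  rcases eq_or_ne j k with rfl | h
  · simp
  · simp [h]

/-! ### Spectrum away from the poles of `Q` -/

section Regular

variable {p} {τ : ℂ} (hτ : ∀ k, (p.freq k : ℂ) + τ ≠ 0)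

include hτ

/-- Off the poles the thermal rows are solved for the tail of `w`; inserting this tail into the mass
functional gives one scalar equation linking `z` and `R`. -/
theorem reduced_of_isImage {w f : EllTwo} (h : p.IsImage w (f + τ • w)) :
    EllTwo.tail w = -p.invMul τ (EllTwo.tail f)
      - (p.massL f + τ * p.massL w) • p.invMul τ p.gamVec ∧
    p.yfun τ * p.massL w + p.acoef * w 0
      = p.mg * (p.gamPair (p.invMul τ (EllTwo.tail f)) + p.hfun τ * p.massL f) := by
  obtain ⟨-, -, h2⟩ := p.isImage_resolvent_iff.1 h
  have ht : EllTwo.tail w = -p.invMul τ (EllTwo.tail f)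
      - (p.massL f + τ * p.massL w) • p.invMul τ p.gamVec := by
    apply lp.ext
    funext k
    simp only [EllTwo.tail_apply, lp.coeFn_sub, lp.coeFn_neg, lp.coeFn_smul, Pi.sub_apply,
      Pi.neg_apply, Pi.smul_apply, smul_eq_mul, invMul_apply, gamVec_apply]
    have h3 := h2 k
    have h4 := hτ k
    field_simp
    linear_combination h3
  refine ⟨ht, ?_⟩
  have h3 := p.massL_eq w
  rw [ht] at h3
  simp only [map_sub, map_neg, map_smul, smul_eq_mul] at h3
  change p.massL w = -p.mg * (-p.gamPair _ - _ * p.hfun τ) - _ at h3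
  rw [yfun]
  linear_combination h3

/-- Converse of the reduction: the vector is rebuilt from `R` and `z`, and `h1` is precisely the
consistency condition that its mass functional equals the prescribed `z`. -/
theorem isImage_of_reduced {f : EllTwo} {R z : ℂ}
    (h1 : p.yfun τ * z + p.acoef * R
      = p.mg * (p.gamPair (p.invMul τ (EllTwo.tail f)) + p.hfun τ * p.massL f))
    (h2 : p.pfun τ * R - p.bcoef * z = -f 1 - (τ + p.nucoef) * f 0) :
    ∃ w : EllTwo, w 0 = R ∧ p.massL w = z ∧ p.IsImage w (f + τ • w) := by
  set w := EllTwo.cons R (τ * R + f 0) (-p.invMul τ (EllTwo.tail f)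
      - (p.massL f + τ * z) • p.invMul τ p.gamVec) with hw
  have hz : p.massL w = z := by
    rw [hw, massL_cons]
    simp only [map_sub, map_neg, map_smul, smul_eq_mul]
    change -p.mg * (-p.gamPair _ - _ * p.hfun τ) - _ = z
    rw [yfun] at h1
    linear_combination -h1
  refine ⟨w, rfl, hz, p.isImage_resolvent_iff.2 ⟨rfl, ?_, fun k => ?_⟩⟩
  · rw [hz]
    exact h2
  · rw [hz, hw, EllTwo.cons_add_two]
    simp only [EllTwo.tail_apply, lp.coeFn_sub, lp.coeFn_neg, lp.coeFn_smul, Pi.sub_apply,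
      Pi.neg_apply, Pi.smul_apply, smul_eq_mul, invMul_apply, gamVec_apply]
    have h4 := hτ k
    field_simp

theorem mem_resolventDomain_of_detfun_ne_zero (hD : p.detfun τ ≠ 0) :
    τ ∈ resolventDomain p.generator := by
  refine mem_resolventDomain_of_bijective p.generator_isClosed (fun w hw => ?_) fun f => ?_
  · rw [mem_graph_iff, ← zero_add (τ • w)] at hw
    obtain ⟨ht, h1⟩ := reduced_of_isImage hτ hw
    obtain ⟨h0, h2, -⟩ := p.isImage_resolvent_iff.1 hw
    have hzero : p.invMul τ 0 = 0 := by
      apply lp.ext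
      funext k
      simp
    simp only [map_zero, hzero, mul_zero, add_zero, lp.coeFn_zero, Pi.zero_apply, neg_zero,
      sub_zero, zero_add] at ht h0 h1 h2
    have hR : p.detfun τ * w 0 = 0 := by
      rw [detfun]
      linear_combination p.yfun τ * h2 + p.bcoef * h1
    have hz : p.detfun τ * p.massL w = 0 := by
      rw [detfun]
      linear_combination p.pfun τ * h1 - p.acoef * h2
    have hR' := (mul_eq_zero.1 hR).resolve_left hD
    have hz' := (mul_eq_zero.1 hz).resolve_left hD
    rw [hz', mul_zero, zero_smul, sub_zero] at ht
    rw [hR', mul_zero] at h0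
    apply lp.ext
    funext i
    match i with
    | 0 => simpa using hR'
    | 1 => simpa using h0
    | k + 2 =>
      have := congrArg (fun x : EllTwo => x k) ht
      simpa using this
  · set F₁ := p.mg * (p.gamPair (p.invMul τ (EllTwo.tail f)) + p.hfun τ * p.massL f) with hF₁
    set F₂ := -f 1 - (τ + p.nucoef) * f 0 with hF₂
    -- The values of `R` and `z` are given by Cramer's rule for the reduced 2×2 system with
    -- determinant `detfun`.
    obtain ⟨w, -, -, hw⟩ := isImage_of_reduced (p := p) hτ (f := f)
      (R := (p.yfun τ * F₂ + p.bcoef * F₁) / p.detfun τ)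
      (z := (p.pfun τ * F₁ - p.acoef * F₂) / p.detfun τ) (by
        rw [← hF₁]
        field_simp
        rw [detfun]
        ring) (by
        rw [← hF₂]
        field_simp
        rw [detfun]
        ring)
    exact ⟨w, p.mem_graph_iff.2 hw⟩

omit hτ in
theorem notMem_resolventDomain_of_eigenvector {w : EllTwo} (hw : p.IsImage w (τ • w))
    (hne : w ≠ 0) : τ ∉ resolventDomain p.generator := by
  rintro ⟨S, hS⟩
  have := (isResolventAt_iff.1 hS _ _).1 (p.mem_graph_iff.2 hw)
  rw [sub_self, map_zero] at this
  exact hne this.symm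

theorem exists_eigenvector (hD : p.detfun τ = 0) : ∃ w : EllTwo, w ≠ 0 ∧ p.IsImage w (τ • w) := by
  have hzero : p.invMul τ (EllTwo.tail 0) = 0 := by
    apply lp.ext
    funext k
    simp
  -- The pair `(bcoef, pfun τ)` spans the kernel of the singular 2×2 system, and it is nonzero
  -- because `bcoef` is positive.
  obtain ⟨w, hR, -, hw⟩ := isImage_of_reduced (p := p) hτ (f := 0) (R := p.bcoef) (z := p.pfun τ)
    (by
      rw [hzero]
      simp only [map_zero, mul_zero, add_zero]
      rw [detfun] at hD
      linear_combination hD)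
    (by simp [mul_comm])
  rw [zero_add] at hw
  refine ⟨w, ?_, hw⟩
  rintro rfl
  have hb : (p.bcoef : ℂ) ≠ 0 := by
    have : 0 < p.bcoef := by
      have := p.Rg_pos
      have := p.Tinf_pos
      have := p.rhol_pos
      have := p.Rs_pos
      unfold bcoef
      positivity
    exact_mod_cast this.ne'
  exact hb hR.symm

theorem notMem_resolventDomain_of_detfun_eq_zero (hD : p.detfun τ = 0) :
    τ ∉ resolventDomain p.generator := by
  obtain ⟨w, hne, hw⟩ := exists_eigenvector hτ hD
  exact notMem_resolventDomain_of_eigenvector hw hne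

end Regular

/-! ### Spectrum at the poles of `Q` -/

section Pole

variable {p} {τ : ℂ} {k₀ : ℕ} (hτ : (p.freq k₀ : ℂ) + τ = 0)

include hτ

theorem ne_zero_of_pole : τ ≠ 0 := by
  rintro rfl
  have : p.freq k₀ = 0 := by exact_mod_cast (add_zero (p.freq k₀ : ℂ)) ▸ hτ
  exact (p.freq_pos k₀).ne' this

theorem freq_add_ne_zero_of_pole {k : ℕ} (hk : k ≠ k₀) : (p.freq k : ℂ) + τ ≠ 0 := by
  intro h
  have : (p.freq k : ℂ) = p.freq k₀ := by linear_combination h - hτ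
  exact hk (p.freq_injective (by exact_mod_cast this))

/-- In row `k₀` the coefficient of `c_{k₀}` vanishes, so that row fixes `z`, as `Γ_{k₀}` and `τ` are
nonzero. The quadratic row then fixes `R`, the other rows fix the other modes, and the free mode
`c_{k₀}` is determined by the mass balance. -/
theorem mem_resolventDomain_of_pole (hP : p.pfun τ ≠ 0) : τ ∈ resolventDomain p.generator := by
  have hτ0 := ne_zero_of_pole hτ
  have hG := p.Gam_ne_zero k₀
  have hmg := p.mg_ne_zero
  refine mem_resolventDomain_of_bijective p.generator_isClosed (fun w hw => ?_) fun f => ?_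
  · rw [mem_graph_iff, ← zero_add (τ • w)] at hw
    obtain ⟨h0, h1, h2⟩ := p.isImage_resolvent_iff.1 hw
    simp only [map_zero, lp.coeFn_zero, Pi.zero_apply, neg_zero, add_zero, mul_zero,
      sub_zero, zero_add, zero_sub] at h0 h1 h2
    have hz : p.massL w = 0 := by
      have := h2 k₀
      rw [hτ, zero_mul, eq_comm, neg_eq_zero] at this
      simpa [hG, hτ0] using this
    rw [hz] at h1 h2
    simp only [mul_zero, sub_zero, neg_zero] at h1 h2
    have hR : w 0 = 0 := (mul_eq_zero.1 h1).resolve_left hP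
    rw [hR, mul_zero] at h0
    have hk : ∀ k, k ≠ k₀ → w (k + 2) = 0 := fun k hk =>
      (mul_eq_zero.1 (h2 k)).resolve_left (freq_add_ne_zero_of_pole hτ hk)
    have ht : EllTwo.tail w = EllTwo.unit k₀ (w (k₀ + 2)) := by
      apply lp.ext
      funext k
      rw [EllTwo.unit_apply, EllTwo.tail_apply]
      rcases eq_or_ne k k₀ with rfl | h
      · simp
      · rw [if_neg h, hk k h]
    have hk₀ : w (k₀ + 2) = 0 := by
      have h3 := p.massL_eq w
      rw [hz, ht, gamPair_unit, hR, mul_zero, sub_zero] at h3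
      change 0 = -p.mg * _ at h3
      rw [eq_comm, neg_mul, neg_eq_zero] at h3
      simpa [hmg, hG] using h3
    apply lp.ext
    funext i
    match i with
    | 0 => simpa using hR
    | 1 => simpa using h0
    | k + 2 =>
      rcases eq_or_ne k k₀ with rfl | h
      · simpa using hk₀
      · simpa using hk k h
  · set z := -(f (k₀ + 2) / p.Gam k₀ + p.massL f) / τ with hz
    set R := (-f 1 - (τ + p.nucoef) * f 0 + p.bcoef * z) / p.pfun τ with hR
    set c₀ := -p.invMul τ (EllTwo.tail f) - (p.massL f + τ * z) • p.invMul τ p.gamVec with hc₀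
    set α := (-(z + p.acoef * R) / p.mg - p.gamPair c₀) / p.Gam k₀ with hα
    set w := EllTwo.cons R (τ * R + f 0) (c₀ + EllTwo.unit k₀ α) with hw
    have hzw : p.massL w = z := by
      rw [hw, massL_cons, map_add, gamPair_unit, hα]
      field_simp
      ring
    refine ⟨w, p.mem_graph_iff.2 (p.isImage_resolvent_iff.2 ⟨rfl, ?_, fun k => ?_⟩)⟩
    · rw [hzw, hw, EllTwo.cons_zero, hR]
      field_simp
      ring
    · rw [hzw]
      rcases eq_or_ne k k₀ with rfl | hk
      · rw [hτ, hz]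
        field_simp
        ring
      · have h4 := freq_add_ne_zero_of_pole hτ hk
        rw [hw, EllTwo.cons_add_two, hc₀]
        simp only [EllTwo.tail_apply, lp.coeFn_add, lp.coeFn_sub, lp.coeFn_neg, lp.coeFn_smul,
          Pi.add_apply, Pi.sub_apply, Pi.neg_apply, Pi.smul_apply, smul_eq_mul, invMul_apply,
          gamVec_apply, EllTwo.unit_apply, if_neg hk, add_zero]
        field_simp

/-- An eigenvector with `z = 0`: a radial oscillation whose contribution to the mass is compensated
by the single mode `k₀`. -/
theorem notMem_resolventDomain_of_pole (hP : p.pfun τ = 0) :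
    τ ∉ resolventDomain p.generator := by
  have hG := p.Gam_ne_zero k₀
  have hmg := p.mg_ne_zero
  set w := EllTwo.cons 1 τ (EllTwo.unit k₀ (-p.acoef / (p.mg * p.Gam k₀))) with hw
  have hz : p.massL w = 0 := by
    rw [hw, massL_cons, gamPair_unit]
    field_simp
    ring
  refine notMem_resolventDomain_of_eigenvector (w := w) ?_ ?_
  · rw [← zero_add (τ • w), isImage_resolvent_iff, hz]
    refine ⟨by simp [hw], by simp [hP], fun k => ?_⟩
    simp only [map_zero, mul_zero, lp.coeFn_zero, Pi.zero_apply, add_zero, neg_zero, sub_zero]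
    rcases eq_or_ne k k₀ with rfl | hk
    · rw [hτ, zero_mul]
    · rw [hw, EllTwo.cons_add_two, EllTwo.unit_apply, if_neg hk, mul_zero]
  · intro h
    have := congrArg (fun x : EllTwo => x 0) h
    simp [hw] at this

end Pole

theorem ne_pole_iff {τ : ℂ} {k : ℕ} : τ ≠ p.pole k ↔ (p.freq k : ℂ) + τ ≠ 0 := by
  rw [pole_eq, ne_eq, ne_eq, eq_neg_iff_add_eq_zero, add_comm]

theorem notMem_resolventDomain_iff (τ : ℂ) :
    τ ∉ resolventDomain p.generator ↔ τ ∈ p.zerosQ ∪ p.resonances := by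
  by_cases h : ∀ j, τ ≠ p.pole j
  · have h' : ∀ k, (p.freq k : ℂ) + τ ≠ 0 := fun k => p.ne_pole_iff.1 (h k)
    have e : τ ∈ p.zerosQ ∪ p.resonances ↔ p.detfun τ = 0 := by
      rw [← Q_eq_zero_iff]
      constructor
      · rintro (h1 | ⟨⟨j, hj⟩, -⟩)
        · exact h1.2
        · exact absurd hj (h j)
      · exact fun h1 => Or.inl ⟨h, h1⟩
    rw [e]
    exact ⟨fun h1 => by_contra fun h2 => h1 (mem_resolventDomain_of_detfun_ne_zero h' h2),
      notMem_resolventDomain_of_detfun_eq_zero h'⟩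
  · have hex := h
    push Not at hex
    obtain ⟨k, hk⟩ := hex
    have h' : (p.freq k : ℂ) + τ = 0 := by rw [hk, pole_eq]; ring
    have e : τ ∈ p.zerosQ ∪ p.resonances ↔ p.pfun τ = 0 := by
      rw [← P_eq_zero_iff]
      constructor
      · rintro (h1 | h1)
        · exact absurd h1.1 h
        · exact h1.2
      · exact fun h1 => Or.inr ⟨⟨k, hk⟩, h1⟩
    rw [e]
    exact ⟨fun h1 => by_contra fun h2 => h1 (mem_resolventDomain_of_pole h' h2),
      notMem_resolventDomain_of_pole h'⟩

theorem unboundedSpectrum_generator :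
    unboundedSpectrum p.generator = p.zerosQ ∪ p.resonances := by
  ext τ
  exact p.notMem_resolventDomain_iff τ

end BubbleParams

/-! ## Resolvent estimate in a sector -/

namespace BubbleParams

variable (p : BubbleParams)

theorem hasSum_Gam_sq' : HasSum (fun k => p.mcoef * p.Gam k ^ 2) (p.gam - 1) := by
  have h := p.hasSum_Gam_sq.mul_left p.mcoef
  have h3 := p.gam_pos.ne'
  have h4 : p.gam - 1 ≠ 0 := by linarith [p.one_lt_gam]
  have e : p.mcoef * (4 * Real.pi * (p.gam - 1) ^ 2 / (3 * p.gam ^ 2)) = p.gam - 1 := by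
    have := Real.pi_ne_zero
    unfold mcoef
    field_simp
  rw [e] at h
  exact h.congr_fun fun k => by ring

/-- Uses `1 - τ / (q + τ) = q / (q + τ)` with the weights `m Γ_k²`, which sum to `γ - 1`. Positivity
of the weights is the source of every bound on `yfun`. -/
theorem hasSum_yfun {τ : ℂ} (hτ : ∀ k, (p.freq k : ℂ) + τ ≠ 0) :
    HasSum (fun k => ((p.mcoef * p.Gam k ^ 2 : ℝ) : ℂ) * (p.freq k * ((p.freq k : ℂ) + τ)⁻¹))
      (p.gam * p.yfun τ - 1) := by
  have h1 := Complex.hasSum_ofReal.2 p.hasSum_Gam_sq'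
  have h2 := (p.hasSum_hfun τ).mul_left (τ * p.mcoef)
  have hg : (p.gam : ℂ) ≠ 0 := by exact_mod_cast p.gam_pos.ne'
  have e : p.gam * p.yfun τ - 1 = ((p.gam - 1 : ℝ) : ℂ) - τ * p.mcoef * p.hfun τ := by
    rw [yfun, mg]
    push_cast
    field_simp
    ring
  rw [e]
  refine (h1.sub h2).congr_fun fun k => ?_
  have := hτ k
  push_cast
  field_simp
  ring

/-! ### Bounds in the sector `Re τ ≥ -|Im τ|` -/

section Sector

variable {p} {τ : ℂ} (hτ : -|τ.im| ≤ τ.re)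

include hτ

/-- For `Re τ ≥ 0`, adding a positive number increases the modulus. Otherwise `|Im τ| ≥ |Re τ|`, and
the imaginary part alone suffices. -/
theorem norm_freq_add_ge (k : ℕ) : ‖τ‖ / 2 ≤ ‖(p.freq k : ℂ) + τ‖ := by
  have hq := p.freq_pos k
  rw [← sq_le_sq₀ (by positivity) (by positivity), div_pow, ← Complex.normSq_eq_norm_sq,
    ← Complex.normSq_eq_norm_sq, Complex.normSq_apply, Complex.normSq_apply]
  simp only [Complex.add_re, Complex.add_im, Complex.ofReal_re, Complex.ofReal_im, zero_add]
  rcases le_or_gt 0 τ.re with h | h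
  · nlinarith [_root_.mul_nonneg hq.le h, sq_nonneg τ.im, sq_nonneg τ.re, sq_nonneg (p.freq k)]
  · have : τ.re ^ 2 ≤ τ.im ^ 2 := by
      rw [← sq_abs τ.im]
      nlinarith [abs_nonneg τ.im]
    nlinarith [sq_nonneg (p.freq k + τ.re)]

theorem freq_add_ne_zero_of_sector (h0 : τ ≠ 0) (k : ℕ) : (p.freq k : ℂ) + τ ≠ 0 := by
  have h1 := norm_freq_add_ge (p := p) hτ k
  have h2 := norm_pos_iff.2 h0
  exact norm_pos_iff.1 (by linarith)

theorem norm_mul_norm_invMul_le (x : EllTwo) : ‖τ‖ * ‖p.invMul τ x‖ ≤ 2 * ‖x‖ := by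
  rcases eq_or_ne τ 0 with rfl | h0
  · simp
  have h2 := norm_pos_iff.2 h0
  have h := p.norm_invMul_le (τ := τ) (C := 2 / ‖τ‖) (fun k => by
    rw [norm_inv, ← inv_div]
    exact inv_anti₀ (by positivity) (norm_freq_add_ge hτ k)) x
  calc ‖τ‖ * ‖p.invMul τ x‖ ≤ ‖τ‖ * (2 / ‖τ‖ * ‖x‖) := by gcongr
    _ = 2 * ‖x‖ := by field_simp

/-- After multiplication by `ω = 1 + i s`, with `s = ±1` chosen so that `s Im τ = |Im τ|`, the real
part of each term of `hasSum_yfun` has the sign of `q_k + Re τ + |Im τ| ≥ 0`. Hence `Re (ω γ yfun) ≥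
1`, and `|ω| ≤ 2`. -/
theorem one_le_norm_yfun (h0 : τ ≠ 0) : 1 ≤ 2 * p.gam * ‖p.yfun τ‖ := by
  have hg := p.gam_pos
  obtain ⟨s, hs, hsi⟩ : ∃ s : ℝ, |s| = 1 ∧ s * τ.im = |τ.im| := by
    rcases le_total 0 τ.im with h | h
    · exact ⟨1, by simp, by simp [abs_of_nonneg h]⟩
    · exact ⟨-1, by simp, by simp [abs_of_nonpos h]⟩
  set ω : ℂ := ⟨1, s⟩ with hω
  have hωn : ‖ω‖ ≤ 2 := by
    have := Complex.norm_le_abs_re_add_abs_im ω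
    rw [hω] at this ⊢
    simp only [abs_one, hs] at this
    linarith
  have h1 := Complex.reCLM.hasSum ((p.hasSum_yfun (freq_add_ne_zero_of_sector hτ h0)).mul_left ω)
  have h2 : 0 ≤ Complex.reCLM (ω * (p.gam * p.yfun τ - 1)) := by
    refine h1.nonneg fun k => ?_
    have hq := p.freq_pos k
    have hm := p.mcoef_pos
    have e : Complex.reCLM (ω * (((p.mcoef * p.Gam k ^ 2 : ℝ) : ℂ)
        * (p.freq k * ((p.freq k : ℂ) + τ)⁻¹)))
        = p.mcoef * p.Gam k ^ 2 * p.freq k * (p.freq k + τ.re + s * τ.im)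
          / Complex.normSq ((p.freq k : ℂ) + τ) := by
      simp [hω, Complex.inv_re, Complex.inv_im, -Complex.ofReal_mul, -Complex.ofReal_pow]
      ring
    rw [e, hsi]
    have := Complex.normSq_nonneg ((p.freq k : ℂ) + τ)
    have : 0 ≤ p.freq k + τ.re + |τ.im| := by linarith
    positivity
  have h3 : 1 ≤ (ω * (p.gam * p.yfun τ)).re := by
    have : (ω * (p.gam * p.yfun τ - 1)).re = (ω * (p.gam * p.yfun τ)).re - 1 := by
      rw [mul_sub, mul_one, Complex.sub_re]
    change 0 ≤ (ω * (p.gam * p.yfun τ - 1)).re at h2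
    linarith
  calc (1 : ℝ) ≤ ‖ω * (p.gam * p.yfun τ)‖ := h3.trans (Complex.re_le_norm _)
    _ = ‖ω‖ * (p.gam * ‖p.yfun τ‖) := by
      rw [norm_mul, norm_mul, Complex.norm_real, Real.norm_eq_abs, abs_of_pos hg]
    _ ≤ 2 * (p.gam * ‖p.yfun τ‖) := by gcongr
    _ = 2 * p.gam * ‖p.yfun τ‖ := by ring

end Sector

/-- The rows for `R` and `R'` involve only bounded functionals of `w`. The thermal part is
controlled by `|τ| ‖invMul‖ ≤ 2` and by the reduced equation, in which the lower bound on `yfun`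
allows solving for `z`. The term `‖w‖` on the right is left to be absorbed for large `τ`. -/
theorem exists_apriori : ∃ C : ℝ, 0 < C ∧ ∀ (τ : ℂ) (w f : EllTwo), -|τ.im| ≤ τ.re → τ ≠ 0 →
    p.IsImage w (f + τ • w) → ‖τ‖ * ‖w‖ ≤ C * (‖f‖ + ‖w‖) := by
  set G := ‖p.gamVec‖ with hG
  set M := ‖p.massL‖ with hM
  have hγ := p.gam_pos
  set K₁ := ‖(p.bcoef : ℂ)‖ * M + ‖(p.scoef : ℂ)‖ + ‖(p.nucoef : ℂ)‖ with hK₁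
  set K₂ := 2 * p.gam * (‖(p.acoef : ℂ)‖ + ‖p.mg‖ * (2 * G + 2 * G ^ 2 * M)) with hK₂
  have hG0 : 0 ≤ G := norm_nonneg _
  have hM0 : 0 ≤ M := norm_nonneg _
  have hK₁0 : 0 ≤ K₁ := by positivity
  have hK₂0 : 0 ≤ K₂ := by positivity
  refine ⟨1 + (1 + K₁) + (2 + (M + K₂) * (2 * G)), by positivity, fun τ w f hτ h0 hw => ?_⟩
  have hτp := norm_pos_iff.2 h0
  set N := ‖f‖ + ‖w‖ with hN
  have hf : ‖f‖ ≤ N := le_add_of_nonneg_right (norm_nonneg _)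
  have hw' : ‖w‖ ≤ N := le_add_of_nonneg_left (norm_nonneg _)
  have hN0 : 0 ≤ N := by positivity
  have i0 := hw.1
  have i1 := hw.2.1
  simp only [lp.coeFn_add, lp.coeFn_smul, Pi.add_apply, Pi.smul_apply, smul_eq_mul] at i0 i1
  obtain ⟨ht, hy⟩ := reduced_of_isImage (freq_add_ne_zero_of_sector hτ h0) hw
  have b0 : ‖τ‖ * ‖w 0‖ ≤ N := by
    rw [← norm_mul, show τ * w 0 = w 1 - f 0 by rw [← i0]; ring]
    refine (norm_sub_le _ _).trans ?_
    linarith [EllTwo.norm_apply_le w 1, EllTwo.norm_apply_le f 0]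
  have hmass : ‖p.massL w‖ ≤ M * ‖w‖ := p.massL.le_opNorm w
  have hmassf : ‖p.massL f‖ ≤ M * ‖f‖ := p.massL.le_opNorm f
  have b1 : ‖τ‖ * ‖w 1‖ ≤ (1 + K₁) * N := by
    rw [← norm_mul, show τ * w 1 = p.bcoef * p.massL w + p.scoef * w 0 - p.nucoef * w 1 - f 1 by
      rw [← i1]; ring]
    calc ‖p.bcoef * p.massL w + p.scoef * w 0 - p.nucoef * w 1 - f 1‖
        ≤ ‖(p.bcoef : ℂ) * p.massL w‖ + ‖(p.scoef : ℂ) * w 0‖ + ‖(p.nucoef : ℂ) * w 1‖ + ‖f 1‖ :=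
          (norm_sub_le _ _).trans (add_le_add_left
            ((norm_sub_le _ _).trans (add_le_add_left (norm_add_le _ _) _)) _)
      _ ≤ ‖(p.bcoef : ℂ)‖ * (M * N) + ‖(p.scoef : ℂ)‖ * N + ‖(p.nucoef : ℂ)‖ * N + N := by
          rw [norm_mul, norm_mul, norm_mul]
          gcongr
          · exact hmass.trans (by gcongr)
          · exact (EllTwo.norm_apply_le w 0).trans hw'
          · exact (EllTwo.norm_apply_le w 1).trans hw'
          · exact (EllTwo.norm_apply_le f 1).trans hf
      _ = (1 + K₁) * N := by rw [hK₁]; ring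
  have hi := norm_mul_norm_invMul_le (p := p) hτ
  have hmassf' : ‖p.massL f‖ ≤ M * N := hmassf.trans (by gcongr)
  have hiG : ‖τ‖ * ‖p.invMul τ p.gamVec‖ ≤ 2 * G := hi _
  have hif : ‖τ‖ * ‖p.invMul τ (EllTwo.tail f)‖ ≤ 2 * N :=
    (hi _).trans (mul_le_mul_of_nonneg_left ((EllTwo.norm_tail_le f).trans hf) two_pos.le)
  have b2 : ‖τ‖ * ‖p.massL w‖ ≤ K₂ * N := by
    have h1 := one_le_norm_yfun (p := p) hτ h0
    have h2 : ‖τ‖ * ‖p.gamPair (p.invMul τ (EllTwo.tail f))‖ ≤ 2 * G * N := by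
      calc ‖τ‖ * ‖p.gamPair (p.invMul τ (EllTwo.tail f))‖
          ≤ ‖τ‖ * (G * ‖p.invMul τ (EllTwo.tail f)‖) := by gcongr; exact p.norm_gamPair_le _
        _ = G * (‖τ‖ * ‖p.invMul τ (EllTwo.tail f)‖) := by ring
        _ ≤ G * (2 * N) := by
          gcongr
        _ = 2 * G * N := by ring
    have h3 : ‖τ‖ * ‖p.hfun τ‖ ≤ 2 * G ^ 2 := by
      calc ‖τ‖ * ‖p.hfun τ‖ ≤ ‖τ‖ * (G * ‖p.invMul τ p.gamVec‖) := by
            gcongr; exact p.norm_gamPair_le _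
        _ = G * (‖τ‖ * ‖p.invMul τ p.gamVec‖) := by ring
        _ ≤ G * (2 * G) := by gcongr
        _ = 2 * G ^ 2 := by ring
    have h4 : ‖τ‖ * ‖p.yfun τ * p.massL w‖
        ≤ (‖(p.acoef : ℂ)‖ + ‖p.mg‖ * (2 * G + 2 * G ^ 2 * M)) * N := by
      rw [show p.yfun τ * p.massL w = p.mg * (p.gamPair (p.invMul τ (EllTwo.tail f))
        + p.hfun τ * p.massL f) - p.acoef * w 0 by rw [← hy]; ring]
      calc _ ≤ ‖τ‖ * (‖p.mg‖ * (‖p.gamPair (p.invMul τ (EllTwo.tail f))‖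
              + ‖p.hfun τ‖ * ‖p.massL f‖) + ‖(p.acoef : ℂ)‖ * ‖w 0‖) := by
            gcongr
            refine (norm_sub_le _ _).trans ?_
            rw [norm_mul, norm_mul, ← norm_mul (p.hfun τ)]
            gcongr
            exact norm_add_le _ _
        _ = ‖p.mg‖ * (‖τ‖ * ‖p.gamPair (p.invMul τ (EllTwo.tail f))‖
              + (‖τ‖ * ‖p.hfun τ‖) * ‖p.massL f‖) + ‖(p.acoef : ℂ)‖ * (‖τ‖ * ‖w 0‖) := by ring
        _ ≤ ‖p.mg‖ * (2 * G * N + 2 * G ^ 2 * (M * N)) + ‖(p.acoef : ℂ)‖ * N := by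
            gcongr
        _ = _ := by ring
    calc ‖τ‖ * ‖p.massL w‖ ≤ (2 * p.gam * ‖p.yfun τ‖) * (‖τ‖ * ‖p.massL w‖) :=
          le_mul_of_one_le_left (by positivity) h1
      _ = 2 * p.gam * (‖τ‖ * ‖p.yfun τ * p.massL w‖) := by rw [norm_mul]; ring
      _ ≤ 2 * p.gam * ((‖(p.acoef : ℂ)‖ + ‖p.mg‖ * (2 * G + 2 * G ^ 2 * M)) * N) := by gcongr
      _ = K₂ * N := by rw [hK₂]; ring
  have b3 : ‖τ‖ * ‖EllTwo.tail w‖ ≤ (2 + (M + K₂) * (2 * G)) * N := by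
    rw [ht]
    calc ‖τ‖ * ‖-p.invMul τ (EllTwo.tail f)
          - (p.massL f + τ * p.massL w) • p.invMul τ p.gamVec‖
        ≤ ‖τ‖ * (‖p.invMul τ (EllTwo.tail f)‖
          + (‖p.massL f‖ + ‖τ‖ * ‖p.massL w‖) * ‖p.invMul τ p.gamVec‖) := by
          gcongr
          refine (norm_sub_le _ _).trans ?_
          rw [norm_neg, norm_smul, ← norm_mul τ]
          gcongr
          exact norm_add_le _ _
      _ = ‖τ‖ * ‖p.invMul τ (EllTwo.tail f)‖
          + (‖p.massL f‖ + ‖τ‖ * ‖p.massL w‖) * (‖τ‖ * ‖p.invMul τ p.gamVec‖) := by ring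
      _ ≤ 2 * N + (M * N + K₂ * N) * (2 * G) := by
          gcongr
      _ = _ := by ring
  calc ‖τ‖ * ‖w‖ ≤ ‖τ‖ * (‖w 0‖ + ‖w 1‖ + ‖EllTwo.tail w‖) := by
        gcongr; exact EllTwo.norm_le w
    _ = ‖τ‖ * ‖w 0‖ + ‖τ‖ * ‖w 1‖ + ‖τ‖ * ‖EllTwo.tail w‖ := by ring
    _ ≤ N + (1 + K₁) * N + (2 + (M + K₂) * (2 * G)) * N := by gcongr
    _ = _ := by ring

theorem exists_hasSectorEstimate : ∃ ρ M : ℝ, HasSectorEstimate p.generator ρ M := by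
  obtain ⟨C, hC, h⟩ := p.exists_apriori
  have key : ∀ (τ : ℂ) (w f : EllTwo), -|τ.im| ≤ τ.re → 2 * C ≤ ‖τ‖ →
      p.IsImage w (f + τ • w) → ‖τ‖ * ‖w‖ ≤ 2 * C * ‖f‖ := by
    intro τ w f hτ hn hw
    have h0 : τ ≠ 0 := norm_pos_iff.1 (by linarith)
    have h1 := h τ w f hτ h0 hw
    nlinarith [norm_nonneg w]
  -- For `‖τ‖ ≥ 2C` the term `C ‖w‖` is at most half of the left side, which doubles the constant.
  refine ⟨2 * C, 2 * C, fun τ hτ hn => ?_⟩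
  have hpos : 0 < ‖τ‖ := by linarith
  have h0 : τ ≠ 0 := norm_pos_iff.1 hpos
  have hp := freq_add_ne_zero_of_sector (p := p) hτ h0
  have hD : p.detfun τ ≠ 0 := by
    intro hD
    obtain ⟨w, hw0, hw⟩ := exists_eigenvector hp hD
    rw [← zero_add (τ • w)] at hw
    have h1 := key τ w 0 hτ hn hw
    rw [norm_zero, mul_zero] at h1
    have := mul_pos hpos (norm_pos_iff.2 hw0)
    linarith
  obtain ⟨S, hS⟩ := mem_resolventDomain_of_detfun_ne_zero hp hD
  refine ⟨S, hS, ?_⟩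
  rw [← norm_smul]
  refine ContinuousLinearMap.opNorm_le_bound _ (by positivity) fun f => ?_
  rw [_root_.smul_apply, norm_smul]
  have h1 : (S f, f + τ • S f) ∈ p.generator.graph :=
    (isResolventAt_iff.1 hS _ _).2 (by rw [add_sub_cancel_right])
  exact key τ (S f) f hτ hn (p.mem_graph_iff.1 h1)

end BubbleParams

/-! ## Location of the zeros of `Q` -/

namespace BubbleParams

variable (p : BubbleParams)

/-- `π² κ̄`, the distance of the poles of `Q` from the origin. -/
def gap : ℝ := Real.pi ^ 2 * p.kbar

/-- `3 p_* / (ρ_l R_*²)` -/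
def stiff : ℝ := 3 * p.ps / (p.rhol * p.Rs ^ 2)

/-- `p_{∞,*} R_* / (2 p_{∞,*} R_* + 6 σ)` -/
def eta : ℝ := p.pinf * p.Rs / (2 * p.pinf * p.Rs + 6 * p.sig)

/-- The factor `√(ϑ / (η + ϑ))`. -/
def shrink : ℝ := √(p.vartheta / (p.eta + p.vartheta))

/-- `∑ 1 / (j⁴ + u)` -/
def quarticSum (u : ℝ) : ℝ := ∑' j : ℕ, 1 / (((j : ℝ) + 1) ^ 4 + u)

theorem gap_pos : 0 < p.gap := by
  have := p.kbar_pos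
  have := Real.pi_pos
  unfold gap
  positivity

theorem gap_le_freq (k : ℕ) : p.gap ≤ p.freq k := by
  rw [freq_eq]
  refine le_mul_of_one_le_right p.gap_pos.le ?_
  have : (0 : ℝ) ≤ k := Nat.cast_nonneg k
  nlinarith

theorem ps_pos : 0 < p.ps := by
  have := p.Rg_pos
  have := p.Tinf_pos
  have := p.rhos_pos
  rw [p.ps_eq]
  positivity

theorem stiff_pos : 0 < p.stiff := by
  have := p.ps_pos
  have := p.rhol_pos
  have := p.Rs_pos
  unfold stiff
  positivity

theorem bcoef_mul_acoef : p.bcoef * p.acoef = p.stiff := by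
  have := p.rhol_pos.ne'
  have := p.Rs_pos.ne'
  unfold bcoef acoef stiff
  rw [p.ps_eq]
  field_simp

theorem nucoef_nonneg : 0 ≤ p.nucoef := by
  have := p.mul_nonneg
  have := p.rhol_pos
  have := p.Rs_pos
  unfold nucoef
  positivity

theorem scoef_nonneg : 0 ≤ p.scoef := by
  have := p.sig_nonneg
  have := p.rhol_pos
  have := p.Rs_pos
  unfold scoef
  positivity

theorem eta_pos : 0 < p.eta := by
  have := p.pinf_pos
  have := p.Rs_pos
  have := p.sig_nonneg
  unfold eta
  positivity

theorem eta_le : p.eta ≤ 1 / 2 := by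
  have h1 := _root_.mul_pos p.pinf_pos p.Rs_pos
  have h2 := p.sig_nonneg
  unfold eta
  rw [div_le_iff₀ (by linarith)]
  linarith

/-- Explains the value of `η`: it is the relative margin by which `stiff` exceeds `(2/3) stiff +
scoef`, the depth that `-pfun` may reach at a real point. -/
theorem eta_identity : (1 + p.eta) * (2 / 3 * p.stiff + p.scoef) = p.stiff := by
  have h1 := p.pinf_pos
  have h2 := p.Rs_pos
  have h3 := p.sig_nonneg
  have h4 := p.rhol_pos
  have h5 : 2 * p.pinf * p.Rs + 6 * p.sig ≠ 0 := by positivity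
  unfold eta stiff scoef
  rw [p.ps_eq']
  field_simp
  ring

theorem vartheta_pos : 0 < p.vartheta := by
  have := p.one_lt_gam
  unfold vartheta
  rw [sub_pos]
  rw [one_div]
  exact inv_lt_one_of_one_lt₀ this

theorem gam_mul_vartheta : p.gam * p.vartheta = p.gam - 1 := by
  have := p.gam_pos.ne'
  unfold vartheta
  field_simp

theorem shrink_pos : 0 < p.shrink := by
  have := p.vartheta_pos
  have := p.eta_pos
  exact Real.sqrt_pos.2 (by positivity)

theorem shrink_sq : p.shrink ^ 2 = p.vartheta / (p.eta + p.vartheta) := by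
  have := p.vartheta_pos
  have := p.eta_pos
  exact Real.sq_sqrt (by positivity)

theorem shrink_lt_one : p.shrink < 1 := by
  have h1 := p.vartheta_pos
  have h2 := p.eta_pos
  have h : p.shrink ^ 2 < 1 := by
    rw [shrink_sq, div_lt_one (by positivity)]
    linarith
  nlinarith [p.shrink_pos]

/-- With `x = η / ϑ`, this is `√(1 + x) ≤ 1 + x / 2`. The first rate thus uses only half of the
margin `η`. -/
theorem vartheta_mul_shrink_inv_le : p.vartheta * (p.shrink⁻¹ - 1) ≤ p.eta / 2 := by
  have h1 := p.vartheta_pos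
  have h2 := p.eta_pos
  have h3 := p.shrink_pos
  have h4 : p.shrink⁻¹ ^ 2 = 1 + p.eta / p.vartheta := by
    rw [inv_pow, shrink_sq, inv_div]
    field_simp
    ring
  have h5 : p.shrink⁻¹ ≤ 1 + p.eta / p.vartheta / 2 := by
    refine le_of_sq_le_sq ?_ (by positivity)
    rw [h4]
    nlinarith [sq_nonneg (p.eta / p.vartheta)]
  calc p.vartheta * (p.shrink⁻¹ - 1) ≤ p.vartheta * (p.eta / p.vartheta / 2) := by
        gcongr; linarith
    _ = p.eta / 2 := by field_simp

theorem summable_quartic {u : ℝ} (hu : 0 ≤ u) :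
    Summable fun j : ℕ => 1 / (((j : ℝ) + 1) ^ 4 + u) := by
  have h : Summable fun j : ℕ => 1 / ((j : ℝ) + 1) ^ 4 := by
    have := (summable_nat_add_iff 1).2 (Real.summable_one_div_nat_pow (p := 4).2 (by norm_num))
    simpa using this
  refine h.of_nonneg_of_le (fun j => by positivity) fun j => ?_
  gcongr
  linarith

theorem quarticSum_pos {u : ℝ} (hu : 0 ≤ u) : 0 < quarticSum u :=
  (summable_quartic hu).tsum_pos (fun j => by positivity) 0 (by positivity)

theorem sq_ratio {ε : ℝ} (hε : ε < 1) :
    (√(1 - ε) * p.ratio) ^ 2 = (1 - ε) * (2 / 3 * p.stiff) / p.gap ^ 2 := by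
  have h1 := p.stiff_pos
  have h2 : 2 * p.ps / (p.rhol * p.Rs ^ 2) = 2 / 3 * p.stiff := by
    unfold stiff; ring
  rw [ratio, h2, mul_pow, Real.sq_sqrt (by linarith), mul_pow, Real.sq_sqrt (by positivity)]
  change (1 - ε) * ((1 / p.gap) ^ 2 * _) = _
  ring

theorem Disc_eq : p.Disc = (2 * p.rhol * p.Rs) ^ 2 * (p.nucoef ^ 2 / 4 - 2 / 3 * p.stiff) := by
  have h1 := p.rhol_pos.ne'
  have h2 := p.Rs_pos.ne'
  unfold Disc nucoef stiff
  field_simp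
  ring

/-- The gain of the third rate in the underdamped case. -/
def gain (ε : ℝ) : ℝ :=
  4 / 3 * (1 - ε) ^ 2 * p.vartheta * p.stiff / (Real.pi ^ 2 * p.gap) *
    quarticSum ((1 - ε) * (2 / 3 * p.stiff) / p.gap ^ 2)

/-- The terms `4π⁴/90` cancel against those in `remainder`, leaving the full quartic sum. The two
indicator terms become one case distinction. -/
theorem rate_eq {ε : ℝ} (hε : ε < 1) :
    p.rate ε = min (min ((1 - p.shrink) * p.gap) √(ε * (2 / 3 * p.stiff)))
      (if p.Disc ≤ 0 then p.nucoef / 2 + p.gain ε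
        else p.nucoef / 2 - √(p.nucoef ^ 2 / 4 - 2 / 3 * p.stiff)) := by
  have h1 := p.rhol_pos
  have h2 := p.Rs_pos
  have h3 := p.kbar_pos
  have h4 := Real.pi_pos
  have e1 : 2 * p.ps / (p.rhol * p.Rs ^ 2) = 2 / 3 * p.stiff := by
    unfold stiff; ring
  have e2 : 2 * p.mul / (p.rhol * p.Rs ^ 2) = p.nucoef / 2 := by
    unfold nucoef; ring
  have e3 : (1 - ε) ^ 2 * p.vartheta * p.ps / (Real.pi ^ 4 * p.kbar * p.rhol * p.Rs ^ 2) *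
      (4 * Real.pi ^ 4 / 90 + p.remainder ε) = p.gain ε := by
    rw [remainder, p.sq_ratio hε, gain, quarticSum, stiff, gap]
    field_simp
    ring
  have e4 : √p.Disc / (2 * p.rhol * p.Rs) = √(p.nucoef ^ 2 / 4 - 2 / 3 * p.stiff) := by
    rw [Disc_eq, Real.sqrt_mul (by positivity), Real.sqrt_sq (by positivity)]
    field_simp
  rw [rate, e1, e2, e3, e4]
  change min (min ((1 - p.shrink) * p.gap) _) _ = _
  congr 1
  by_cases h : p.Disc ≤ 0
  · rw [if_pos h, if_pos h, if_neg (not_lt.2 h), sub_zero]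
  · rw [if_neg h, if_neg h, if_pos (not_le.1 h), add_zero]

theorem gain_pos {ε : ℝ} (hε : ε < 1) : 0 < p.gain ε := by
  have h1 := p.stiff_pos
  have h2 := p.gap_pos
  have h3 := p.vartheta_pos
  have h4 := Real.pi_pos
  have h5 : 0 < 1 - ε := by linarith
  have := quarticSum_pos (u := (1 - ε) * (2 / 3 * p.stiff) / p.gap ^ 2) (by positivity)
  unfold gain
  positivity

theorem rate_pos {ε : ℝ} (hε₀ : 0 < ε) (hε : ε < 1) : 0 < p.rate ε := by
  have h1 := p.stiff_pos
  have h2 := p.nucoef_nonneg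
  rw [p.rate_eq hε]
  refine lt_min (lt_min ?_ ?_) ?_
  · exact _root_.mul_pos (by linarith [p.shrink_lt_one]) p.gap_pos
  · exact Real.sqrt_pos.2 (by positivity)
  · split_ifs with h
    · linarith [p.gain_pos hε]
    · rw [Disc_eq, not_le] at h
      have h3 := p.rhol_pos
      have h4 := p.Rs_pos
      have h5 : 0 < p.nucoef ^ 2 / 4 - 2 / 3 * p.stiff := pos_of_mul_pos_right h (by positivity)
      have h6 : 0 < p.nucoef := h2.lt_of_ne fun h => by rw [← h] at h5; linarith
      rw [sub_pos, Real.sqrt_lt' (by positivity)]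
      linarith

theorem rate_lt_gap {ε : ℝ} (hε : ε < 1) : p.rate ε < p.gap := by
  rw [p.rate_eq hε]
  refine ((min_le_left _ _).trans (min_le_left _ _)).trans_lt ?_
  nlinarith [p.shrink_pos, p.gap_pos]

/-! ### The thermal response to the right of the first pole -/

section Zero

variable {p} {τ : ℂ}

theorem freq_add_ne_zero (hτ : -p.gap < τ.re) (k : ℕ) : (p.freq k : ℂ) + τ ≠ 0 := by
  intro h
  have := congrArg Complex.re h
  simp only [Complex.add_re, Complex.ofReal_re, Complex.zero_re] at this
  linarith [p.gap_le_freq k]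

/-- Since every `q_k` is at least `gap`, this half-plane gives `|q_k + τ| ≥ shrink · q_k`. So every
quotient in `hasSum_yfun` is at most `1 / shrink`, and `|yfun| ≤ 1 + ϑ (1 / shrink - 1)`. -/
theorem norm_yfun_le (hτ : -((1 - p.shrink) * p.gap) ≤ τ.re) : ‖p.yfun τ‖ ≤ 1 + p.eta / 2 := by
  have h0 := p.shrink_pos
  have h1 := p.gap_pos
  have hg := p.gam_pos
  have hne := freq_add_ne_zero (p := p) (τ := τ) (by nlinarith)
  have h2 : ∀ k, ‖p.freq k * ((p.freq k : ℂ) + τ)⁻¹‖ ≤ p.shrink⁻¹ := by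
    intro k
    have hq := p.freq_pos k
    have h3 : p.shrink * p.freq k ≤ ‖(p.freq k : ℂ) + τ‖ := by
      refine le_trans ?_ (Complex.re_le_norm _)
      simp only [Complex.add_re, Complex.ofReal_re]
      nlinarith [p.gap_le_freq k, p.shrink_lt_one]
    rw [norm_mul, norm_inv, Complex.norm_real, Real.norm_eq_abs, abs_of_pos hq,
      ← div_eq_mul_inv, div_le_iff₀ (norm_pos_iff.2 (hne k))]
    calc p.freq k = p.shrink⁻¹ * (p.shrink * p.freq k) := by field_simp
      _ ≤ _ := by gcongr
  have h3 : ‖p.gam * p.yfun τ - 1‖ ≤ (p.gam - 1) * p.shrink⁻¹ := by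
    refine (p.hasSum_yfun hne).norm_le_of_bounded (p.hasSum_Gam_sq'.mul_right _) fun k => ?_
    rw [norm_mul, Complex.norm_real, Real.norm_eq_abs,
      abs_of_nonneg (_root_.mul_nonneg p.mcoef_pos.le (sq_nonneg _))]
    exact mul_le_mul_of_nonneg_left (h2 k) (_root_.mul_nonneg p.mcoef_pos.le (sq_nonneg _))
  have h4 : p.gam * ‖p.yfun τ‖ ≤ 1 + (p.gam - 1) * p.shrink⁻¹ := by
    have h5 : p.gam * ‖p.yfun τ‖ = ‖p.gam * p.yfun τ‖ := by
      rw [norm_mul, Complex.norm_real, Real.norm_eq_abs, abs_of_pos hg]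
    rw [h5]
    calc ‖p.gam * p.yfun τ‖ = ‖1 + (p.gam * p.yfun τ - 1)‖ := by congr 1; ring
      _ ≤ ‖(1 : ℂ)‖ + _ := norm_add_le _ _
      _ ≤ _ := by rw [norm_one]; gcongr
  rw [← p.gam_mul_vartheta] at h4
  have h5 := mul_le_mul_of_nonneg_left p.vartheta_mul_shrink_inv_le hg.le
  have h6 := p.gam_mul_vartheta
  refine le_of_mul_le_mul_left ?_ hg
  nlinarith

theorem yfun_of_im_eq_zero (hτ : -p.gap < τ.re) (him : τ.im = 0) :
    (p.yfun τ).im = 0 ∧ 0 < (p.yfun τ).re := by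
  have hg := p.gam_pos
  have h := p.hasSum_yfun (freq_add_ne_zero hτ)
  have hterm : ∀ k, ((p.mcoef * p.Gam k ^ 2 : ℝ) : ℂ) * (p.freq k * ((p.freq k : ℂ) + τ)⁻¹)
      = ((p.mcoef * p.Gam k ^ 2 * (p.freq k * (p.freq k + τ.re)⁻¹) : ℝ) : ℂ) := by
    intro k
    have e : τ = (τ.re : ℂ) := Complex.ext rfl (by simpa using him)
    rw [e]
    push_cast
    rfl
  simp only [hterm] at h
  have h1 := Complex.imCLM.hasSum h
  have h2 := Complex.reCLM.hasSum h
  simp only [Complex.imCLM_apply, Complex.reCLM_apply, Complex.ofReal_im,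
    Complex.ofReal_re, Complex.sub_im, Complex.sub_re, Complex.one_im, Complex.one_re,
    Complex.im_ofReal_mul, Complex.re_ofReal_mul, sub_zero] at h1 h2
  have h3 := h2.nonneg fun k => by
    have h4 := p.freq_pos k
    have h5 : 0 < p.freq k + τ.re := by linarith [p.gap_le_freq k]
    have := p.mcoef_pos
    positivity
  constructor
  · have := h1.unique hasSum_zero
    simpa [hg.ne'] using this
  · exact pos_of_mul_pos_right (by linarith : 0 < p.gam * (p.yfun τ).re) hg.le

/-- The factors `(k + 1)²` cancel, so the series for `Im yfun` has equal weights; this is why an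
unweighted quartic sum appears in the rate. -/
theorem mcoef_mul_Gam_sq_mul_freq (k : ℕ) :
    p.mcoef * p.Gam k ^ 2 * p.freq k = 6 / Real.pi ^ 2 * (p.gam - 1) * p.gap := by
  have hk : (k : ℝ) + 1 ≠ 0 := by positivity
  rw [mcoef_mul_Gam_sq, freq_eq, gap]
  field_simp

theorem hasSum_im_yfun (hτ : -p.gap < τ.re) (him : τ.im ≠ 0) :
    HasSum (fun k => 6 / Real.pi ^ 2 * (p.gam - 1) * p.gap *
      (1 / ((p.freq k + τ.re) ^ 2 + τ.im ^ 2))) (-(p.gam * (p.yfun τ).im) / τ.im) := by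
  have h := Complex.imCLM.hasSum (p.hasSum_yfun (freq_add_ne_zero hτ))
  have h1 := h.mul_left (-(τ.im)⁻¹)
  have e : -(τ.im)⁻¹ * Complex.imCLM (p.gam * p.yfun τ - 1)
      = -(p.gam * (p.yfun τ).im) / τ.im := by
    simp [div_eq_mul_inv]
    ring
  rw [e] at h1
  refine h1.congr_fun fun k => ?_
  have h2 : 0 < (p.freq k + τ.re) ^ 2 + τ.im ^ 2 := by positivity
  simp only [Complex.imCLM_apply]
  rw [Complex.im_ofReal_mul, Complex.im_ofReal_mul, Complex.inv_im, Complex.normSq_apply,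
    ← p.mcoef_mul_Gam_sq_mul_freq k]
  simp only [Complex.add_re, Complex.add_im, Complex.ofReal_re, Complex.ofReal_im, zero_add]
  rw [← sq, ← sq]
  field_simp

end Zero

end BubbleParams

/-! ### Exclusion of zeros to the right of the decay rate -/

namespace BubbleParams

variable {p : BubbleParams} {τ : ℂ}

theorem pfun_re : (p.pfun τ).re = τ.re ^ 2 - τ.im ^ 2 + p.nucoef * τ.re - p.scoef := by
  simp [pfun, sq]

theorem pfun_im : (p.pfun τ).im = τ.im * (2 * τ.re + p.nucoef) := by
  simp [pfun, sq]
  ring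

theorem detfun_eq_zero_iff : p.detfun τ = 0 ↔
    (p.yfun τ).re * (p.pfun τ).re - (p.yfun τ).im * (p.pfun τ).im = -p.stiff ∧
      (p.yfun τ).re * (p.pfun τ).im + (p.yfun τ).im * (p.pfun τ).re = 0 := by
  have h : (p.bcoef : ℂ) * p.acoef = p.stiff := by exact_mod_cast p.bcoef_mul_acoef
  rw [detfun, h, Complex.ext_iff]
  simp [add_eq_zero_iff_eq_neg]

/-- No real zeros to the right of the decay rate. -/
theorem detfun_ne_zero_of_im_eq_zero (h₁ : -((1 - p.shrink) * p.gap) ≤ τ.re)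
    (h₂ : -(2 / 3 * p.stiff) ≤ τ.re ^ 2 + p.nucoef * τ.re) (him : τ.im = 0) :
    p.detfun τ ≠ 0 := by
  intro hD
  have hgap : -p.gap < τ.re := by nlinarith [p.shrink_pos, p.gap_pos]
  obtain ⟨hyi, hyr⟩ := yfun_of_im_eq_zero hgap him
  have h := (detfun_eq_zero_iff.1 hD).1
  rw [hyi, zero_mul, sub_zero, pfun_re, him] at h
  have hy : (p.yfun τ).re ≤ 1 + p.eta / 2 := (Complex.re_le_norm _).trans (norm_yfun_le h₁)
  have hc : 0 < 2 / 3 * p.stiff + p.scoef := by linarith [p.stiff_pos, p.scoef_nonneg]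
  have hη := p.eta_pos
  have e := p.eta_identity
  -- At a zero this would give `stiff ≤ (1 + η/2)(2/3 stiff + scoef)`, strictly less than `(1 +
  -- η)(2/3 stiff + scoef) = stiff`.
  have h3 : (p.yfun τ).re * -(2 / 3 * p.stiff + p.scoef)
      ≤ (p.yfun τ).re * (τ.re ^ 2 - 0 ^ 2 + p.nucoef * τ.re - p.scoef) :=
    mul_le_mul_of_nonneg_left (by linarith) hyr.le
  have h4 := mul_le_mul_of_nonneg_right hy hc.le
  have h5 := _root_.mul_pos hη hc
  linarith

/-- The size of the quadratic factor at a zero off the real axis. -/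
theorem normSq_pfun_ge (hD : p.detfun τ = 0) (h₁ : -((1 - p.shrink) * p.gap) ≤ τ.re) :
    (4 / 5 * p.stiff) ^ 2 ≤ (p.pfun τ).re ^ 2 + (p.pfun τ).im ^ 2 := by
  have hB := p.stiff_pos
  -- From `η ≤ 1/2` comes `1 + η/2 ≤ 5/4`, so `|pfun| = stiff / |yfun| ≥ (4/5) stiff`.
  have hy : ‖p.yfun τ‖ ≤ 5 / 4 := (norm_yfun_le h₁).trans (by linarith [p.eta_le])
  have h : (p.bcoef : ℂ) * p.acoef = p.stiff := by exact_mod_cast p.bcoef_mul_acoef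
  rw [detfun, h, add_eq_zero_iff_eq_neg] at hD
  have h2 := congrArg norm hD
  rw [norm_mul, norm_neg, Complex.norm_real, Real.norm_eq_abs, abs_of_pos hB] at h2
  have h3 : 4 / 5 * p.stiff ≤ ‖p.pfun τ‖ := by
    have := mul_le_mul_of_nonneg_right hy (norm_nonneg (p.pfun τ))
    linarith
  have h4 : (p.pfun τ).re ^ 2 + (p.pfun τ).im ^ 2 = ‖p.pfun τ‖ ^ 2 := by
    rw [← Complex.normSq_eq_norm_sq, Complex.normSq_apply]
    ring
  rw [h4]
  gcongr

/-- The real part without `scoef` is nonpositive, so subtracting `scoef` only enlarges its modulus.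
What remains is `τ (τ + ν)`, and each factor has modulus at least `|Im τ|`. -/
theorem pow_im_le_normSq_pfun (h : τ.re ^ 2 ≤ τ.im ^ 2 - p.nucoef * τ.re) :
    (τ.im ^ 2) ^ 2 ≤ (p.pfun τ).re ^ 2 + (p.pfun τ).im ^ 2 := by
  have hs := p.scoef_nonneg
  rw [pfun_re, pfun_im]
  set u := τ.re ^ 2 - τ.im ^ 2 + p.nucoef * τ.re with hu
  have hu0 : u ≤ 0 := by linarith
  have h1 : u ^ 2 ≤ (u - p.scoef) ^ 2 := by nlinarith
  have h2 : u ^ 2 + (τ.im * (2 * τ.re + p.nucoef)) ^ 2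
      = (τ.re ^ 2 + τ.im ^ 2) * ((τ.re + p.nucoef) ^ 2 + τ.im ^ 2) := by
    rw [hu]; ring
  have h3 : (τ.im ^ 2) ^ 2 ≤ (τ.re ^ 2 + τ.im ^ 2) * ((τ.re + p.nucoef) ^ 2 + τ.im ^ 2) := by
    rw [sq (τ.im ^ 2)]
    gcongr <;> nlinarith [sq_nonneg τ.re, sq_nonneg (τ.re + p.nucoef)]
  linarith

/-- A zero off the real axis is more strongly damped than by viscosity alone. -/
theorem gain_lt_of_detfun_eq_zero {ε : ℝ} (hε₀ : 0 < ε) (hε : ε < 1) (hD : p.detfun τ = 0)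
    (him : τ.im ≠ 0) (h₁ : -((1 - p.shrink) * p.gap) ≤ τ.re) :
    τ.re < -(p.nucoef / 2) ∧
      (-√(ε * (2 / 3 * p.stiff)) ≤ τ.re → τ.re < -(p.nucoef / 2 + p.gain ε)) := by
  have hB := p.stiff_pos
  have hg := p.gam_pos
  have hg1 := p.one_lt_gam
  have hgp := p.gap_pos
  have hν := p.nucoef_nonneg
  have hpi := Real.pi_pos
  have hgap : -p.gap < τ.re := by nlinarith [p.shrink_pos]
  have hS := hasSum_im_yfun hgap him
  set S := -(p.gam * (p.yfun τ).im) / τ.im with hSdef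
  set N := (p.pfun τ).re ^ 2 + (p.pfun τ).im ^ 2 with hN
  set W := 6 / Real.pi ^ 2 * (p.gam - 1) * p.gap with hW
  have hW0 : 0 < W := _root_.mul_pos (_root_.mul_pos (by positivity) (by linarith)) hgp
  have hω : 0 < τ.im ^ 2 := by positivity
  have hNB := normSq_pfun_ge hD h₁
  rw [← hN] at hNB
  have hS0 : 0 < S := by
    refine hasSum_lt (i := 0) (fun k => ?_) ?_ hasSum_zero hS <;> positivity
  -- Combining the real and imaginary parts of the equation eliminates `Re yfun` and leaves `Im yfun
  -- · |pfun|² = stiff · Im pfun`, where `Im pfun` contains the factor `2 Re τ + ν`. Positivity of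
  -- `S` then gives the viscous damping.
  have hkey : N * S = p.gam * p.stiff * -(2 * τ.re + p.nucoef) := by
    obtain ⟨e1, e2⟩ := detfun_eq_zero_iff.1 hD
    have e3 : (p.yfun τ).im * N = p.stiff * (p.pfun τ).im := by
      rw [hN]
      linear_combination (p.pfun τ).re * e2 - (p.pfun τ).im * e1
    rw [pfun_im] at e3
    rw [hSdef]
    field_simp
    linear_combination -e3
  have hN0 : 0 < N := lt_of_lt_of_le (by positivity) hNB
  have hpos := _root_.mul_pos hN0 hS0
  have hre : 0 < -(2 * τ.re + p.nucoef) := by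
    rw [hkey] at hpos
    exact pos_of_mul_pos_right hpos (by positivity)
  refine ⟨by linarith, fun h₂ => ?_⟩
  -- Chosen so that both `V²` and `V (Im τ)²` are at most `N`. Together these bound every term of `N
  -- S` below by the corresponding term of the quartic series.
  set V := (1 - ε) * (2 / 3 * p.stiff) with hV
  have hV0 : 0 < V := _root_.mul_pos (by linarith) (by positivity)
  have hVB : V ≤ 2 / 3 * p.stiff := by
    rw [hV]; nlinarith
  have hNV : V ^ 2 ≤ N := le_trans (by gcongr; linarith) hNB
  have hNω : V * τ.im ^ 2 ≤ N := by
    -- For small `Im τ` the bound `N ≥ ((4/5) stiff)²` suffices. For large `Im τ` the second rate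
    -- keeps `(Re τ)²` below `(Im τ)²`, so that `N ≥ (Im τ)⁴`.
    rcases le_or_gt (τ.im ^ 2) (2 / 3 * p.stiff) with h | h
    · refine le_trans ?_ hNB
      calc V * τ.im ^ 2 ≤ (2 / 3 * p.stiff) * (2 / 3 * p.stiff) := by gcongr
        _ ≤ _ := by nlinarith
    · have h3 : τ.re ^ 2 ≤ 2 / 3 * p.stiff := by
        have h4 : (-τ.re) ^ 2 ≤ √(ε * (2 / 3 * p.stiff)) ^ 2 := by
          gcongr <;> linarith
        rw [neg_sq, Real.sq_sqrt (by positivity)] at h4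
        nlinarith
      refine le_trans ?_ (pow_im_le_normSq_pfun (by nlinarith))
      rw [sq (τ.im ^ 2)]
      gcongr
      linarith
  have hT : HasSum (fun k => W * (V ^ 2 / (p.freq k ^ 2 + V)))
      (W * (V ^ 2 / p.gap ^ 2 * quarticSum (V / p.gap ^ 2))) := by
    refine (((summable_quartic (u := V / p.gap ^ 2) (by positivity)).hasSum.mul_left
      (V ^ 2 / p.gap ^ 2)).mul_left W).congr_fun fun k => ?_
    have : p.freq k = p.gap * ((k : ℝ) + 1) ^ 2 := p.freq_eq k
    rw [this]
    field_simp
  have hterm : ∀ k, W * (V ^ 2 / (p.freq k ^ 2 + V))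
      < N * (W * (1 / ((p.freq k + τ.re) ^ 2 + τ.im ^ 2))) := by
    intro k
    have hq := p.gap_le_freq k
    -- Here `Re τ < 0` while `q_k + Re τ > 0`, so dropping `Re τ` enlarges the square.
    have h3 : (p.freq k + τ.re) ^ 2 < p.freq k ^ 2 := by nlinarith
    have h4 : 0 < (p.freq k + τ.re) ^ 2 + τ.im ^ 2 := by positivity
    have h5 : 0 < p.freq k ^ 2 + V := by positivity
    have h6 : V ^ 2 * ((p.freq k + τ.re) ^ 2 + τ.im ^ 2) < N * (p.freq k ^ 2 + V) := by
      have i1 : V ^ 2 * (p.freq k + τ.re) ^ 2 < V ^ 2 * p.freq k ^ 2 := by gcongr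
      have i2 := mul_le_mul_of_nonneg_right hNV (sq_nonneg (p.freq k))
      have i3 := mul_le_mul_of_nonneg_right hNω hV0.le
      linarith
    have h7 : V ^ 2 / (p.freq k ^ 2 + V) < N / ((p.freq k + τ.re) ^ 2 + τ.im ^ 2) := by
      rw [div_lt_div_iff₀ h5 h4]
      exact h6
    calc _ < W * (N / ((p.freq k + τ.re) ^ 2 + τ.im ^ 2)) := by gcongr
      _ = _ := by ring
  have hlt := hasSum_lt (i := 0) (fun k => (hterm k).le) (hterm 0) hT (hS.mul_left N)
  rw [hkey] at hlt
  have hgain : W * (V ^ 2 / p.gap ^ 2 * quarticSum (V / p.gap ^ 2))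
      = p.gam * p.stiff * (2 * p.gain ε) := by
    rw [gain, ← hV, hW, ← p.gam_mul_vartheta, hV]
    field_simp
    ring
  rw [hgain] at hlt
  have := lt_of_mul_lt_mul_left hlt (by positivity)
  linarith

theorem re_lt_of_detfun_eq_zero {ε : ℝ} (hε₀ : 0 < ε) (hε : ε < 1) (hD : p.detfun τ = 0) :
    τ.re < -p.rate ε := by
  by_contra! h
  have hB := p.stiff_pos
  have hrate := p.rate_eq hε
  have h₁ : p.rate ε ≤ (1 - p.shrink) * p.gap := by
    rw [hrate]
    exact (min_le_left _ _).trans (min_le_left _ _)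
  have h₂ : p.rate ε ≤ √(ε * (2 / 3 * p.stiff)) := by
    rw [hrate]
    exact (min_le_left _ _).trans (min_le_right _ _)
  have h₃ := hrate.trans_le (min_le_right _ _)
  replace h₁ : -((1 - p.shrink) * p.gap) ≤ τ.re := by linarith
  replace h₂ : -√(ε * (2 / 3 * p.stiff)) ≤ τ.re := by linarith
  have hdisc := p.Disc_eq
  have hρ : 0 < (2 * p.rhol * p.Rs) ^ 2 := by
    have := p.rhol_pos
    have := p.Rs_pos
    positivity
  by_cases him : τ.im = 0
  · refine detfun_ne_zero_of_im_eq_zero h₁ ?_ him hD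
    -- The third rate guarantees `x² + ν x + (2/3) stiff ≥ 0` at `x = Re τ`. For `Δ ≤ 0` this
    -- quadratic is never negative; for `Δ > 0` the point lies to the right of its larger root.
    split_ifs at h₃ with hΔ
    · have : p.nucoef ^ 2 / 4 - 2 / 3 * p.stiff ≤ 0 := by
        rw [hdisc] at hΔ
        exact nonpos_of_mul_nonpos_right hΔ hρ
      nlinarith [sq_nonneg (τ.re + p.nucoef / 2)]
    · have h5 : 0 ≤ p.nucoef ^ 2 / 4 - 2 / 3 * p.stiff := by
        rw [hdisc, not_le] at hΔ
        exact (pos_of_mul_pos_right hΔ hρ.le).le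
      have h6 := Real.sq_sqrt h5
      have h7 : √(p.nucoef ^ 2 / 4 - 2 / 3 * p.stiff) ≤ τ.re + p.nucoef / 2 := by linarith
      have h8 := pow_le_pow_left₀ (Real.sqrt_nonneg _) h7 2
      nlinarith
  · obtain ⟨i1, i2⟩ := gain_lt_of_detfun_eq_zero hε₀ hε hD him h₁
    split_ifs at h₃ with hΔ
    · linarith [i2 h₂]
    · linarith [Real.sqrt_nonneg (p.nucoef ^ 2 / 4 - 2 / 3 * p.stiff)]

variable (p)

theorem re_lt_of_mem_zerosQ {ε : ℝ} (hε₀ : 0 < ε) (hε : ε < 1) {τ : ℂ} (h : τ ∈ p.zerosQ) :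
    τ.re < -p.rate ε :=
  re_lt_of_detfun_eq_zero hε₀ hε ((p.Q_eq_zero_iff τ).1 h.2)

/-- Resonances cause no trouble: they are poles, and the rate is smaller than the distance `gap` of
the nearest pole from the origin. -/
theorem mem_resolventDomain_of_neg_rate_le {ε : ℝ} (hε₀ : 0 < ε) (hε : ε < 1) {τ : ℂ}
    (h : -p.rate ε ≤ τ.re) : τ ∈ resolventDomain p.generator := by
  by_contra hn
  rcases (p.notMem_resolventDomain_iff τ).1 hn with h1 | ⟨⟨j, hj⟩, -⟩
  · linarith [p.re_lt_of_mem_zerosQ hε₀ hε h1]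
  · rw [hj, pole_eq, Complex.neg_re, Complex.ofReal_re] at h
    linarith [p.rate_lt_gap hε, p.gap_le_freq j]

/-! ## The remainder in the decay rate -/

theorem ratio_nonneg : 0 ≤ p.ratio := by
  have := p.gap_pos
  change 0 ≤ 1 / p.gap * _
  positivity

theorem hasSum_one_div_succ_pow_four :
    HasSum (fun j : ℕ => 1 / ((j : ℝ) + 1) ^ 4) (Real.pi ^ 4 / 90) := by
  have h := (hasSum_nat_add_iff' (f := fun n : ℕ => (1 : ℝ) / (n : ℝ) ^ 4) 1).mpr hasSum_zeta_four
  simpa using h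

theorem summable_one_div_succ_pow_seven : Summable fun j : ℕ => 1 / ((j : ℝ) + 1) ^ 7 := by
  have := (summable_nat_add_iff 1).2 (Real.summable_one_div_nat_pow (p := 7).2 (by norm_num))
  simpa using this

/-- Each term of the difference is `v⁴ / (y⁴ (y⁴ + v⁴))`, and `v y³ ≤ y⁴ + v⁴` trades one power of
`v` for the summable `1 / y⁷`. With `v² = √(1 - ε) X` the power `v³` is the stated order of the
remainder. -/
theorem abs_quarticSum_sub_le {v : ℝ} (hv : 0 ≤ v) :
    |quarticSum (v ^ 4) - Real.pi ^ 4 / 90| ≤ (∑' j : ℕ, 1 / ((j : ℝ) + 1) ^ 7) * v ^ 3 := by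
  have h := hasSum_one_div_succ_pow_four.sub (summable_quartic (u := v ^ 4) (by positivity)).hasSum
  rw [abs_sub_comm, ← Real.norm_eq_abs]
  refine h.norm_le_of_bounded (summable_one_div_succ_pow_seven.hasSum.mul_right (v ^ 3)) fun j => ?_
  set y := (j : ℝ) + 1 with hy
  have hy0 : 0 < y := by positivity
  have e : 1 / y ^ 4 - 1 / (y ^ 4 + v ^ 4) = v ^ 4 / (y ^ 4 * (y ^ 4 + v ^ 4)) := by
    field_simp
    ring
  have h1 : v * y ^ 3 ≤ y ^ 4 + v ^ 4 := by
    rcases le_total v y with hvy | hvy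
    · calc v * y ^ 3 ≤ y * y ^ 3 := by gcongr
        _ ≤ y ^ 4 + v ^ 4 := by nlinarith [pow_nonneg hv 4]
    · calc v * y ^ 3 ≤ v * v ^ 3 := by gcongr
        _ ≤ y ^ 4 + v ^ 4 := by nlinarith [pow_pos hy0 4]
  rw [e, Real.norm_eq_abs, abs_of_nonneg (by positivity), one_div_mul_eq_div,
    div_le_div_iff₀ (by positivity) (by positivity)]
  calc v ^ 4 * y ^ 7 = v ^ 3 * y ^ 4 * (v * y ^ 3) := by ring
    _ ≤ v ^ 3 * y ^ 4 * (y ^ 4 + v ^ 4) := by gcongr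
    _ = v ^ 3 * (y ^ 4 * (y ^ 4 + v ^ 4)) := by ring

theorem abs_remainder_le {ε : ℝ} (hε : ε < 1) :
    |p.remainder ε| ≤ 4 * (∑' j : ℕ, 1 / ((j : ℝ) + 1) ^ 7) *
      ((1 - ε) ^ (3 / 4 : ℝ) * p.ratio ^ (3 / 2 : ℝ)) := by
  have h1 : 0 ≤ 1 - ε := by linarith
  have h2 := p.ratio_nonneg
  set v := √(√(1 - ε) * p.ratio) with hv
  have hv0 : 0 ≤ v := Real.sqrt_nonneg _
  have hv2 : v ^ 2 = √(1 - ε) * p.ratio := Real.sq_sqrt (by positivity)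
  have e1 : p.remainder ε = 4 * (quarticSum (v ^ 4) - Real.pi ^ 4 / 90) := by
    rw [remainder, quarticSum, ← hv2, ← pow_mul]
    ring
  have e2 : v ^ 3 = (1 - ε) ^ (3 / 4 : ℝ) * p.ratio ^ (3 / 2 : ℝ) := by
    rw [hv, Real.sqrt_eq_rpow, Real.sqrt_eq_rpow, ← Real.rpow_natCast,
      ← Real.rpow_mul (by positivity), Real.mul_rpow (by positivity) h2, ← Real.rpow_mul h1]
    norm_num
  rw [e1, abs_mul, abs_of_pos (by norm_num : (0 : ℝ) < 4), ← e2, mul_assoc]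
  gcongr
  exact abs_quarticSum_sub_le hv0

end BubbleParams

/-! ### Uniform resolvent bound on the half-plane -/

namespace BubbleParams

variable (p : BubbleParams)

theorem exists_resolvent_bound {ε : ℝ} (hε₀ : 0 < ε) (hε : ε < 1) :
    ∃ C : ℝ, ∀ τ : ℂ, -p.rate ε ≤ τ.re →
      ∃ S : EllTwo →L[ℂ] EllTwo, IsResolventAt p.generator τ S ∧ ‖S‖ ≤ C := by
  obtain ⟨ρ, M₀, h⟩ := p.exists_hasSectorEstimate
  obtain ⟨δ, M, hδ, hw⟩ := h.exists_hasWedgeResolvent (p.rate_pos hε₀ hε)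
    fun _ => p.mem_resolventDomain_of_neg_rate_le hε₀ hε
  refine ⟨M, fun τ hτ => ?_⟩
  have hmem : τ ∈ wedge (-p.rate ε) δ := by
    have := _root_.mul_nonneg hδ.le (abs_nonneg τ.im)
    simp only [wedge, Set.mem_ofPred_eq]
    linarith
  exact ⟨_, isResolventAt_resolventFun (hw.mem hmem), hw.norm_le hmem⟩

end BubbleParams

end

/-! ### Assembly of the proposition -/

theorem proposition2p3 :
    (∃ K : ℝ, ∀ (p : BubbleParams) (ε : ℝ), 0 < ε → ε < 1 →
      |p.remainder ε| ≤ K * ((1 - ε) ^ (3 / 4 : ℝ) * p.ratio ^ (3 / 2 : ℝ))) ∧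
    ∀ p : BubbleParams,
      unboundedSpectrum p.generator = p.zerosQ ∪ p.resonances ∧
      (p.resonances = ∅ → unboundedSpectrum p.generator = p.zerosQ) ∧
      (∀ ε : ℝ, 0 < ε → ε < 1 →
        0 < p.rate ε ∧
        (∀ τ ∈ p.zerosQ, τ.re < -p.rate ε) ∧
        ∃ C : ℝ, ∀ τ : ℂ, -p.rate ε ≤ τ.re →
          ∃ S : EllTwo →L[ℂ] EllTwo, IsResolventAt p.generator τ S ∧ ‖S‖ ≤ C) ∧
      IsSectorial (-p.generator) ∧
      ∃ T : ℝ → EllTwo →L[ℂ] EllTwo,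
        IsAnalyticSemigroup T ∧ IsGenerator p.generator T ∧
        ∀ ε : ℝ, 0 < ε → ε < 1 →
          ∃ C : ℝ, 0 < C ∧ ∀ t : ℝ, 0 ≤ t → ‖T t‖ ≤ C * Real.exp (-p.rate ε * t) := by

  refine ⟨⟨_, fun p ε _ hε => p.abs_remainder_le hε⟩, fun p => ?_⟩
  obtain ⟨ρ, M, hsec⟩ := p.exists_hasSectorEstimate
  refine ⟨p.unboundedSpectrum_generator, fun h => ?_, fun ε hε₀ hε =>
    ⟨p.rate_pos hε₀ hε, fun τ hτ => p.re_lt_of_mem_zerosQ hε₀ hε hτ,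
      p.exists_resolvent_bound hε₀ hε⟩, hsec.isSectorial_neg p.generator_dense, ?_⟩
  · rw [p.unboundedSpectrum_generator, h, Set.union_empty]
  -- The semigroup is constructed once for the whole family of rates, so that `T` does not depend on
  -- `ε`.
  · have : Nonempty {ε : ℝ // 0 < ε ∧ ε < 1} := ⟨⟨1 / 2, by norm_num, by norm_num⟩⟩
    obtain ⟨T, hT, hgen, hdecay⟩ := hsec.exists_semigroup p.generator_dense
      (fun ε : {ε : ℝ // 0 < ε ∧ ε < 1} => p.rate ε) (fun ε => p.rate_pos ε.2.1 ε.2.2)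
      fun ε _ => p.mem_resolventDomain_of_neg_rate_le ε.2.1 ε.2.2
    exact ⟨T, hT, hgen, fun ε hε₀ hε => hdecay ⟨ε, hε₀, hε⟩⟩
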